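/- Let $\Gamma=\mathrm{PSL}_2(\mathbb Z)$ act on the upper half-plane $\mathbb H$ (with the hyperbolic metric), let $s_0=\left[\begin{smallmatrix}0&-1\\1&0\end{smallmatrix}\right]$, $u_1=\left[\begin{smallmatrix}0&1\\-1&1\end{smallmatrix}\right]$, $G_0=\langle s_0\rangle$, $G_1=\langle u_1\rangle$, $\rho=e^{\pi i/3}$, and let $\triangle$ be the hyperbolic triangle with vertices $0,\rho,\infty$, minus the vertices $0$ and $\infty$. Let $G\subset\Gamma$ be an arbitrary subgroup. Let $X_{\mathrm{comb}}(G)$ be the graph (multiple edges allowed) with edge set $G\backslash\Gamma$, whose vertices of type (0), respectively (1), are the $G_0$-orbits, respectively the $G_1$-orbits, in $G\backslash\Gamma$, an edge $x$ joining the two orbits that contain it. Let $\mathbf T=X_{\mathrm{comb}}(\{1\})$; its edges are the elements of $\Gamma$, its vertices are the left cosets of $G_0$ and of $G_1$ in $\Gamma$, and $G\backslash\mathbf T=X_{\mathrm{comb}}(G)$. Suppose that cutting $X_{\mathrm{comb}}(G)$ in some of its vertices of valency 2 (all of these are of type (0)) yields a tree $X'$, and let $\jmath:X'\to\mathbf T$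 be a morphism of graphs, preserving the types of the vertices, whose composition with $\mathbf T\to X_{\mathrm{comb}}(G)$ is the natural map $X'\to X_{\mathrm{comb}}(G)$. For an edge $x\in G\backslash\Gamma$ of $X'$ let $\jmath(x)\in\Gamma$ be its image. Put $$P=\bigcup_{x\in G\backslash\Gamma}\jmath(x)\cdot\triangle .$$ The edges of $P$, the involution $\sigma$ on the set of these edges and the elements $g_s\in\Gamma$ are defined as follows. * If $x$ is an edge of $X_{\mathrm{comb}}(G)$ that meets a cut vertex, then $xs_0$ is the other edge that meets it. There is an edge $s=s_x$ of $P$, the image under $\jmath(x)$ of the imaginary half-axis, and $\sigma(s_x)=s_{xs_0}$. The element $g_s$ takes $s$ to $\sigma(s)$ and reverses the orientations induced from $P$; explicitly, $g_s=\jmath(xs_0)s_0\jmath(x)^{-1}$. * If the vertex of type (0) of $x$ has valency 1 in $X_{\mathrm{comb}}(G)$, there are two edges $s',s''$ of $P$, the images under $\jmath(x)$ of the geodesics joining $i$ with $0$ and with $\infty$; $\sigma$ swaps them, and $g_{s'}=g_{s''}=\jmath(x)s_0\jmath(x)^{-1}$ is the element that swaps them. * If the vertex of type (1) of $x$ has valency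 1 in $X_{\mathrm{comb}}(G)$, there are two edges $s',s''$ of $P$, the images under $\jmath(x)$ of the geodesics joining $\rho$ with $0$ and with $\infty$; $\sigma$ swaps them, $g_{s''}=\jmath(x)u_1\jmath(x)^{-1}$ takes $s''$ to $s'$, and $g_{s'}=g_{s''}^{-1}$. **Theorem.** 1. The couple $(P,\sigma)$ is a special polygon. That is, $P$ is a convex hyperbolic polygon (closed, convex, with non-empty interior; its boundary is the union of the above edges, which are pairwise distinct geodesic arcs, form a locally finite family and meet only in their extremities), $\sigma$ is an involution on the set of the edges of $P$, and * any edge of $P$ is a $\Gamma$-copy of the geodesic that joins $\infty$ with $0$, $i$ or $\rho$; * any edge that is a $\Gamma$-copy of the geodesic joining $0$ and $\infty$ is paired under $\sigma$ with another such edge; * any edge $s$ that is a $\Gamma$-copy of the geodesic joining $i$ and $\infty$ is adjacent to another such edge $s'$ with $\sigma(s)=s'$, $\sigma(s')=s$, and the angle between $s$ and $s'$ is $\pi$; * any edge $s$ that is a $\Gamma$-copy of the geodesic joining $\rho$ and $\infty$ is adjacent to another such edge $s'$ with $\sigma(s)=s'$, $\sigma(s')=s$, and the internal angle between $s$ and $s'$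 is $\frac{2\pi}3$. If $(\Gamma:G)<\infty$, then the number of edges of $P$ is finite. 2. For every edge $s$ of $P$, $g_s$ is the unique element of $\Gamma$ that takes $s$ to $\sigma(s)$ reversing the orientations induced from $P$ (i.e., such that $g_sP$ and $P$ lie on opposite sides of $\sigma(s)$: the interiors of $g_sP$ and $P$ are disjoint), and $g_s\in G$. Let $S$ be a set of edges of $P$ that intersects every $\sigma$-orbit exactly once. Then the elements $g_s$, $s\in S$, are pairwise distinct and $\{g_s\mid s\in S\}$ is an independent set of generators of $G$, i.e., $G$ is the free product of the cyclic subgroups generated by the elements of this set. -/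

import Mathlib

open scoped UpperHalfPlane MatrixGroups Pointwise

noncomputable section

namespace ModularPolygon

/-! ### The modular group and its action on the upper half-plane -/

/-- The modular group `Γ = PSL₂(ℤ)`. -/
abbrev PSL2Z : Type := PSL(2, ℤ)

/-- The homomorphism from `Γ` to the permutations of `ℍ` induced by the Möbius action of
`SL₂(ℤ)`, whose centre acts trivially. -/
def moebiusHom : PSL2Z →* Equiv.Perm ℍ :=
  QuotientGroup.lift (Subgroup.center SL(2, ℤ)) (MulAction.toPermHom SL(2, ℤ) ℍ) (by
    intro A hA
    obtain ⟨r, hr, hA'⟩ := Matrix.SpecialLinearGroup.mem_center_iff.mp hA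
    have hr0 : (r : ℂ) ≠ 0 := by
      rintro h
      have h0 : r = 0 := by exact_mod_cast h
      simp [h0] at hr
    have h00 : A 0 0 = r := by rw [← hA', Matrix.scalar_apply]; simp
    have h01 : A 0 1 = 0 := by rw [← hA', Matrix.scalar_apply]; simp
    have h10 : A 1 0 = 0 := by rw [← hA', Matrix.scalar_apply]; simp
    have h11 : A 1 1 = r := by rw [← hA', Matrix.scalar_apply]; simp
    ext z
    change ((A • z : ℍ) : ℂ) = z
    rw [UpperHalfPlane.coe_specialLinearGroup_apply, h00, h01, h10, h11]
    simp [hr0])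

instance : MulAction PSL2Z ℍ := MulAction.compHom ℍ moebiusHom

theorem mk_smul (A : SL(2, ℤ)) (z : ℍ) : (QuotientGroup.mk A : PSL2Z) • z = A • z := rfl

/-- The class of `(0 -1; 1 0)`. -/
def s₀ : PSL2Z := QuotientGroup.mk ModularGroup.S

/-- The matrix `(0 1; -1 1)`. -/
def uMatrix : SL(2, ℤ) := ⟨!![0, 1; -1, 1], by simp [Matrix.det_fin_two_of]⟩

/-- The class of `(0 1; -1 1)`. -/
def u₁ : PSL2Z := QuotientGroup.mk uMatrix

/-- The subgroup `G₀` of order 2 generated by `s₀`. -/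
def G₀ : Subgroup PSL2Z := Subgroup.zpowers s₀

/-- The subgroup `G₁` of order 3 generated by `u₁`. -/
def G₁ : Subgroup PSL2Z := Subgroup.zpowers u₁

/-! ### Bipartite multigraphs -/

/-- A bipartite multigraph: vertices of type (0) and of type (1), and every edge joins a vertex of
type (0) with a vertex of type (1). Multiple edges are allowed. -/
structure BipGraph where
  Edge : Type
  Vert0 : Type
  Vert1 : Type
  end0 : Edge → Vert0
  end1 : Edge → Vert1

namespace BipGraph

/-- The number of edges that meet at a vertex of type (0). -/
def valency0 (X : BipGraph) (v : X.Vert0) : ℕ∞ := {e | X.end0 e = v}.encard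

/-- The number of edges that meet at a vertex of type (1). -/
def valency1 (X : BipGraph) (v : X.Vert1) : ℕ∞ := {e | X.end1 e = v}.encard

/-- The subdivision of `X`: a new vertex is put in the middle of every edge. This is a simple graph
with the same geometric realisation as `X`. -/
def subdivision (X : BipGraph) : SimpleGraph (X.Edge ⊕ (X.Vert0 ⊕ X.Vert1)) :=
  SimpleGraph.fromRel fun a b =>
    ∃ e : X.Edge, a = Sum.inl e ∧
      (b = Sum.inr (Sum.inl (X.end0 e)) ∨ b = Sum.inr (Sum.inr (X.end1 e)))

/-- A multigraph is a tree if its subdivision is one. (In particular a tree has no multiple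
edges.) -/
def IsTree (X : BipGraph) : Prop := X.subdivision.IsTree

/-- Morphisms of bipartite multigraphs that preserve the types of the vertices. -/
structure Hom (X Y : BipGraph) where
  onEdge : X.Edge → Y.Edge
  onVert0 : X.Vert0 → Y.Vert0
  onVert1 : X.Vert1 → Y.Vert1
  map_end0 : ∀ e, Y.end0 (onEdge e) = onVert0 (X.end0 e)
  map_end1 : ∀ e, Y.end1 (onEdge e) = onVert1 (X.end1 e)

/-- Composition of morphisms. -/
def Hom.comp {X Y Z : BipGraph} (q : Hom Y Z) (p : Hom X Y) : Hom X Z where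
  onEdge := q.onEdge ∘ p.onEdge
  onVert0 := q.onVert0 ∘ p.onVert0
  onVert1 := q.onVert1 ∘ p.onVert1
  map_end0 e := by simp [q.map_end0, p.map_end0]
  map_end1 e := by simp [q.map_end1, p.map_end1]

open Classical in
/-- The graph obtained from `X` by cutting it in all the vertices of the set `C` of vertices of
type (0): a vertex `v ∈ C` is replaced by several univalent vertices, one for each edge that meets
`v`. -/
def cut (X : BipGraph) (C : Set X.Vert0) : BipGraph where
  Edge := X.Edge
  Vert0 := {v : X.Vert0 // v ∉ C} ⊕ {e : X.Edge // X.end0 e ∈ C}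
  Vert1 := X.Vert1
  end0 e := if h : X.end0 e ∈ C then Sum.inr ⟨e, h⟩ else Sum.inl ⟨X.end0 e, h⟩
  end1 := X.end1

/-- The natural map from the cut graph to the original one. -/
def cutProj (X : BipGraph) (C : Set X.Vert0) : Hom (X.cut C) X where
  onEdge e := e
  onVert0 := Sum.elim (fun v => v.1) (fun e => X.end0 e.1)
  onVert1 v := v
  map_end0 e := by
    by_cases h : X.end0 e ∈ C <;> simp [cut, h]
  map_end1 _ := rfl

end BipGraph

/-! ### The graphs `X_comb(G)` and `T` -/

/-- The set `G \ Γ` of right cosets `Gγ`. -/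
abbrev RCoset (G : Subgroup PSL2Z) : Type := Quotient (QuotientGroup.rightRel G)

/-- The right coset `Gγ`. -/
def RCoset.of (G : Subgroup PSL2Z) (γ : PSL2Z) : RCoset G := Quotient.mk _ γ

/-- The right action of `Γ` on `G \ Γ`: `(Gγ) · δ = Gγδ`. -/
def RCoset.mulRight {G : Subgroup PSL2Z} (x : RCoset G) (δ : PSL2Z) : RCoset G :=
  Quotient.map' (s₁ := QuotientGroup.rightRel G) (s₂ := QuotientGroup.rightRel G)
    (fun γ => γ * δ) (by
      intro a b h
      rw [QuotientGroup.rightRel_apply] at h ⊢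
      simpa [mul_assoc] using h) x

theorem RCoset.mulRight_one {G : Subgroup PSL2Z} (x : RCoset G) : x.mulRight 1 = x := by
  induction x using Quotient.inductionOn'
  simp [RCoset.mulRight]

theorem RCoset.mulRight_mul {G : Subgroup PSL2Z} (x : RCoset G) (a b : PSL2Z) :
    x.mulRight (a * b) = (x.mulRight a).mulRight b := by
  induction x using Quotient.inductionOn'
  simp [RCoset.mulRight, mul_assoc]

/-- Two elements of `G \ Γ` are related if they are in the same orbit of the subgroup `K`. -/
def orbitSetoid (G K : Subgroup PSL2Z) : Setoid (RCoset G) where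
  r x y := ∃ k ∈ K, x.mulRight k = y
  iseqv :=
    { refl := fun x => ⟨1, K.one_mem, x.mulRight_one⟩
      symm := by
        rintro x y ⟨k, hk, rfl⟩
        exact ⟨k⁻¹, K.inv_mem hk, by rw [← RCoset.mulRight_mul, mul_inv_cancel,
          RCoset.mulRight_one]⟩
      trans := by
        rintro x y z ⟨k, hk, rfl⟩ ⟨l, hl, rfl⟩
        exact ⟨k * l, K.mul_mem hk hl, RCoset.mulRight_mul _ _ _⟩ }

/-- The graph `X_comb(G)`: the edges are the elements of `G \ Γ`, the vertices are the `G₀`-orbits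
and the `G₁`-orbits in `G \ Γ`, and an edge joins the two orbits that contain it. -/
def Xcomb (G : Subgroup PSL2Z) : BipGraph where
  Edge := RCoset G
  Vert0 := Quotient (orbitSetoid G G₀)
  Vert1 := Quotient (orbitSetoid G G₁)
  end0 := Quotient.mk _
  end1 := Quotient.mk _

/-- The tree `T`: the edges are the elements of `Γ`, the vertices are the left cosets of `G₀` and
of `G₁`, and an edge joins the two cosets that contain it. -/
def treeT : BipGraph where
  Edge := PSL2Z
  Vert0 := PSL2Z ⧸ G₀
  Vert1 := PSL2Z ⧸ G₁
  end0 γ := QuotientGroup.mk γ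
  end1 γ := QuotientGroup.mk γ

/-- The left coset `γK` is mapped to the `K`-orbit of `Gγ`. -/
def orbitOfCoset (G K : Subgroup PSL2Z) : PSL2Z ⧸ K → Quotient (orbitSetoid G K) :=
  Quotient.map' (s₁ := QuotientGroup.leftRel K) (s₂ := orbitSetoid G K) (RCoset.of G) (by
    intro a b h
    rw [QuotientGroup.leftRel_apply] at h
    refine ⟨a⁻¹ * b, h, ?_⟩
    simp [RCoset.of, RCoset.mulRight])

/-- The quotient map from `T` to `G \ T = X_comb(G)`. -/
def treeProj (G : Subgroup PSL2Z) : treeT.Hom (Xcomb G) where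
  onEdge := RCoset.of G
  onVert0 := orbitOfCoset G G₀
  onVert1 := orbitOfCoset G G₁
  map_end0 _ := rfl
  map_end1 _ := rfl

/-! ### Hyperbolic geometry -/

/-- The geodesic segment joining `z` and `w` in `ℍ` (with its hyperbolic metric). -/
def geodSegment (z w : ℍ) : Set ℍ := {x | dist z x + dist x w = dist z w}

/-- Hyperbolic convexity. -/
def HypConvex (A : Set ℍ) : Prop := ∀ z ∈ A, ∀ w ∈ A, geodSegment z w ⊆ A

/-- A geodesic arc: a complete geodesic, a geodesic ray or a geodesic segment that is not reduced
to a point. -/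
def IsGeodesicArc (A : Set ℍ) : Prop :=
  ∃ (c : ℝ → ℍ) (I : Set ℝ), Isometry c ∧ I.OrdConnected ∧ IsClosed I ∧ I.Nontrivial ∧ c '' I = A

/-- The extremities in `ℍ` of a geodesic arc: the points of the arc that are not strictly between
two other points of it. -/
def extremities (A : Set ℍ) : Set ℍ :=
  {x ∈ A | ∀ y ∈ A, ∀ z ∈ A, x ∈ geodSegment y z → x = y ∨ x = z}

/-- The angle at `v` between the geodesic segments that join `v` with `a` and with `b`. The Cayley
transform `z ↦ (z - v) / (z - conj v)` is conformal, takes `v` to the centre `0` of the unit disc,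
and takes the geodesics through `v` to Euclidean straight lines through `0`. -/
def hypAngle (v a b : ℍ) : ℝ :=
  InnerProductGeometry.angle
    (((a : ℂ) - v) / (a - (starRingEnd ℂ) (v : ℂ))) (((b : ℂ) - v) / (b - (starRingEnd ℂ) (v : ℂ)))

/-- The geodesic arcs `A` and `B` are adjacent, i.e., they meet in exactly one point, which is an
extremity of both, and they make the angle `θ` there. If `A` and `B` are sides of a convex
polygon, then the angle between them in `[0, π]` is the internal angle. -/
def AdjacentWithAngle (A B : Set ℍ) (θ : ℝ) : Prop :=
  ∃ v, A ∩ B = {v} ∧ v ∈ extremities A ∧ v ∈ extremities B ∧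
    ∀ a ∈ A, a ≠ v → ∀ b ∈ B, b ≠ v → hypAngle v a b = θ

/-- `P` is a convex hyperbolic polygon (possibly unbounded, possibly with infinitely many sides)
and `side` is the family of its sides. A point where two sides meet at the angle `π` is allowed. -/
structure IsConvexPolygon (P : Set ℍ) {ι : Type} (side : ι → Set ℍ) : Prop where
  isClosed : IsClosed P
  convex : HypConvex P
  nonempty_interior : (interior P).Nonempty
  frontier_eq : frontier P = ⋃ s, side s
  geodesic : ∀ s, IsGeodesicArc (side s)
  locallyFinite : LocallyFinite side
  injective : Function.Injective side
  inter_subset : ∀ s t, s ≠ t → side s ∩ side t ⊆ extremities (side s) ∩ extremities (side t)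

/-- The geodesic that joins `0` and `∞`. -/
def imagAxis : Set ℍ := {z | z.re = 0}

/-- The geodesic that joins `i` and `∞`. -/
def iToInfty : Set ℍ := {z | z.re = 0 ∧ 1 ≤ z.im}

/-- The geodesic that joins `i` and `0`. -/
def iToZero : Set ℍ := {z | z.re = 0 ∧ z.im ≤ 1}

/-- The geodesic that joins `ρ = exp(πi/3)` and `∞`. -/
def rhoToInfty : Set ℍ := {z | z.re = 1 / 2 ∧ Real.sqrt 3 / 2 ≤ z.im}

/-- The geodesic that joins `ρ = exp(πi/3)` and `0`. -/
def rhoToZero : Set ℍ := {z | ‖(z : ℂ) - 1‖ = 1 ∧ z.re ≤ 1 / 2}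

/-- The hyperbolic triangle with vertices `0`, `ρ = exp(πi/3)` and `∞`, minus the vertices `0` and
`∞`. -/
def triangle : Set ℍ := {z | 0 ≤ z.re ∧ z.re ≤ 1 / 2 ∧ 1 ≤ ‖(z : ℂ) - 1‖}

/-- `A` is a `Γ`-copy of `B`. -/
def IsCopy (A B : Set ℍ) : Prop := ∃ γ : PSL2Z, A = γ • B

/-- `P`, with the family `side` of its sides and the map `σ` on them, is a special polygon in
the sense of Kulkarni. -/
structure IsSpecialPolygon (P : Set ℍ) {ι : Type} (side : ι → Set ℍ) (σ : ι → ι) : Prop where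
  polygon : IsConvexPolygon P side
  involutive : Function.Involutive σ
  types : ∀ s, IsCopy (side s) imagAxis ∨ IsCopy (side s) iToInfty ∨ IsCopy (side s) rhoToInfty
  free : ∀ s, IsCopy (side s) imagAxis → σ s ≠ s ∧ IsCopy (side (σ s)) imagAxis
  even : ∀ s, IsCopy (side s) iToInfty → σ s ≠ s ∧ IsCopy (side (σ s)) iToInfty ∧
    AdjacentWithAngle (side s) (side (σ s)) Real.pi
  odd : ∀ s, IsCopy (side s) rhoToInfty → σ s ≠ s ∧ IsCopy (side (σ s)) rhoToInfty ∧
    AdjacentWithAngle (side s) (side (σ s)) (2 * Real.pi / 3)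

/-- `γ` takes the side `A` of the convex polygon `P` to the side `B` and reverses the orientations
of `A` and `B` induced from `P`, i.e., the polygons `γ P` and `P` lie on opposite sides of `B`. -/
def PairsSides (P A B : Set ℍ) (γ : PSL2Z) : Prop :=
  γ • A = B ∧ Disjoint (interior (γ • P)) (interior P)

/-! ### The polygon associated with a cut tree -/

/-- The element of `Γ = Edge(T)` that is the image of the edge `x` of `X'` under `j : X' → T`. -/
def edgeElt {G : Subgroup PSL2Z} {C : Set (Xcomb G).Vert0} (j : ((Xcomb G).cut C).Hom treeT)
    (x : RCoset G) : PSL2Z := j.onEdge x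

/-- The polygon `P`: the union of the triangles `γ · triangle`, where `γ` runs through the edges of
the image of the lift `j : X' → T`. -/
def polygon {G : Subgroup PSL2Z} {C : Set (Xcomb G).Vert0} (j : ((Xcomb G).cut C).Hom treeT) :
    Set ℍ :=
  ⋃ x : RCoset G, edgeElt j x • triangle

/-- The labels of the sides of `P`. A univalent vertex of `X'` is given by the only edge `x` of `X'`
that meets it. There is
* one side for a univalent vertex of type (0) obtained from cutting a vertex of `X_comb(G)`;
* two sides for a univalent vertex of type (0) of `X_comb(G)`;
* two sides for a univalent vertex of type (1) of `X_comb(G)`. -/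
inductive Side (G : Subgroup PSL2Z) (C : Set (Xcomb G).Vert0) : Type
  | free (x : RCoset G) (h : (Xcomb G).end0 x ∈ C)
  | even (x : RCoset G) (h : (Xcomb G).valency0 ((Xcomb G).end0 x) = 1) (upper : Bool)
  | odd (x : RCoset G) (h : (Xcomb G).valency1 ((Xcomb G).end1 x) = 1) (upper : Bool)

/-- The sides of `P` as subsets of `ℍ`. -/
def sideSet {G : Subgroup PSL2Z} {C : Set (Xcomb G).Vert0} (j : ((Xcomb G).cut C).Hom treeT) :
    Side G C → Set ℍ
  | .free x _ => edgeElt j x • imagAxis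
  | .even x _ true => edgeElt j x • iToInfty
  | .even x _ false => edgeElt j x • iToZero
  | .odd x _ true => edgeElt j x • rhoToInfty
  | .odd x _ false => edgeElt j x • rhoToZero

theorem end0_mulRight {G : Subgroup PSL2Z} (x : RCoset G) :
    (Xcomb G).end0 (x.mulRight s₀) = (Xcomb G).end0 x :=
  (Quotient.sound (s := orbitSetoid G G₀) ⟨s₀, Subgroup.mem_zpowers s₀, rfl⟩).symm

/-- The side-pairing involution `σ`. The edges of `X_comb(G)` that meet a cut bivalent vertex are
`x` and `x · s₀`. -/
def sigma {G : Subgroup PSL2Z} {C : Set (Xcomb G).Vert0} : Side G C → Side G C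
  | .free x h => .free (x.mulRight s₀) (by rw [end0_mulRight]; exact h)
  | .even x h b => .even x h (!b)
  | .odd x h b => .odd x h (!b)

/-- The side-pairing elements `g_s`. -/
def sidePairing {G : Subgroup PSL2Z} {C : Set (Xcomb G).Vert0}
    (j : ((Xcomb G).cut C).Hom treeT) : Side G C → PSL2Z
  | .free x _ => edgeElt j (x.mulRight s₀) * s₀ * (edgeElt j x)⁻¹
  | .even x _ _ => edgeElt j x * s₀ * (edgeElt j x)⁻¹
  | .odd x _ true => edgeElt j x * u₁ * (edgeElt j x)⁻¹
  | .odd x _ false => edgeElt j x * u₁⁻¹ * (edgeElt j x)⁻¹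

/-- A subset `A` of a group `H` is an independent set of generators if `H` is the free product of
the cyclic subgroups generated by the elements of `A`, i.e., the natural homomorphism from the free
product of these subgroups to `H` is an isomorphism. -/
def IsIndependentGeneratingSet {H : Type} [Group H] (A : Set H) : Prop :=
  Function.Bijective
    (Monoid.CoprodI.lift fun a : A => (Subgroup.zpowers (a : H)).subtype)

end ModularPolygon

end

open scoped UpperHalfPlane MatrixGroups Pointwise

noncomputable section

namespace ModularPolygon

/-! ### Generators of the modular group -/

/-! The group Γ permutes the triangles γ△ simply transitively, just as it permutes the edges γ of T,
and the triangles are glued as the edges are: γ△ and γs₀△ share the line γ·`imagAxis`, while γ△,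
γu₁△ and γu₁⁻¹△ fill an ideal triangle around γρ. Hence P is a thickening of the image of X' in T,
with one triangle for every coset in G\Γ, and its sides lie where X' ends: at cut vertices and at
univalent vertices of X_comb(G).

Algebra. Γ is the free product of ⟨s₀⟩ and ⟨u₁⟩ (`freeProductHom_injective`), so an action of Γ is
given by two permutations with s₀² = 1 and u₁³ = 1. Label the sides by elements k(s) of a group K
with k(σs) = k(s)⁻¹, k(s)² = 1 on even sides and k(s)³ = 1 on odd sides. Then Γ acts on K × G\Γ, a
covering of X_comb(G) that is trivial over X', and its monodromy is a homomorphism G → K with g_s ↦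
k(s) (`exists_hom_of_pairing`). Cyclic K separate the g_s (`exists_hom_separating`). With K the free
product of the ⟨g_s⟩, s ∈ S, one gets a left inverse of the natural map K → G. This map is onto
because a walk in T that leaves the image of X' can be brought back by some g_s
(`eq_top_of_sidePairing_mem`).

Geometry. Since g_s ≠ 1, the triangle across a side is not in P (`edgeElt_ne_mul_s₀`,
`edgeElt_ne_mul_u₁`), so the boundary of P is the union of the sides (`frontier_polygon`). No
translate of the ideal triangle 0, 1, ∞ crosses the imaginary axis (`smul_idealTriangle_subset`), so
a walk along X' never leaves the half-plane of a side. The intersection of these half-planes is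
connected, and P is closed and relatively open in it; thus P equals it and is convex
(`polygon_eq_iInter_sideHalf`). Finally, gP and P do not overlap for 1 ≠ g ∈ G because every coset
has only one triangle in P; together with the small stabilisers of the three geodesics this
characterises g_s (`pairsSides_iff`). -/

theorem mk_neg (A : SL(2, ℤ)) : (QuotientGroup.mk (-A) : PSL2Z) = QuotientGroup.mk A := by
  rw [QuotientGroup.eq]
  have h : (-A)⁻¹ * A = -1 := by rw [inv_neg, neg_mul, inv_mul_cancel]
  rw [h, Matrix.SpecialLinearGroup.mem_center_iff]
  refine ⟨-1, by simp, ?_⟩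
  ext i j
  simp

theorem s₀_mul_self : s₀ * s₀ = 1 := by
  have h : ModularGroup.S * ModularGroup.S = (-1 : SL(2, ℤ)) := by
    decide
  change (QuotientGroup.mk (ModularGroup.S * ModularGroup.S) : PSL2Z) = _
  rw [h, mk_neg]; rfl

theorem s₀_inv : s₀⁻¹ = s₀ := inv_eq_of_mul_eq_one_left s₀_mul_self

theorem u₁_mul_mul : u₁ * u₁ * u₁ = 1 := by
  have h : uMatrix * uMatrix * uMatrix = (-1 : SL(2, ℤ)) := by
    decide
  change (QuotientGroup.mk (uMatrix * uMatrix * uMatrix) : PSL2Z) = _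
  rw [h, mk_neg]; rfl

theorem u₁_inv : u₁⁻¹ = u₁ * u₁ := inv_eq_of_mul_eq_one_left u₁_mul_mul

theorem mem_G₀_iff {γ : PSL2Z} : γ ∈ G₀ ↔ γ = 1 ∨ γ = s₀ := by
  constructor
  · rintro ⟨n, rfl⟩
    obtain ⟨k, rfl | rfl⟩ := Int.even_or_odd' n
    · left; simp [zpow_mul, sq, s₀_mul_self]
    · right; simp [zpow_add, zpow_mul, sq, s₀_mul_self]
  · rintro (rfl | rfl)
    exacts [one_mem _, Subgroup.mem_zpowers _]

theorem mem_G₁_iff {γ : PSL2Z} : γ ∈ G₁ ↔ γ = 1 ∨ γ = u₁ ∨ γ = u₁ * u₁ := by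
  constructor
  · rintro ⟨n, rfl⟩
    have h3 : u₁ ^ (3 : ℤ) = 1 := by
      rw [← u₁_mul_mul]; rw [show (3 : ℤ) = ((3 : ℕ) : ℤ) by rfl, zpow_natCast, pow_three, mul_assoc]
    have hn : n = 3 * (n / 3) + n % 3 := by omega
    have h0 := Int.emod_nonneg n (b := 3) (by norm_num)
    have h1 := Int.emod_lt_of_pos n (b := 3) (by norm_num)
    have h2 : (u₁ ^ n : PSL2Z) = u₁ ^ (n % 3) := by
      conv_lhs => rw [hn]
      rw [zpow_add, zpow_mul, h3, one_zpow, one_mul]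
    change (u₁ ^ n = 1 ∨ u₁ ^ n = u₁ ∨ u₁ ^ n = u₁ * u₁)
    rw [h2]
    generalize n % 3 = m at h0 h1
    interval_cases m
    · left; simp
    · right; left; simp
    · right; right; exact zpow_two _
  · rintro (rfl | rfl | rfl)
    exacts [one_mem _, Subgroup.mem_zpowers _,
      mul_mem (Subgroup.mem_zpowers _) (Subgroup.mem_zpowers _)]

theorem closure_s₀_u₁ : Subgroup.closure {s₀, u₁} = (⊤ : Subgroup PSL2Z) := by
  have hs : s₀ ∈ Subgroup.closure {s₀, u₁} := Subgroup.subset_closure (by simp)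
  have hu : u₁ ∈ Subgroup.closure {s₀, u₁} := Subgroup.subset_closure (by simp)
  -- The translation is u₁⁻¹s₀ up to sign, so the standard generators S and T are words in s₀ and
  -- u₁.
  have hT : (QuotientGroup.mk ModularGroup.T : PSL2Z) = u₁⁻¹ * s₀ := by
    have h : ModularGroup.T = -(uMatrix⁻¹ * ModularGroup.S) := by
      decide
    rw [h, mk_neg]; rfl
  rw [eq_top_iff]
  rintro γ -
  obtain ⟨A, rfl⟩ := QuotientGroup.mk_surjective γ
  have hA : A ∈ Subgroup.closure {ModularGroup.S, ModularGroup.T} := by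
    rw [SpecialLinearGroup.SL2Z_generators]; trivial
  induction hA using Subgroup.closure_induction with
  | mem x hx =>
    rcases hx with rfl | rfl
    · exact hs
    · rw [hT]; exact mul_mem (inv_mem hu) hs
  | one => exact one_mem _
  | mul x y _ _ h1 h2 => exact mul_mem h1 h2
  | inv x _ h => exact inv_mem h

/-- This is induction along walks in T: the edges next to γ are γs₀, γu₁ and γu₁². Positive words
suffice because both generators have finite order. -/
theorem induction_mul_right {p : PSL2Z → Prop} (one : p 1) (mul_s₀ : ∀ γ, p γ → p (γ * s₀))
    (mul_u₁ : ∀ γ, p γ → p (γ * u₁)) (γ : PSL2Z) : p γ := by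
  have hγ : γ ∈ Subgroup.closure {s₀, u₁} := by rw [closure_s₀_u₁]; trivial
  induction hγ using Subgroup.closure_induction_right with
  | one => exact one
  | mul_right x _ y hy h =>
    rcases hy with rfl | rfl
    exacts [mul_s₀ _ h, mul_u₁ _ h]
  | mul_inv_cancel x _ y hy h =>
    rcases hy with rfl | rfl
    · rw [s₀_inv]; exact mul_s₀ _ h
    · rw [u₁_inv, ← mul_assoc]; exact mul_u₁ _ (mul_u₁ _ h)

/-! ### The action on the upper half-plane -/

/-- The expression is |cz + d|², which vanishes only for c = d = 0. -/
theorem re_sq_add_im_sq_denom_pos (A : SL(2, ℤ)) (z : ℍ) :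
    0 < ((A 1 0 : ℝ) * z.re + A 1 1) ^ 2 + ((A 1 0 : ℝ) * z.im) ^ 2 := by
  have hdet := A.det_coe
  rw [Matrix.det_fin_two] at hdet
  have hy := z.im_pos
  by_cases hc : A 1 0 = 0
  · have hd : A 1 1 ≠ 0 := by rintro h; simp [hc, h] at hdet
    have : (0 : ℝ) < (A 1 1 : ℝ) ^ 2 := by positivity
    simpa [hc] using this
  · positivity

theorem coe_mk_smul (A : SL(2, ℤ)) (z : ℍ) :
    (((QuotientGroup.mk A : PSL2Z) • z : ℍ) : ℂ) = (A 0 0 * z + A 0 1) / (A 1 0 * z + A 1 1) := by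
  rw [mk_smul, UpperHalfPlane.coe_specialLinearGroup_apply]
  simp

theorem re_mk_smul (A : SL(2, ℤ)) (z : ℍ) :
    ((QuotientGroup.mk A : PSL2Z) • z).re =
      ((A 0 0 : ℝ) * A 1 0 * (z.re ^ 2 + z.im ^ 2) +
        ((A 0 0 : ℝ) * A 1 1 + A 0 1 * A 1 0) * z.re + A 0 1 * A 1 1) /
      (((A 1 0 : ℝ) * z.re + A 1 1) ^ 2 + ((A 1 0 : ℝ) * z.im) ^ 2) := by
  rw [← UpperHalfPlane.coe_re, coe_mk_smul, Complex.div_re, ← add_div]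
  congr 1
  · simp; ring
  · simp [Complex.normSq_apply]; ring

theorem im_mk_smul (A : SL(2, ℤ)) (z : ℍ) :
    ((QuotientGroup.mk A : PSL2Z) • z).im =
      z.im / (((A 1 0 : ℝ) * z.re + A 1 1) ^ 2 + ((A 1 0 : ℝ) * z.im) ^ 2) := by
  have hdet := A.det_coe
  rw [Matrix.det_fin_two] at hdet
  have hdet' : (A 0 0 : ℝ) * A 1 1 - A 0 1 * A 1 0 = 1 := by exact_mod_cast hdet
  rw [← UpperHalfPlane.coe_im, coe_mk_smul, Complex.div_im, ← sub_div]
  congr 1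
  · simp
    linear_combination z.im * hdet'
  · simp [Complex.normSq_apply]; ring

instance : IsIsometricSMul PSL2Z ℍ where
  isometry_smul γ := by
    obtain ⟨A, rfl⟩ := QuotientGroup.mk_surjective γ
    have h : (fun z : ℍ => (QuotientGroup.mk A : PSL2Z) • z) =
        fun z => (Matrix.SpecialLinearGroup.map (Int.castRingHom ℝ) A : SL(2, ℝ)) • z := by
      funext z
      ext
      rw [coe_mk_smul, UpperHalfPlane.coe_specialLinearGroup_apply]
      simp
    rw [h]
    exact isometry_smul ℍ _

theorem re_s₀_smul (z : ℍ) : (s₀ • z).re = -z.re / (z.re ^ 2 + z.im ^ 2) := by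
  rw [s₀, re_mk_smul]; simp [ModularGroup.S]

theorem im_s₀_smul (z : ℍ) : (s₀ • z).im = z.im / (z.re ^ 2 + z.im ^ 2) := by
  rw [s₀, im_mk_smul]; simp [ModularGroup.S]

theorem re_u₁_smul (z : ℍ) : (u₁ • z).re = (1 - z.re) / ((1 - z.re) ^ 2 + z.im ^ 2) := by
  rw [u₁, re_mk_smul]; simp [uMatrix]; ring

theorem im_u₁_smul (z : ℍ) : (u₁ • z).im = z.im / ((1 - z.re) ^ 2 + z.im ^ 2) := by
  rw [u₁, im_mk_smul]; simp [uMatrix]; ring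

/-- The matrix `(1 -1; 1 0)`, which represents the inverse of `u₁`. -/
def uInvMatrix : SL(2, ℤ) := ⟨!![1, -1; 1, 0], by simp [Matrix.det_fin_two_of]⟩

theorem u₁_inv_eq_mk : u₁⁻¹ = QuotientGroup.mk uInvMatrix := by
  refine inv_eq_of_mul_eq_one_left ?_
  have h : uInvMatrix * uMatrix = 1 := by decide
  change (QuotientGroup.mk (uInvMatrix * uMatrix) : PSL2Z) = _
  rw [h]; rfl

theorem re_u₁_inv_smul (z : ℍ) : (u₁⁻¹ • z).re = 1 - z.re / (z.re ^ 2 + z.im ^ 2) := by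
  have hp : 0 < z.re ^ 2 + z.im ^ 2 := by have := z.im_pos; positivity
  rw [u₁_inv_eq_mk, re_mk_smul]
  simp [uInvMatrix]
  field_simp
  ring

theorem im_u₁_inv_smul (z : ℍ) : (u₁⁻¹ • z).im = z.im / (z.re ^ 2 + z.im ^ 2) := by
  rw [u₁_inv_eq_mk, im_mk_smul]
  simp [uInvMatrix]

open Filter Topology Set

/-! ### Klein coordinates -/

/-- The square of the absolute value of a point of `ℍ`. In the coordinates `re` and `sqNorm`
geodesics are straight. -/
def sqNorm (z : ℍ) : ℝ := z.re ^ 2 + z.im ^ 2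

theorem sqNorm_pos (z : ℍ) : 0 < sqNorm z := by
  have := z.im_pos
  unfold sqNorm; positivity

theorem re_sq_lt_sqNorm (z : ℍ) : z.re ^ 2 < sqNorm z := by
  have := z.im_pos
  unfold sqNorm; nlinarith

theorem continuous_sqNorm : Continuous sqNorm := by
  unfold sqNorm
  exact (UpperHalfPlane.continuous_re.pow 2).add (UpperHalfPlane.continuous_im.pow 2)

theorem norm_coe_sub_one_sq (z : ℍ) : ‖(z : ℂ) - 1‖ ^ 2 = 1 - 2 * z.re + sqNorm z := by
  rw [← Complex.normSq_eq_norm_sq, Complex.normSq_apply, sqNorm]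
  simp; ring

theorem sub_add_sqNorm_pos (z : ℍ) : 0 < 1 - 2 * z.re + sqNorm z := by
  nlinarith [re_sq_lt_sqNorm z, sq_nonneg (z.re - 1)]

theorem re_s₀_smul' (z : ℍ) : (s₀ • z).re = -z.re / sqNorm z := re_s₀_smul z

theorem sqNorm_s₀_smul (z : ℍ) : sqNorm (s₀ • z) = 1 / sqNorm z := by
  have := sqNorm_pos z
  unfold sqNorm at *
  rw [re_s₀_smul, im_s₀_smul]
  field_simp

theorem re_u₁_smul' (z : ℍ) : (u₁ • z).re = (1 - z.re) / (1 - 2 * z.re + sqNorm z) := by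
  rw [re_u₁_smul, sqNorm]; congr 1; ring

theorem sqNorm_u₁_smul (z : ℍ) : sqNorm (u₁ • z) = 1 / (1 - 2 * z.re + sqNorm z) := by
  have h := sub_add_sqNorm_pos z
  have h' : 1 - 2 * z.re + sqNorm z = (1 - z.re) ^ 2 + z.im ^ 2 := by unfold sqNorm; ring
  rw [h'] at h ⊢
  rw [sqNorm, re_u₁_smul, im_u₁_smul]
  field_simp

theorem re_u₁_inv_smul' (z : ℍ) : (u₁⁻¹ • z).re = 1 - z.re / sqNorm z := re_u₁_inv_smul z

theorem sqNorm_u₁_inv_smul (z : ℍ) :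
    sqNorm (u₁⁻¹ • z) = (1 - 2 * z.re + sqNorm z) / sqNorm z := by
  have := sqNorm_pos z
  unfold sqNorm at *
  rw [re_u₁_inv_smul, im_u₁_inv_smul]
  field_simp
  ring

/-- The point at the parameter `t` of the geodesic segment joining `z` and `w`, parametrised
linearly in the coordinates `re` and `sqNorm`. -/
def kleinPath (z w : ℍ) (t : unitInterval) : ℍ :=
  ⟨⟨(1 - t) * z.re + t * w.re,
    √((1 - t) * sqNorm z + t * sqNorm w - ((1 - t) * z.re + t * w.re) ^ 2)⟩, by
    obtain ⟨t, h0, h1⟩ := t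
    refine Real.sqrt_pos.mpr ?_
    have hz := re_sq_lt_sqNorm z
    have hw := re_sq_lt_sqNorm w
    have key : 0 < (1 - t) * (sqNorm z - z.re ^ 2) + t * (sqNorm w - w.re ^ 2) := by
      rcases h0.eq_or_lt with rfl | h0
      · simpa using hz
      · have : 0 ≤ (1 - t) * (sqNorm z - z.re ^ 2) := mul_nonneg (by linarith) (by linarith)
        have : 0 < t * (sqNorm w - w.re ^ 2) := mul_pos h0 (by linarith)
        linarith
    have : 0 ≤ t * (1 - t) * (z.re - w.re) ^ 2 :=
      mul_nonneg (mul_nonneg h0 (by linarith)) (sq_nonneg _)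
    dsimp only
    nlinarith⟩

theorem continuous_kleinPath (z w : ℍ) : Continuous (kleinPath z w) := by
  refine Continuous.upperHalfPlaneMk ?_ _
  have h : ∀ t : unitInterval, (⟨(1 - t) * z.re + t * w.re,
    √((1 - t) * sqNorm z + t * sqNorm w - ((1 - t) * z.re + t * w.re) ^ 2)⟩ : ℂ) =
      Complex.equivRealProdCLM.symm ((1 - t) * z.re + t * w.re,
    √((1 - t) * sqNorm z + t * sqNorm w - ((1 - t) * z.re + t * w.re) ^ 2)) := fun t => rfl
  simp_rw [h]
  fun_prop

theorem kleinPath_re (z w : ℍ) (t : unitInterval) :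
    (kleinPath z w t).re = (1 - t) * z.re + t * w.re := rfl

theorem kleinPath_sqNorm (z w : ℍ) (t : unitInterval) :
    sqNorm (kleinPath z w t) = (1 - t) * sqNorm z + t * sqNorm w := by
  have h := (kleinPath z w t).im_pos
  have h2 : (kleinPath z w t).im =
    √((1 - t) * sqNorm z + t * sqNorm w - ((1 - t) * z.re + t * w.re) ^ 2) := rfl
  rw [sqNorm, kleinPath_re, h2, Real.sq_sqrt]
  · ring
  · rw [h2] at h
    exact (Real.sqrt_pos.mp h).le

theorem ext_re_sqNorm {z w : ℍ} (h : z.re = w.re) (h' : sqNorm z = sqNorm w) : z = w := by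
  have hz := z.im_pos
  have hw := w.im_pos
  unfold sqNorm at h'
  rw [h] at h'
  refine UpperHalfPlane.ext (Complex.ext h ?_)
  change z.im = w.im
  nlinarith

theorem kleinPath_zero (z w : ℍ) : kleinPath z w 0 = z :=
  ext_re_sqNorm (by simp [kleinPath_re]) (by simp [kleinPath_sqNorm])

theorem kleinPath_one (z w : ℍ) : kleinPath z w 1 = w :=
  ext_re_sqNorm (by simp [kleinPath_re]) (by simp [kleinPath_sqNorm])

/-- Convexity in the coordinates `re` and `sqNorm`. -/
def KleinConvex (A : Set ℍ) : Prop := ∀ z ∈ A, ∀ w ∈ A, ∀ t, kleinPath z w t ∈ A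

/-- Only connectedness is taken from this form of convexity; metric convexity is treated separately
through `HypConvex`. -/
theorem KleinConvex.isPreconnected {A : Set ℍ} (hA : KleinConvex A) : IsPreconnected A := by
  refine isPreconnected_of_forall_pair fun z hz w hw => ⟨range (kleinPath z w), ?_, ?_, ?_, ?_⟩
  · rintro _ ⟨t, rfl⟩
    exact hA z hz w hw t
  · exact ⟨0, kleinPath_zero z w⟩
  · exact ⟨1, kleinPath_one z w⟩
  · exact isPreconnected_range (continuous_kleinPath z w)

theorem kleinConvex_iInter {ι : Sort*} {A : ι → Set ℍ} (h : ∀ i, KleinConvex (A i)) :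
    KleinConvex (⋂ i, A i) := fun z hz w hw t =>
  mem_iInter.mpr fun i => h i z (mem_iInter.mp hz i) w (mem_iInter.mp hw i) t

theorem kleinConvex_linear (a b c : ℝ) : KleinConvex {z | 0 ≤ a * sqNorm z + b * z.re + c} := by
  rintro z hz w hw ⟨t, h0, h1⟩
  simp only [mem_ofPred_eq, kleinPath_re, kleinPath_sqNorm] at *
  nlinarith [mul_nonneg h0 hw, mul_nonneg (sub_nonneg.mpr h1) hz]

/-! ### Hyperbolic half-planes -/

/-- The closed half-plane to the right of the vertical geodesic through `k`. -/
def rightHalf (k : ℝ) : Set ℍ := {z | k ≤ z.re}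

/-- The closed half-plane to the left of the vertical geodesic through `k`. -/
def leftHalf (k : ℝ) : Set ℍ := {z | z.re ≤ k}

theorem hypConvex_smul {A : Set ℍ} (hA : HypConvex A) (γ : PSL2Z) :
    HypConvex (γ • A) := by
  intro z hz w hw x hx
  rw [mem_smul_set_iff_inv_smul_mem] at *
  refine hA _ hz _ hw ?_
  simpa only [geodSegment, mem_ofPred_eq, dist_smul] using hx

theorem hypConvex_iInter {ι : Sort*} {A : ι → Set ℍ} (h : ∀ i, HypConvex (A i)) :
    HypConvex (⋂ i, A i) := fun z hz w hw _ hx =>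
  mem_iInter.mpr fun i => h i z (mem_iInter.mp hz i) w (mem_iInter.mp hw i) hx

theorem dist_lt_dist_of_cosh {z w z' w' : ℍ} (h : Real.cosh (dist z w) < Real.cosh (dist z' w')) :
    dist z w < dist z' w' := by
  rwa [Real.cosh_lt_cosh, abs_of_nonneg dist_nonneg, abs_of_nonneg dist_nonneg] at h

/-- The projection of a point beyond a vertical geodesic on this geodesic is strictly nearer to the
points on the other side. -/
theorem exists_nearer_of_separated (k : ℝ) {x : ℍ} (hx : x.re ≠ k) :
    ∃ p : ℍ, ∀ z : ℍ, (z.re - k) * (x.re - k) ≤ 0 → dist z p < dist z x := by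
  have hx0 : 0 < (x.re - k) ^ 2 := by
    have : x.re - k ≠ 0 := sub_ne_zero.mpr hx
    positivity
  have hxp := x.im_pos
  -- The circle with centre k through x is orthogonal to the vertical line at k + ir, so this point
  -- is the foot of the perpendicular from x.
  set r := √((x.re - k) ^ 2 + x.im ^ 2) with hr
  have hr2 : r ^ 2 = (x.re - k) ^ 2 + x.im ^ 2 := Real.sq_sqrt (by positivity)
  have hr0 : 0 < r := Real.sqrt_pos.mpr (by positivity)
  have hrx : x.im < r := by nlinarith
  refine ⟨⟨⟨k, r⟩, hr0⟩, fun z hz => dist_lt_dist_of_cosh ?_⟩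
  have hzp := z.im_pos
  rw [UpperHalfPlane.cosh_dist', UpperHalfPlane.cosh_dist']
  change ((z.re - k) ^ 2 + z.im ^ 2 + r ^ 2) / (2 * z.im * r) < _
  rw [div_lt_div_iff₀ (by positivity) (by positivity)]
  -- The mixed term 2(z.re - k)(x.re - k) in the expansion around k is nonpositive by the choice of
  -- sides. The strict gain comes from the denominators, where x.im < r.
  have h1 : (z.re - k) ^ 2 + z.im ^ 2 + r ^ 2 ≤ (z.re - x.re) ^ 2 + z.im ^ 2 + x.im ^ 2 := by
    nlinarith
  have h2 : 0 < (z.re - k) ^ 2 + z.im ^ 2 + r ^ 2 := by positivity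
  calc ((z.re - k) ^ 2 + z.im ^ 2 + r ^ 2) * (2 * z.im * x.im)
      < ((z.re - k) ^ 2 + z.im ^ 2 + r ^ 2) * (2 * z.im * r) := by gcongr
    _ ≤ _ := by gcongr

/-- If x on a segment from z to w lay outside, then passing through its projection p on the boundary
would be shorter, against the triangle inequality. -/
theorem hypConvex_rightHalf (k : ℝ) : HypConvex (rightHalf k) := by
  intro z hz w hw x hx
  by_contra hlt
  simp only [rightHalf, mem_ofPred_eq, not_le] at hz hw hlt
  obtain ⟨p, hp⟩ := exists_nearer_of_separated k hlt.ne
  have h1 := hp z (by nlinarith)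
  have h2 := hp w (by nlinarith)
  have h3 := dist_triangle z p w
  rw [dist_comm p w] at h3
  simp only [geodSegment, mem_ofPred_eq, dist_comm x w] at hx
  linarith

theorem hypConvex_leftHalf (k : ℝ) : HypConvex (leftHalf k) := by
  intro z hz w hw x hx
  by_contra hlt
  simp only [leftHalf, mem_ofPred_eq, not_le] at hz hw hlt
  obtain ⟨p, hp⟩ := exists_nearer_of_separated k hlt.ne'
  have h1 := hp z (by nlinarith)
  have h2 := hp w (by nlinarith)
  have h3 := dist_triangle z p w
  rw [dist_comm p w] at h3
  simp only [geodSegment, mem_ofPred_eq, dist_comm x w] at hx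
  linarith

/-- After clearing the positive factor |cz + d|², the preimage of a vertical line is an affine line
in the coordinates `re` and `sqNorm`. -/
theorem exists_re_smul_sub_eq (γ : PSL2Z) (k : ℝ) : ∃ a b c : ℝ, ∀ z : ℍ, ∃ N : ℝ, 0 < N ∧
    ((γ • z).re - k) * N = a * sqNorm z + b * z.re + c := by
  obtain ⟨A, rfl⟩ := QuotientGroup.mk_surjective γ
  refine ⟨A 0 0 * A 1 0 - k * A 1 0 ^ 2,
    A 0 0 * A 1 1 + A 0 1 * A 1 0 - k * (2 * A 1 0 * A 1 1), A 0 1 * A 1 1 - k * A 1 1 ^ 2,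
    fun z => ⟨_, re_sq_add_im_sq_denom_pos A z, ?_⟩⟩
  rw [re_mk_smul, sub_mul, div_mul_cancel₀ _ (re_sq_add_im_sq_denom_pos A z).ne', sqNorm]
  ring

theorem kleinConvex_smul_rightHalf (γ : PSL2Z) (k : ℝ) : KleinConvex (γ • rightHalf k) := by
  obtain ⟨a, b, c, h⟩ := exists_re_smul_sub_eq γ⁻¹ k
  convert kleinConvex_linear a b c using 1
  ext z
  obtain ⟨N, hN, hz⟩ := h z
  rw [mem_smul_set_iff_inv_smul_mem, mem_ofPred_eq, ← hz, mul_nonneg_iff_of_pos_right hN,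
    sub_nonneg]
  rfl

theorem kleinConvex_smul_leftHalf (γ : PSL2Z) (k : ℝ) : KleinConvex (γ • leftHalf k) := by
  obtain ⟨a, b, c, h⟩ := exists_re_smul_sub_eq γ⁻¹ k
  convert kleinConvex_linear (-a) (-b) (-c) using 1
  ext z
  obtain ⟨N, hN, hz⟩ := h z
  have : -a * sqNorm z + -b * z.re + -c = (k - (γ⁻¹ • z).re) * N := by linear_combination hz
  rw [mem_smul_set_iff_inv_smul_mem, mem_ofPred_eq, this, mul_nonneg_iff_of_pos_right hN,
    sub_nonneg]
  rfl

/-! ### The tessellation by the translates of the triangle -/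

theorem mem_triangle_iff {z : ℍ} :
    z ∈ triangle ↔ 0 ≤ z.re ∧ z.re ≤ 1 / 2 ∧ 2 * z.re ≤ sqNorm z := by
  have h := norm_coe_sub_one_sq z
  have h0 := norm_nonneg ((z : ℂ) - 1)
  simp only [triangle, mem_ofPred_eq]
  refine and_congr_right fun _ => and_congr_right fun _ => ⟨fun h1 => ?_, fun h1 => ?_⟩ <;> nlinarith

theorem mem_s₀_smul_triangle_iff {z : ℍ} :
    z ∈ s₀ • triangle ↔ z.re ≤ 0 ∧ -1 ≤ 2 * z.re ∧ -(2 * z.re) ≤ sqNorm z := by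
  have h := sqNorm_pos z
  rw [mem_smul_set_iff_inv_smul_mem, mem_triangle_iff, s₀_inv, re_s₀_smul', sqNorm_s₀_smul,
    le_div_iff₀ h, div_le_iff₀ h, ← mul_div_assoc, div_le_div_iff_of_pos_right h]
  constructor <;> rintro ⟨h1, h2, h3⟩ <;> refine ⟨?_, ?_, ?_⟩ <;> linarith

theorem mem_u₁_smul_triangle_iff {z : ℍ} :
    z ∈ u₁ • triangle ↔ z.re ≤ sqNorm z ∧ sqNorm z ≤ 2 * z.re ∧ sqNorm z ≤ 1 := by
  have h := sqNorm_pos z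
  have h1 : 1 - z.re / sqNorm z = (sqNorm z - z.re) / sqNorm z := by field_simp
  rw [mem_smul_set_iff_inv_smul_mem, mem_triangle_iff, re_u₁_inv_smul', sqNorm_u₁_inv_smul, h1,
    le_div_iff₀ h, div_le_iff₀ h, ← mul_div_assoc, div_le_div_iff_of_pos_right h]
  constructor <;> rintro ⟨h1, h2, h3⟩ <;> refine ⟨?_, ?_, ?_⟩ <;> linarith

theorem mem_u₁_inv_smul_triangle_iff {z : ℍ} :
    z ∈ u₁⁻¹ • triangle ↔ z.re ≤ 1 ∧ 1 ≤ 2 * z.re ∧ 1 ≤ sqNorm z := by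
  have h := sub_add_sqNorm_pos z
  rw [mem_smul_set_iff_inv_smul_mem, mem_triangle_iff, inv_inv, re_u₁_smul', sqNorm_u₁_smul,
    le_div_iff₀ h, div_le_iff₀ h, ← mul_div_assoc, div_le_div_iff_of_pos_right h]
  constructor <;> rintro ⟨h1, h2, h3⟩ <;> refine ⟨?_, ?_, ?_⟩ <;> linarith

/-- The ideal triangle with vertices `0`, `1` and `∞`. -/
def idealTriangle : Set ℍ := {z | 0 ≤ z.re ∧ z.re ≤ 1 ∧ z.re ≤ sqNorm z}

/-- The element u₁ rotates the ideal triangle about ρ with order 3, and △ is one third of it. -/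
theorem idealTriangle_eq :
    idealTriangle = triangle ∪ (u₁ • triangle ∪ u₁⁻¹ • triangle) := by
  ext z
  simp only [mem_union, mem_triangle_iff, mem_u₁_smul_triangle_iff, mem_u₁_inv_smul_triangle_iff,
    idealTriangle, mem_ofPred_eq]
  have := sqNorm_pos z
  constructor
  · rintro ⟨h1, h2, h3⟩
    by_cases h4 : z.re ≤ 1 / 2
    · by_cases h5 : 2 * z.re ≤ sqNorm z
      · exact .inl ⟨h1, h4, h5⟩
      · exact .inr (.inl ⟨h3, by linarith, by linarith⟩)
    · by_cases h5 : sqNorm z ≤ 1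
      · exact .inr (.inl ⟨h3, by linarith, by linarith⟩)
      · exact .inr (.inr ⟨h2, by linarith, by linarith⟩)
  · rintro (⟨h1, h2, h3⟩ | ⟨h1, h2, h3⟩ | ⟨h1, h2, h3⟩)
    · exact ⟨h1, by linarith, by linarith⟩
    · exact ⟨by linarith, by linarith, h1⟩
    · exact ⟨by linarith, h1, by linarith⟩

theorem isClosed_triangle : IsClosed triangle := by
  have : triangle = {z | 0 ≤ z.re ∧ z.re ≤ 1 / 2 ∧ 2 * z.re ≤ sqNorm z} := by
    ext z; exact mem_triangle_iff
  rw [this]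
  have h := UpperHalfPlane.continuous_re
  exact (isClosed_le continuous_const h).inter ((isClosed_le h continuous_const).inter
    (isClosed_le (continuous_const.mul h) continuous_sqNorm))

theorem union_s₀_smul_triangle_mem_nhds {p : ℍ} (h : p.re = 0) :
    triangle ∪ s₀ • triangle ∈ 𝓝 p := by
  have hc := UpperHalfPlane.continuous_re
  have hp := sqNorm_pos p
  have h1 : ∀ᶠ z : ℍ in 𝓝 p, z.re < 1 / 2 :=
    hc.continuousAt.eventually_lt continuousAt_const (by norm_num [h])
  have h2 : ∀ᶠ z : ℍ in 𝓝 p, -(1 / 2) < z.re :=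
    continuousAt_const.eventually_lt hc.continuousAt (by norm_num [h])
  have h3 : ∀ᶠ z : ℍ in 𝓝 p, 2 * z.re < sqNorm z :=
    (continuous_const.mul hc).continuousAt.eventually_lt continuous_sqNorm.continuousAt (by simpa [h])
  have h4 : ∀ᶠ z : ℍ in 𝓝 p, -(2 * z.re) < sqNorm z :=
    (continuous_const.mul hc).neg.continuousAt.eventually_lt continuous_sqNorm.continuousAt
      (by simpa [h])
  filter_upwards [h1, h2, h3, h4] with z h1 h2 h3 h4
  rw [mem_union, mem_triangle_iff, mem_s₀_smul_triangle_iff]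
  rcases le_total 0 z.re with h0 | h0
  · exact .inl ⟨h0, h1.le, h3.le⟩
  · exact .inr ⟨h0, by linarith, h4.le⟩

theorem idealTriangle_mem_nhds {p : ℍ} (hp : p ∈ triangle) (h : 0 < p.re) :
    idealTriangle ∈ 𝓝 p := by
  have hc := UpperHalfPlane.continuous_re
  rw [mem_triangle_iff] at hp
  have h1 : ∀ᶠ z : ℍ in 𝓝 p, 0 < z.re := continuousAt_const.eventually_lt hc.continuousAt h
  have h2 : ∀ᶠ z : ℍ in 𝓝 p, z.re < 1 :=
    hc.continuousAt.eventually_lt continuousAt_const (by linarith)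
  have h3 : ∀ᶠ z : ℍ in 𝓝 p, z.re < sqNorm z :=
    hc.continuousAt.eventually_lt continuous_sqNorm.continuousAt (by linarith)
  filter_upwards [h1, h2, h3] with z h1 h2 h3
  exact ⟨h1.le, h2.le, h3.le⟩

/-- The interior of the triangle, minus the unit circle. -/
def triangleCore : Set ℍ := {z | 0 < z.re ∧ z.re < 1 / 2 ∧ 2 * z.re < sqNorm z ∧ sqNorm z ≠ 1}

theorem triangleCore_subset : triangleCore ⊆ triangle := fun _ hz =>
  mem_triangle_iff.mpr ⟨hz.1.le, hz.2.1.le, hz.2.2.1.le⟩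

theorem triangleCore_subset_interior : triangleCore ⊆ interior triangle := by
  rintro p ⟨h1, h2, h3, -⟩
  have hc := UpperHalfPlane.continuous_re
  rw [mem_interior_iff_mem_nhds]
  filter_upwards [continuousAt_const.eventually_lt hc.continuousAt h1,
    hc.continuousAt.eventually_lt continuousAt_const h2,
    (continuous_const.mul hc).continuousAt.eventually_lt continuous_sqNorm.continuousAt h3]
    with z h1 h2 h3
  exact mem_triangle_iff.mpr ⟨h1.le, h2.le, h3.le⟩

theorem triangleCore_nonempty : triangleCore.Nonempty := by
  refine ⟨⟨⟨1 / 4, 3⟩, by norm_num⟩, ?_⟩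
  simp only [triangleCore, sqNorm, mem_ofPred_eq, UpperHalfPlane.re, UpperHalfPlane.im]
  norm_num

/-- The triangle is convex in Klein coordinates, so the path from z to an interior point enters the
interior at once. -/
theorem triangle_subset_closure : triangle ⊆ closure triangleCore := by
  intro z hz
  rw [mem_triangle_iff] at hz
  set w : ℍ := ⟨⟨1 / 4, 3⟩, by norm_num⟩ with hw
  have hwr : w.re = 1 / 4 := rfl
  have hwi : w.im = 3 := rfl
  have hws : sqNorm w = 145 / 16 := by rw [sqNorm, hwr, hwi]; norm_num
  let t : ℕ → unitInterval := fun n => ⟨1 / ((n : ℝ) + 1), by positivity, by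
    rw [div_le_one (by positivity)]; linarith [(Nat.cast_nonneg n : (0 : ℝ) ≤ n)]⟩
  have ht : Tendsto t atTop (𝓝 0) := by
    rw [tendsto_subtype_rng]
    exact tendsto_one_div_add_atTop_nhds_zero_nat
  have hp : Tendsto (fun n => kleinPath z w (t n)) atTop (𝓝 z) := by
    have := ((continuous_kleinPath z w).tendsto 0).comp ht
    rwa [kleinPath_zero] at this
  -- The unit circle is avoided too: for |z| < 1 by continuity, and otherwise because `sqNorm` moves
  -- from a value at least 1 towards 145/16 > 1.
  have hq : ∀ᶠ n in atTop, sqNorm (kleinPath z w (t n)) ≠ 1 := by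
    rcases lt_or_ge (sqNorm z) 1 with h | h
    · filter_upwards [((continuous_sqNorm.tendsto z).comp hp).eventually (gt_mem_nhds h)] with n hn
      exact hn.ne
    · refine Eventually.of_forall fun n => ?_
      have h0 : (0 : ℝ) < t n := by change (0 : ℝ) < 1 / ((n : ℝ) + 1); positivity
      have h1 : (t n : ℝ) ≤ 1 := (t n).2.2
      rw [kleinPath_sqNorm, hws]
      refine ne_of_gt ?_
      nlinarith
  refine mem_closure_of_tendsto hp ?_
  filter_upwards [hq] with n hn
  have h0 : (0 : ℝ) < t n := by change (0 : ℝ) < 1 / ((n : ℝ) + 1); positivity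
  have h1 : (t n : ℝ) ≤ 1 := (t n).2.2
  obtain ⟨hz1, hz2, hz3⟩ := hz
  refine ⟨?_, ?_, ?_, hn⟩
  · rw [kleinPath_re, hwr]; nlinarith
  · rw [kleinPath_re, hwr]; nlinarith
  · rw [kleinPath_re, kleinPath_sqNorm, hwr, hws]; nlinarith

/-- The part of △ outside the unit circle is the right half of the standard fundamental domain, and
s₀ takes the part inside to the left half. So elements e, f of {1, s₀} move z into the open standard
domain and γz into the closed one, whence fγe⁻¹ = 1. Off the unit circle the point z really lands in
the open domain. What remains is γ = s₀, which makes the real part negative. -/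
theorem eq_one_of_mem_triangleCore {γ : PSL2Z} {z : ℍ} (hz : z ∈ triangleCore)
    (hγ : γ • z ∈ triangle) : γ = 1 := by
  obtain ⟨g, rfl⟩ := QuotientGroup.mk_surjective γ
  have normSq_eq : ∀ z : ℍ, Complex.normSq (z : ℂ) = sqNorm z := fun z => by
    rw [Complex.normSq_apply, sqNorm, UpperHalfPlane.coe_re, UpperHalfPlane.coe_im]; ring
  have h1 : ∃ e : SL(2, ℤ), ((QuotientGroup.mk e : PSL2Z) = 1 ∨ (QuotientGroup.mk e : PSL2Z) = s₀) ∧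
      e • z ∈ ModularGroup.fdo := by
    obtain ⟨h1, h2, h3, h4⟩ := hz
    rcases h4.lt_or_gt with h4 | h4
    · refine ⟨ModularGroup.S, .inr rfl, ?_⟩
      have hp := sqNorm_pos z
      rw [← mk_smul]
      change s₀ • z ∈ _
      rw [ModularGroup.fdo, mem_ofPred_eq, normSq_eq, sqNorm_s₀_smul, re_s₀_smul', lt_div_iff₀ hp,
        abs_lt, lt_div_iff₀ hp, div_lt_iff₀ hp]
      exact ⟨by linarith, by linarith, by linarith⟩
    · refine ⟨1, .inl rfl, ?_⟩
      rw [one_smul, ModularGroup.fdo, mem_ofPred_eq, normSq_eq, abs_lt]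
      exact ⟨h4, by linarith, h2⟩
  have h2 : ∃ f : SL(2, ℤ), ((QuotientGroup.mk f : PSL2Z) = 1 ∨ (QuotientGroup.mk f : PSL2Z) = s₀) ∧
      f • g • z ∈ ModularGroup.fd := by
    rw [mk_smul, mem_triangle_iff] at hγ
    generalize g • z = w at hγ
    obtain ⟨h1, h2, h3⟩ := hγ
    rcases le_total (sqNorm w) 1 with h4 | h4
    · refine ⟨ModularGroup.S, .inr rfl, ?_⟩
      have hp := sqNorm_pos w
      rw [← mk_smul]
      change s₀ • w ∈ _
      rw [ModularGroup.fd, mem_ofPred_eq, normSq_eq, sqNorm_s₀_smul, re_s₀_smul', le_div_iff₀ hp,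
        abs_le, le_div_iff₀ hp, div_le_iff₀ hp]
      exact ⟨by linarith, by linarith, by linarith⟩
    · refine ⟨1, .inl rfl, ?_⟩
      rw [one_smul, ModularGroup.fd, mem_ofPred_eq, normSq_eq, abs_le]
      exact ⟨h4, by linarith, h2⟩
  obtain ⟨e, he, hez⟩ := h1
  obtain ⟨f, hf, hfz⟩ := h2
  have h3 : (f * g * e⁻¹) • (e • z) ∈ ModularGroup.fd := by
    rwa [smul_smul, inv_mul_cancel_right, mul_smul]
  have h4 : (QuotientGroup.mk f : PSL2Z) * QuotientGroup.mk g * (QuotientGroup.mk e)⁻¹ = 1 := by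
    change (QuotientGroup.mk (f * g * e⁻¹) : PSL2Z) = 1
    rcases ModularGroup.eq_one_or_neg_one_of_mem_fdo_mem_fd hez h3 with h | h
    · rw [h]; rfl
    · rw [h, mk_neg]; rfl
  have h5 : (QuotientGroup.mk g : PSL2Z) ≠ s₀ := by
    intro h
    rw [h, mem_triangle_iff, re_s₀_smul', le_div_iff₀ (sqNorm_pos z)] at hγ
    linarith [hz.1, hγ.1]
  generalize (QuotientGroup.mk g : PSL2Z) = γ at *
  rcases he with he | he <;> rcases hf with hf | hf <;> rw [he, hf] at h4
  · simpa using h4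
  · refine absurd ?_ h5
    rw [inv_one, mul_one] at h4
    rw [eq_inv_of_mul_eq_one_right h4, s₀_inv]
  · refine absurd ?_ h5
    rw [one_mul] at h4
    exact mul_inv_eq_one.mp h4
  · rw [mul_inv_eq_one] at h4
    exact mul_eq_left.mp h4

theorem exists_mem_smul_triangle (z : ℍ) : ∃ γ : PSL2Z, z ∈ γ • triangle := by
  have normSq_eq : ∀ z : ℍ, Complex.normSq (z : ℂ) = sqNorm z := fun z => by
    rw [Complex.normSq_apply, sqNorm, UpperHalfPlane.coe_re, UpperHalfPlane.coe_im]; ring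
  obtain ⟨g, hg⟩ := ModularGroup.exists_smul_mem_fd z
  rw [← mk_smul] at hg
  generalize (QuotientGroup.mk g : PSL2Z) = γ at hg
  obtain ⟨h1, h2⟩ := hg
  rw [normSq_eq] at h1
  rw [abs_le] at h2
  rcases le_total 0 (γ • z).re with h | h
  · refine ⟨γ⁻¹, ?_⟩
    rw [mem_inv_smul_set_iff, mem_triangle_iff]
    exact ⟨h, h2.2, by linarith⟩
  · refine ⟨γ⁻¹ * s₀, ?_⟩
    rw [mul_smul, mem_inv_smul_set_iff, mem_s₀_smul_triangle_iff]
    exact ⟨h, by linarith, by linarith⟩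

/-- The core is dense in the triangle, so U contains a point of γ·`triangleCore`; the triangle δ△
covering that point must be γ△. This lemma decides each time which triangles pass through a given
point. -/
theorem mem_of_mem_smul_triangle {L : Set PSL2Z} {U : Set ℍ} {p : ℍ} {γ : PSL2Z} (hU : U ∈ 𝓝 p)
    (hL : U ⊆ ⋃ δ ∈ L, δ • triangle) (hp : p ∈ γ • triangle) : γ ∈ L := by
  have h1 : p ∈ closure (γ • triangleCore) := by
    rw [closure_smul]
    exact smul_set_mono triangle_subset_closure hp
  obtain ⟨_, h2, w, hw, rfl⟩ := mem_closure_iff_nhds.mp h1 U hU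
  obtain ⟨δ, hδ, h3⟩ := mem_iUnion₂.mp (hL h2)
  have h4 : (δ⁻¹ * γ) • w ∈ triangle := by
    rw [mul_smul]
    exact mem_smul_set_iff_inv_smul_mem.mp h3
  have := eq_one_of_mem_triangleCore hw h4
  rw [inv_mul_eq_one] at this
  rwa [← this]

theorem eq_one_or_s₀_of_mem {γ : PSL2Z} {p : ℍ} (hp : p ∈ γ • triangle) (h : p.re = 0) :
    γ = 1 ∨ γ = s₀ :=
  mem_of_mem_smul_triangle (L := {1, s₀}) (union_s₀_smul_triangle_mem_nhds h)
    (by simp) hp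

theorem eq_one_or_u₁_of_mem {γ : PSL2Z} {p : ℍ} (hp' : p ∈ triangle) (hp : p ∈ γ • triangle)
    (h : 0 < p.re) : γ = 1 ∨ γ = u₁ ∨ γ = u₁⁻¹ :=
  mem_of_mem_smul_triangle (L := {1, u₁, u₁⁻¹}) (idealTriangle_mem_nhds hp' h)
    (by simp [idealTriangle_eq]) hp

theorem locallyFinite_smul_triangle : LocallyFinite fun γ : PSL2Z => γ • triangle := by
  intro z
  obtain ⟨γ, hγ⟩ := exists_mem_smul_triangle z
  rw [mem_smul_set_iff_inv_smul_mem] at hγ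
  obtain ⟨U, hU, L, hL, hUL⟩ : ∃ U ∈ 𝓝 (γ⁻¹ • z), ∃ L : Set PSL2Z, L.Finite ∧
      U ⊆ ⋃ δ ∈ L, δ • triangle := by
    rcases (mem_triangle_iff.mp hγ).1.eq_or_lt with h | h
    · exact ⟨_, union_s₀_smul_triangle_mem_nhds h.symm, {1, s₀}, by simp, by simp⟩
    · exact ⟨_, idealTriangle_mem_nhds hγ h, {1, u₁, u₁⁻¹}, by simp, by simp [idealTriangle_eq]⟩
  obtain ⟨V, hVU, hV, hzV⟩ := mem_nhds_iff.mp hU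
  refine ⟨γ • V, (hV.smul γ).mem_nhds (mem_smul_set_iff_inv_smul_mem.mpr hzV),
    (hL.image (fun δ => γ * δ)).subset ?_⟩
  rintro δ ⟨p, hp1, hp2⟩
  refine ⟨γ⁻¹ * δ, ?_, by simp⟩
  rw [mem_smul_set_iff_inv_smul_mem] at hp2
  refine mem_of_mem_smul_triangle (hV.mem_nhds hp2) (hVU.trans hUL) ?_
  rw [mul_smul]
  exact smul_mem_smul_set hp1

/-! ### Translates of the triangle on one side of the imaginary axis -/

/-- The three products have the signs of the cusps a/c, b/d and (a + b)/(c + d), the images of ∞, 0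
and 1. Any two of them multiply to n(n + 1) for an integer n, for instance n = bc, because the
determinant is 1; so no two have opposite signs. -/
theorem pairwise_products_nonneg {a b c d : ℤ} (h : a * d - b * c = 1) :
    (0 ≤ a * c ∧ 0 ≤ b * d ∧ 0 ≤ (a + b) * (c + d)) ∨
      (a * c ≤ 0 ∧ b * d ≤ 0 ∧ (a + b) * (c + d) ≤ 0) := by
  have key : ∀ {n : ℤ}, 0 ≤ n * (n + 1) := fun {n} => by
    rcases le_or_gt 0 n with h | h
    · positivity
    · exact mul_nonneg_of_nonpos_of_nonpos h.le (by linarith)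
  have h1 : 0 ≤ (a * c) * (b * d) := by
    have := key (n := b * c)
    have e : a * d = b * c + 1 := by linarith
    calc 0 ≤ b * c * (b * c + 1) := this
      _ = b * c * (a * d) := by rw [e]
      _ = _ := by ring
  have h2 : 0 ≤ (a * c) * ((a + b) * (c + d)) := by
    have := key (n := c * (a + b))
    have e : a * (c + d) = c * (a + b) + 1 := by linarith
    calc 0 ≤ c * (a + b) * (c * (a + b) + 1) := this
      _ = c * (a + b) * (a * (c + d)) := by rw [e]
      _ = _ := by ring
  have h3 : 0 ≤ (b * d) * ((a + b) * (c + d)) := by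
    have := key (n := b * (c + d))
    have e : d * (a + b) = b * (c + d) + 1 := by linarith
    calc 0 ≤ b * (c + d) * (b * (c + d) + 1) := this
      _ = b * (c + d) * (d * (a + b)) := by rw [e]
      _ = _ := by ring
  generalize a * c = x at *
  generalize b * d = y at *
  generalize (a + b) * (c + d) = z at *
  have s : ∀ {x y : ℤ}, 0 ≤ x * y → 0 < x → 0 ≤ y := fun h hx => nonneg_of_mul_nonneg_right h hx
  by_cases hx : 0 < x
  · exact .inl ⟨hx.le, s h1 hx, s h2 hx⟩
  by_cases hy : 0 < y
  · exact .inl ⟨s (by linarith [mul_comm x y]) hy, hy.le, s h3 hy⟩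
  by_cases hz : 0 < z
  · exact .inl ⟨s (by linarith [mul_comm x z]) hz, s (by linarith [mul_comm y z]) hz, hz.le⟩
  exact .inr ⟨not_lt.mp hx, not_lt.mp hy, not_lt.mp hz⟩

/-- The three cusps of the image do not lie strictly on both sides of the imaginary axis, hence
neither does the image. -/
theorem smul_idealTriangle_subset (γ : PSL2Z) :
    γ • idealTriangle ⊆ rightHalf 0 ∨ γ • idealTriangle ⊆ leftHalf 0 := by
  obtain ⟨A, rfl⟩ := QuotientGroup.mk_surjective γ
  have hdet := A.det_coe
  rw [Matrix.det_fin_two] at hdet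
  -- The numerator of the real part is a combination of the three cusp products whose weights |z|² -
  -- re z, re z and 1 - re z are nonnegative exactly on the ideal triangle.
  have num_eq : ∀ z : ℍ, (A 0 0 : ℝ) * A 1 0 * (z.re ^ 2 + z.im ^ 2) +
      ((A 0 0 : ℝ) * A 1 1 + A 0 1 * A 1 0) * z.re + A 0 1 * A 1 1 =
      (A 0 0 * A 1 0 : ℤ) * (sqNorm z - z.re) +
        ((A 0 0 + A 0 1) * (A 1 0 + A 1 1) : ℤ) * z.re + (A 0 1 * A 1 1 : ℤ) * (1 - z.re) :=
    fun z => by push_cast; unfold sqNorm; ring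
  rcases pairwise_products_nonneg hdet with ⟨h1, h2, h3⟩ | ⟨h1, h2, h3⟩
  · left
    rintro _ ⟨z, ⟨hz1, hz2, hz3⟩, rfl⟩
    change 0 ≤ ((QuotientGroup.mk A : PSL2Z) • z).re
    rw [re_mk_smul, num_eq]
    refine div_nonneg ?_ (re_sq_add_im_sq_denom_pos A z).le
    refine add_nonneg (add_nonneg ?_ ?_) ?_ <;> refine mul_nonneg (by exact_mod_cast ‹_›) ?_ <;>
      linarith
  · right
    rintro _ ⟨z, ⟨hz1, hz2, hz3⟩, rfl⟩
    change ((QuotientGroup.mk A : PSL2Z) • z).re ≤ 0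
    rw [re_mk_smul, num_eq]
    refine div_nonpos_of_nonpos_of_nonneg ?_ (re_sq_add_im_sq_denom_pos A z).le
    refine add_nonpos (add_nonpos ?_ ?_) ?_ <;>
      refine mul_nonpos_of_nonpos_of_nonneg (by exact_mod_cast ‹_›) ?_ <;> linarith

theorem triangle_subset_idealTriangle : triangle ⊆ idealTriangle := by
  rw [idealTriangle_eq]; exact subset_union_left

theorem u₁_smul_triangle_subset_idealTriangle : u₁ • triangle ⊆ idealTriangle := by
  rw [idealTriangle_eq]; exact subset_union_of_subset_right subset_union_left _

theorem imagAxis_subset_triangle : imagAxis ⊆ triangle := fun z (hz : z.re = 0) => by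
  rw [mem_triangle_iff, hz]
  exact ⟨le_rfl, by norm_num, by simpa using (sqNorm_pos z).le⟩

theorem s₀_smul_imagAxis : s₀ • imagAxis = imagAxis := by
  ext z
  rw [mem_smul_set_iff_inv_smul_mem, s₀_inv]
  change (s₀ • z).re = 0 ↔ z.re = 0
  rw [re_s₀_smul', div_eq_zero_iff, neg_eq_zero, or_iff_left (sqNorm_pos z).ne']

/-- This excludes that a translate lies on both sides at once, so the side of the ideal triangle is
determined by that of its third △. -/
theorem not_smul_triangleCore_subset_imagAxis (γ : PSL2Z) : ¬ γ • triangleCore ⊆ imagAxis := by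
  intro h
  obtain ⟨z, hz⟩ := triangleCore_nonempty
  have h1 : (γ • z).re = 0 := h (smul_mem_smul_set hz)
  have h2 := eq_one_or_s₀_of_mem (smul_mem_smul_set (triangleCore_subset hz)) h1
  have h3 : z ∈ γ⁻¹ • imagAxis := mem_inv_smul_set_iff.mpr h1
  have h4 : z.re = 0 := by
    rcases h2 with rfl | rfl
    · simpa [imagAxis] using h3
    · rwa [s₀_inv, s₀_smul_imagAxis] at h3
  exact hz.1.ne' h4

theorem smul_idealTriangle_subset_rightHalf {γ : PSL2Z} (h : γ • triangle ⊆ rightHalf 0) :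
    γ • idealTriangle ⊆ rightHalf 0 := by
  refine (smul_idealTriangle_subset γ).resolve_right fun h' => ?_
  refine not_smul_triangleCore_subset_imagAxis γ fun z hz => ?_
  have hz' := smul_set_mono triangleCore_subset hz
  exact le_antisymm (h' (smul_set_mono triangle_subset_idealTriangle hz')) (h hz')

theorem smul_idealTriangle_subset_leftHalf {γ : PSL2Z} (h : γ • triangle ⊆ leftHalf 0) :
    γ • idealTriangle ⊆ leftHalf 0 := by
  refine (smul_idealTriangle_subset γ).resolve_left fun h' => ?_
  refine not_smul_triangleCore_subset_imagAxis γ fun z hz => ?_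
  have hz' := smul_set_mono triangleCore_subset hz
  exact le_antisymm (h hz') (h' (smul_set_mono triangle_subset_idealTriangle hz'))

/-- Turning around γρ stays within one ideal triangle, so it cannot change sides. -/
theorem mul_u₁_smul_triangle_subset_rightHalf {γ : PSL2Z} (h : γ • triangle ⊆ rightHalf 0) :
    (γ * u₁) • triangle ⊆ rightHalf 0 := by
  rw [mul_smul]
  exact (smul_set_mono u₁_smul_triangle_subset_idealTriangle).trans
    (smul_idealTriangle_subset_rightHalf h)

theorem mul_u₁_smul_triangle_subset_leftHalf {γ : PSL2Z} (h : γ • triangle ⊆ leftHalf 0) :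
    (γ * u₁) • triangle ⊆ leftHalf 0 := by
  rw [mul_smul]
  exact (smul_set_mono u₁_smul_triangle_subset_idealTriangle).trans
    (smul_idealTriangle_subset_leftHalf h)

theorem eq_one_or_s₀_of_smul_imagAxis_subset {γ : PSL2Z} (h : γ • imagAxis ⊆ imagAxis) :
    γ = 1 ∨ γ = s₀ := by
  have h0 : UpperHalfPlane.I ∈ imagAxis := rfl
  exact eq_one_or_s₀_of_mem (smul_mem_smul_set (imagAxis_subset_triangle h0))
    (h (smul_mem_smul_set h0))

theorem smul_imagAxis_subset_smul_triangle (γ : PSL2Z) : γ • imagAxis ⊆ γ • triangle :=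
  smul_set_mono imagAxis_subset_triangle

theorem smul_imagAxis_subset_mul_s₀_smul_triangle (γ : PSL2Z) :
    γ • imagAxis ⊆ (γ * s₀) • triangle := by
  conv_lhs => rw [← s₀_smul_imagAxis, ← mul_smul]
  exact smul_set_mono imagAxis_subset_triangle

/-- The triangles γ△ and γs₀△ share the line γ·`imagAxis`. If they were on different sides, this
line would lie in the imaginary axis, which happens only for γ = 1 or s₀. -/
theorem mul_s₀_smul_triangle_subset_rightHalf {γ : PSL2Z} (h : γ • triangle ⊆ rightHalf 0)
    (h1 : γ ≠ 1) (h2 : γ ≠ s₀) : (γ * s₀) • triangle ⊆ rightHalf 0 := by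
  refine (smul_set_mono triangle_subset_idealTriangle).trans
    ((smul_idealTriangle_subset (γ * s₀)).resolve_right fun h' => ?_)
  refine (eq_one_or_s₀_of_smul_imagAxis_subset fun z hz => ?_).elim h1 h2
  exact le_antisymm (h' (smul_set_mono triangle_subset_idealTriangle
    (smul_imagAxis_subset_mul_s₀_smul_triangle γ hz)))
    (h (smul_imagAxis_subset_smul_triangle γ hz))

theorem mul_s₀_smul_triangle_subset_leftHalf {γ : PSL2Z} (h : γ • triangle ⊆ leftHalf 0)
    (h1 : γ ≠ 1) (h2 : γ ≠ s₀) : (γ * s₀) • triangle ⊆ leftHalf 0 := by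
  refine (smul_set_mono triangle_subset_idealTriangle).trans
    ((smul_idealTriangle_subset (γ * s₀)).resolve_left fun h' => ?_)
  refine (eq_one_or_s₀_of_smul_imagAxis_subset fun z hz => ?_).elim h1 h2
  exact le_antisymm (h (smul_imagAxis_subset_smul_triangle γ hz))
    (h' (smul_set_mono triangle_subset_idealTriangle
      (smul_imagAxis_subset_mul_s₀_smul_triangle γ hz)))

/-! ### The sides of the triangle -/

theorem mem_u₁_smul_rightHalf_iff {z : ℍ} :
    z ∈ u₁ • rightHalf (1 / 2) ↔ 2 * z.re ≤ sqNorm z := by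
  have h := sqNorm_pos z
  rw [mem_smul_set_iff_inv_smul_mem, rightHalf, mem_ofPred_eq, re_u₁_inv_smul', le_sub_comm,
    div_le_iff₀ h]
  constructor <;> intro <;> linarith

/-- The geodesic ray that joins the point `k + i m` with `∞`. -/
def verticalRay (k m : ℝ) : Set ℍ := {z | z.re = k ∧ m ≤ z.im}

theorem mem_iToInfty_iff {z : ℍ} : z ∈ iToInfty ↔ z.re = 0 ∧ 1 ≤ sqNorm z := by
  have := z.im_pos
  refine and_congr_right fun h => ?_
  rw [sqNorm, h]
  constructor <;> intro <;> nlinarith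

theorem mem_iToZero_iff {z : ℍ} : z ∈ iToZero ↔ z.re = 0 ∧ sqNorm z ≤ 1 := by
  have := z.im_pos
  refine and_congr_right fun h => ?_
  rw [sqNorm, h]
  constructor <;> intro <;> nlinarith

theorem mem_rhoToInfty_iff {z : ℍ} : z ∈ rhoToInfty ↔ z.re = 1 / 2 ∧ 1 ≤ sqNorm z := by
  have := z.im_pos
  have h3 : √3 ^ 2 = 3 := Real.sq_sqrt (by norm_num)
  have h0 : 0 < √3 := by positivity
  refine and_congr_right fun h => ?_
  rw [sqNorm, h]
  constructor <;> intro <;> nlinarith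

theorem mem_rhoToZero_iff {z : ℍ} :
    z ∈ rhoToZero ↔ z.re ≤ 1 / 2 ∧ sqNorm z = 2 * z.re := by
  have h := norm_coe_sub_one_sq z
  have h0 := norm_nonneg ((z : ℂ) - 1)
  rw [rhoToZero, mem_ofPred_eq, and_comm]
  refine and_congr_right fun _ => ⟨fun h1 => ?_, fun h1 => ?_⟩
  · rw [h1] at h; linarith
  · rw [h1] at h; nlinarith

theorem s₀_smul_iToInfty : s₀ • iToInfty = iToZero := by
  ext z
  have h := sqNorm_pos z
  rw [mem_smul_set_iff_inv_smul_mem, s₀_inv, mem_iToInfty_iff, mem_iToZero_iff, re_s₀_smul',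
    sqNorm_s₀_smul, div_eq_zero_iff, neg_eq_zero, or_iff_left h.ne', le_div_iff₀ h, one_mul]

theorem u₁_smul_rhoToInfty : u₁ • rhoToInfty = rhoToZero := by
  ext z
  have h := sqNorm_pos z
  rw [mem_smul_set_iff_inv_smul_mem, mem_rhoToInfty_iff, mem_rhoToZero_iff, re_u₁_inv_smul',
    sqNorm_u₁_inv_smul, le_div_iff₀ h, one_mul]
  have : 1 - z.re / sqNorm z = 1 / 2 ↔ sqNorm z = 2 * z.re := by
    rw [sub_eq_iff_eq_add, ← sub_eq_iff_eq_add', eq_div_iff h.ne']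
    constructor <;> intro <;> linarith
  rw [this]
  constructor <;> rintro ⟨h1, h2⟩ <;> refine ⟨?_, ?_⟩ <;> linarith

theorem iToInfty_subset_imagAxis : iToInfty ⊆ imagAxis := fun _ h => h.1

theorem iToZero_subset_imagAxis : iToZero ⊆ imagAxis := fun _ h => h.1

theorem iToInfty_union_iToZero : iToInfty ∪ iToZero = imagAxis := by
  ext z
  simp only [iToInfty, iToZero, imagAxis, mem_union, mem_ofPred_eq, ← and_or_left]
  exact and_iff_left (le_total _ _)

theorem rhoToInfty_subset_triangle : rhoToInfty ⊆ triangle := fun z hz => by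
  rw [mem_rhoToInfty_iff] at hz
  rw [mem_triangle_iff, hz.1]
  exact ⟨by norm_num, le_rfl, by linarith [hz.2]⟩

theorem rhoToZero_subset_triangle : rhoToZero ⊆ triangle := fun z hz => by
  rw [mem_rhoToZero_iff] at hz
  have := sqNorm_pos z
  rw [mem_triangle_iff]
  exact ⟨by linarith, hz.1, hz.2.ge⟩

theorem re_pos_of_mem_rhoToInfty {z : ℍ} (hz : z ∈ rhoToInfty) : 0 < z.re := by
  rw [hz.1]; norm_num

theorem re_pos_of_mem_rhoToZero {z : ℍ} (hz : z ∈ rhoToZero) : 0 < z.re := by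
  rw [mem_rhoToZero_iff] at hz
  linarith [sqNorm_pos z]

/-- The point `ρ = exp(πi/3)`. -/
def rho : ℍ := ⟨⟨1 / 2, √3 / 2⟩, by positivity⟩

theorem sqNorm_rho : sqNorm rho = 1 := by
  have h3 : √3 ^ 2 = 3 := Real.sq_sqrt (by norm_num)
  change (1 / 2 : ℝ) ^ 2 + (√3 / 2) ^ 2 = 1
  linarith

theorem u₁_smul_rho : u₁ • rho = rho := by
  have h : rho.re = 1 / 2 := rfl
  refine ext_re_sqNorm ?_ ?_
  · rw [re_u₁_smul', sqNorm_rho, h]; norm_num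
  · rw [sqNorm_u₁_smul, sqNorm_rho, h]; norm_num

theorem s₀_smul_I : s₀ • UpperHalfPlane.I = UpperHalfPlane.I := by
  have h : sqNorm UpperHalfPlane.I = 1 := by simp [sqNorm]
  refine ext_re_sqNorm ?_ ?_
  · rw [re_s₀_smul']; simp
  · rw [sqNorm_s₀_smul, h]; norm_num

theorem rhoToInfty_inter_rhoToZero : rhoToInfty ∩ rhoToZero = {rho} := by
  ext z
  have h : rho.re = 1 / 2 := rfl
  rw [mem_inter_iff, mem_rhoToInfty_iff, mem_rhoToZero_iff, mem_singleton_iff]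
  constructor
  · rintro ⟨⟨h1, -⟩, -, h2⟩
    exact ext_re_sqNorm (h1.trans h.symm) (by rw [sqNorm_rho, h2, h1]; norm_num)
  · rintro rfl
    rw [sqNorm_rho, h]
    norm_num

theorem iToInfty_inter_iToZero : iToInfty ∩ iToZero = {UpperHalfPlane.I} := by
  ext z
  constructor
  · rintro ⟨⟨h1, h2⟩, -, h3⟩
    exact UpperHalfPlane.ext (Complex.ext h1 (le_antisymm h3 h2))
  · rintro rfl
    simp [iToInfty, iToZero]

/-! ### Geodesic arcs and their extremities -/

theorem isGeodesicArc_smul {A : Set ℍ} (h : IsGeodesicArc A) (γ : PSL2Z) :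
    IsGeodesicArc (γ • A) := by
  obtain ⟨c, I, hc, h1, h2, h3, rfl⟩ := h
  exact ⟨fun t => γ • c t, I, (isometry_smul ℍ γ).comp hc, h1, h2, h3, by
    rw [← image_smul, image_image]⟩

theorem isGeodesicArc_imagAxis : IsGeodesicArc imagAxis := by
  refine ⟨_, univ, UpperHalfPlane.isometry_vertical_line 0, ordConnected_univ, isClosed_univ,
    nontrivial_univ, ?_⟩
  ext z
  constructor
  · rintro ⟨t, -, rfl⟩; rfl
  · intro hz
    refine ⟨Real.log z.im, trivial, UpperHalfPlane.ext (Complex.ext ?_ ?_)⟩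
    · exact Eq.symm hz
    · exact Real.exp_log z.im_pos

theorem isGeodesicArc_verticalRay (k : ℝ) {m : ℝ} (hm : 0 < m) :
    IsGeodesicArc (verticalRay k m) := by
  refine ⟨_, Ici (Real.log m), UpperHalfPlane.isometry_vertical_line k, ordConnected_Ici,
    isClosed_Ici, ⟨Real.log m, self_mem_Ici, Real.log m + 1, by simp, by simp⟩, ?_⟩
  ext z
  constructor
  · rintro ⟨t, ht, rfl⟩
    exact ⟨rfl, (Real.log_le_iff_le_exp hm).mp ht⟩
  · rintro ⟨h1, h2⟩
    refine ⟨Real.log z.im, Real.log_le_log hm h2, UpperHalfPlane.ext (Complex.ext ?_ ?_)⟩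
    · exact h1.symm
    · exact Real.exp_log z.im_pos

theorem mem_geodSegment_of_re_eq {x y z : ℍ} (h1 : y.re = x.re) (h2 : x.re = z.re)
    (h3 : y.im ≤ x.im) (h4 : x.im ≤ z.im) : x ∈ geodSegment y z := by
  have h5 := Real.log_le_log y.im_pos h3
  have h6 := Real.log_le_log x.im_pos h4
  rw [geodSegment, mem_ofPred_eq, UpperHalfPlane.dist_of_re_eq h1, UpperHalfPlane.dist_of_re_eq h2,
    UpperHalfPlane.dist_of_re_eq (h1.trans h2), Real.dist_eq, Real.dist_eq, Real.dist_eq,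
    abs_of_nonpos (by linarith), abs_of_nonpos (by linarith), abs_of_nonpos (by linarith)]
  ring

theorem not_mem_extremities_of_re_eq {A : Set ℍ} {x y z : ℍ} (hy : y ∈ A) (hz : z ∈ A)
    (h1 : y.re = x.re) (h2 : x.re = z.re) (h3 : y.im < x.im) (h4 : x.im < z.im) :
    x ∉ extremities A := by
  rintro ⟨-, h⟩
  rcases h y hy z hz (mem_geodSegment_of_re_eq h1 h2 h3.le h4.le) with rfl | rfl
  · exact lt_irrefl _ h3
  · exact lt_irrefl _ h4

theorem extremities_imagAxis : extremities imagAxis = ∅ := by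
  rw [eq_empty_iff_forall_notMem]
  intro x hx
  have h0 : x.re = 0 := hx.1
  have hp := x.im_pos
  exact not_mem_extremities_of_re_eq (A := imagAxis) (y := ⟨⟨0, x.im / 2⟩, by positivity⟩)
    (z := ⟨⟨0, 2 * x.im⟩, by positivity⟩) rfl rfl h0.symm h0
    (by change x.im / 2 < x.im; linarith) (by change x.im < 2 * x.im; linarith) hx

/-- In the coordinate log im, which is an isometry on vertical lines, the ray is [log m, ∞). -/
theorem extremities_verticalRay (k : ℝ) {m : ℝ} (hm : 0 < m) :
    extremities (verticalRay k m) = {⟨⟨k, m⟩, hm⟩} := by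
  ext x
  rw [mem_singleton_iff]
  constructor
  · intro hx
    obtain ⟨h1, h2⟩ := hx.1
    have hp := x.im_pos
    rcases h2.eq_or_lt with h2 | h2
    · exact UpperHalfPlane.ext (Complex.ext h1 h2.symm)
    · refine absurd hx (not_mem_extremities_of_re_eq (y := ⟨⟨k, m⟩, hm⟩)
        (z := ⟨⟨k, 2 * x.im⟩, by positivity⟩) ⟨rfl, le_rfl⟩ ⟨rfl, ?_⟩ h1.symm h1 h2 ?_)
      · change m ≤ 2 * x.im; linarith
      · change x.im < 2 * x.im; linarith
  · rintro rfl
    refine ⟨⟨rfl, le_rfl⟩, fun y hy z hz h => ?_⟩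
    have hy' := Real.log_le_log hm hy.2
    have hz' := Real.log_le_log hm hz.2
    set p : ℍ := ⟨⟨k, m⟩, hm⟩
    have e1 : y.re = p.re := hy.1
    have e2 : p.re = z.re := hz.1.symm
    rw [geodSegment, mem_ofPred_eq, UpperHalfPlane.dist_of_re_eq e1,
      UpperHalfPlane.dist_of_re_eq e2, UpperHalfPlane.dist_of_re_eq (e1.trans e2), Real.dist_eq,
      Real.dist_eq, Real.dist_eq] at h
    change |Real.log y.im - Real.log m| + |Real.log m - Real.log z.im| = _ at h
    rw [abs_of_nonneg (by linarith), abs_of_nonpos (by linarith)] at h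
    rcases le_total (Real.log y.im) (Real.log z.im) with h5 | h5
    · left
      rw [abs_of_nonpos (by linarith)] at h
      exact UpperHalfPlane.ext (Complex.ext hy.1.symm
        (Real.log_injOn_pos hm y.im_pos (by change Real.log m = Real.log y.im; linarith)))
    · right
      rw [abs_of_nonneg (by linarith)] at h
      exact UpperHalfPlane.ext (Complex.ext hz.1.symm
        (Real.log_injOn_pos hm z.im_pos (by change Real.log m = Real.log z.im; linarith)))

theorem smul_mem_geodSegment_iff (γ : PSL2Z) {x y z : ℍ} :
    γ • x ∈ geodSegment (γ • y) (γ • z) ↔ x ∈ geodSegment y z := by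
  rw [geodSegment, geodSegment, mem_ofPred_eq, mem_ofPred_eq, dist_smul, dist_smul, dist_smul]

theorem smul_mem_extremities {A : Set ℍ} {x : ℍ} (hx : x ∈ extremities A) (γ : PSL2Z) :
    γ • x ∈ extremities (γ • A) := by
  refine ⟨smul_mem_smul_set hx.1, ?_⟩
  rintro _ ⟨y, hy, rfl⟩ _ ⟨z, hz, rfl⟩ h
  rcases hx.2 y hy z hz ((smul_mem_geodSegment_iff γ).mp h) with h | h
  exacts [.inl (congrArg _ h), .inr (congrArg _ h)]

theorem extremities_smul (γ : PSL2Z) (A : Set ℍ) : extremities (γ • A) = γ • extremities A := by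
  ext x
  rw [mem_smul_set_iff_inv_smul_mem]
  constructor <;> intro hx
  · have := smul_mem_extremities hx γ⁻¹
    rwa [inv_smul_smul] at this
  · have := smul_mem_extremities hx γ
    rwa [smul_inv_smul] at this

theorem extremities_iToInfty : extremities iToInfty = {UpperHalfPlane.I} :=
  extremities_verticalRay 0 one_pos

theorem extremities_rhoToInfty : extremities rhoToInfty = {rho} :=
  extremities_verticalRay (1 / 2) (by positivity)

theorem extremities_iToZero : extremities iToZero = {UpperHalfPlane.I} := by
  rw [← s₀_smul_iToInfty, extremities_smul, extremities_iToInfty, smul_set_singleton, s₀_smul_I]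

theorem extremities_rhoToZero : extremities rhoToZero = {rho} := by
  rw [← u₁_smul_rhoToInfty, extremities_smul, extremities_rhoToInfty, smul_set_singleton,
    u₁_smul_rho]

theorem isGeodesicArc_iToInfty : IsGeodesicArc iToInfty := isGeodesicArc_verticalRay 0 one_pos

theorem isGeodesicArc_rhoToInfty : IsGeodesicArc rhoToInfty :=
  isGeodesicArc_verticalRay (1 / 2) (by positivity)

theorem isGeodesicArc_iToZero : IsGeodesicArc iToZero := by
  rw [← s₀_smul_iToInfty]; exact isGeodesicArc_smul isGeodesicArc_iToInfty _

theorem isGeodesicArc_rhoToZero : IsGeodesicArc rhoToZero := by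
  rw [← u₁_smul_rhoToInfty]; exact isGeodesicArc_smul isGeodesicArc_rhoToInfty _

theorem IsGeodesicArc.nontrivial {A : Set ℍ} (h : IsGeodesicArc A) : A.Nontrivial := by
  obtain ⟨c, I, hc, -, -, h3, rfl⟩ := h
  exact h3.image hc.injective

/-! ### Angles -/

/-- The Cayley transforms centred at v and at γv differ by a constant rotation, so γ preserves
angles. For γ fixing v, the constant is the rotation that γ induces at v. -/
theorem cayley_mk_smul (A : SL(2, ℤ)) (v : ℍ) :
    ((A 1 0 * (starRingEnd ℂ) (v : ℂ) + A 1 1) / (A 1 0 * v + A 1 1) : ℂ) ≠ 0 ∧ ∀ a : ℍ,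
    ((((QuotientGroup.mk A : PSL2Z) • a : ℍ) : ℂ) - ((QuotientGroup.mk A : PSL2Z) • v : ℍ)) /
        (((QuotientGroup.mk A : PSL2Z) • a : ℍ) -
          (starRingEnd ℂ) (((QuotientGroup.mk A : PSL2Z) • v : ℍ) : ℂ)) =
      (A 1 0 * (starRingEnd ℂ) (v : ℂ) + A 1 1) / (A 1 0 * v + A 1 1) *
        (((a : ℂ) - v) / (a - (starRingEnd ℂ) (v : ℂ))) := by
  have hdet := A.det_coe
  rw [Matrix.det_fin_two] at hdet
  have hdet' : (A 0 0 : ℂ) * A 1 1 - A 0 1 * A 1 0 = 1 := by exact_mod_cast hdet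
  have hne : ∀ z : ℂ, z.im ≠ 0 → (A 1 0 : ℂ) * z + A 1 1 ≠ 0 := fun z hz h => by
    have h1 := congrArg Complex.im h
    have h2 := congrArg Complex.re h
    simp [hz] at h1
    simp [h1] at h2
    simp [h1, h2] at hdet
  have hv := hne v v.im_ne_zero
  have hv' := hne ((starRingEnd ℂ) (v : ℂ)) (by simpa using v.im_ne_zero)
  refine ⟨div_ne_zero hv' hv, fun a => ?_⟩
  have ha := hne a a.im_ne_zero
  have hav : (a : ℂ) - (starRingEnd ℂ) (v : ℂ) ≠ 0 := fun h => by
    have h1 := congrArg Complex.im h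
    have := a.im_pos
    have := v.im_pos
    simp at h1
    linarith
  have h1 : (((QuotientGroup.mk A : PSL2Z) • a : ℍ) : ℂ) - ((QuotientGroup.mk A : PSL2Z) • v : ℍ) =
      (a - v) / ((A 1 0 * a + A 1 1) * (A 1 0 * v + A 1 1)) := by
    rw [coe_mk_smul, coe_mk_smul, div_sub_div _ _ ha hv]
    congr 1
    linear_combination ((a : ℂ) - v) * hdet'
  have h2 : (((QuotientGroup.mk A : PSL2Z) • a : ℍ) : ℂ) -
      (starRingEnd ℂ) (((QuotientGroup.mk A : PSL2Z) • v : ℍ) : ℂ) =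
      (a - (starRingEnd ℂ) (v : ℂ)) /
        ((A 1 0 * a + A 1 1) * (A 1 0 * (starRingEnd ℂ) (v : ℂ) + A 1 1)) := by
    rw [coe_mk_smul, coe_mk_smul]
    simp only [map_div₀, map_add, map_mul, map_intCast]
    rw [div_sub_div _ _ ha hv']
    congr 1
    linear_combination ((a : ℂ) - (starRingEnd ℂ) (v : ℂ)) * hdet'
  rw [h1, h2]
  generalize (A 1 0 : ℂ) * a + A 1 1 = x at *
  generalize (A 1 0 : ℂ) * v + A 1 1 = y at *
  generalize (A 1 0 : ℂ) * (starRingEnd ℂ) (v : ℂ) + A 1 1 = w at *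
  field_simp

theorem hypAngle_smul (γ : PSL2Z) (v a b : ℍ) :
    hypAngle (γ • v) (γ • a) (γ • b) = hypAngle v a b := by
  obtain ⟨A, rfl⟩ := QuotientGroup.mk_surjective γ
  obtain ⟨hc, h⟩ := cayley_mk_smul A v
  rw [hypAngle, h, h, Complex.angle_mul_left hc, hypAngle]

theorem AdjacentWithAngle.smul {A B : Set ℍ} {θ : ℝ} (h : AdjacentWithAngle A B θ) (γ : PSL2Z) :
    AdjacentWithAngle (γ • A) (γ • B) θ := by
  obtain ⟨v, h1, h2, h3, h4⟩ := h
  refine ⟨γ • v, ?_, ?_, ?_, ?_⟩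
  · rw [← smul_set_inter, h1, smul_set_singleton]
  · rw [extremities_smul]; exact smul_mem_smul_set h2
  · rw [extremities_smul]; exact smul_mem_smul_set h3
  · rintro _ ⟨a, ha, rfl⟩ hav _ ⟨b, hb, rfl⟩ hbv
    rw [hypAngle_smul]
    exact h4 a ha (fun h => hav (by rw [h])) b hb (fun h => hbv (by rw [h]))

theorem AdjacentWithAngle.symm {A B : Set ℍ} {θ : ℝ} (h : AdjacentWithAngle A B θ) :
    AdjacentWithAngle B A θ := by
  obtain ⟨v, h1, h2, h3, h4⟩ := h
  refine ⟨v, by rw [inter_comm, h1], h3, h2, fun b hb hbv a ha hav => ?_⟩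
  rw [hypAngle, InnerProductGeometry.angle_comm]
  exact h4 a ha hav b hb hbv

/-- On the vertical line through v the Cayley transform is real, positive above v and negative
below. -/
theorem cayley_of_re_eq {a v : ℍ} (h : a.re = v.re) :
    ((a : ℂ) - v) / (a - (starRingEnd ℂ) (v : ℂ)) =
      (((a.im - v.im) / (a.im + v.im) : ℝ) : ℂ) := by
  have h1 : (a : ℂ) - v = ((a.im - v.im : ℝ) : ℂ) * Complex.I := by
    apply Complex.ext <;> simp [h]
  have h2 : (a : ℂ) - (starRingEnd ℂ) (v : ℂ) = ((a.im + v.im : ℝ) : ℂ) * Complex.I := by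
    apply Complex.ext <;> simp [h]
  rw [h1, h2, mul_div_mul_right _ _ Complex.I_ne_zero, Complex.ofReal_div]

theorem adjacentWithAngle_iToInfty_iToZero : AdjacentWithAngle iToInfty iToZero Real.pi := by
  refine ⟨UpperHalfPlane.I, iToInfty_inter_iToZero, by rw [extremities_iToInfty]; rfl,
    by rw [extremities_iToZero]; rfl, ?_⟩
  rintro a ⟨ha, ha'⟩ hav b ⟨hb, hb'⟩ hbv
  have hi : UpperHalfPlane.I.im = 1 := rfl
  have ha1 : 1 < a.im := ha'.lt_of_ne fun h => hav (UpperHalfPlane.ext (Complex.ext ha h.symm))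
  have hb1 : b.im < 1 := hb'.lt_of_ne fun h => hbv (UpperHalfPlane.ext (Complex.ext hb h))
  have hbp := b.im_pos
  rw [hypAngle, cayley_of_re_eq (v := UpperHalfPlane.I) ha,
    cayley_of_re_eq (v := UpperHalfPlane.I) hb, hi]
  have h1 : 0 < (a.im - 1) / (a.im + 1) := div_pos (by linarith) (by linarith)
  have h2 : (b.im - 1) / (b.im + 1) < 0 := div_neg_of_neg_of_pos (by linarith) (by linarith)
  rw [InnerProductGeometry.angle_eq_pi_iff]
  refine ⟨by exact_mod_cast h1.ne', ((b.im - 1) / (b.im + 1)) / ((a.im - 1) / (a.im + 1)),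
    div_neg_of_neg_of_pos h2 h1, ?_⟩
  rw [Complex.real_smul, ← Complex.ofReal_mul, div_mul_cancel₀ _ h1.ne']

/-- Since |ρ| = 1, the quotient is ρ² = exp(2πi/3), the rotation that u₁ induces at its fixed point
ρ. -/
theorem angle_one_rho_sq :
    InnerProductGeometry.angle (1 : ℂ) ((rho : ℂ) / (starRingEnd ℂ) (rho : ℂ)) =
      2 * Real.pi / 3 := by
  have h3 : √3 * √3 = 3 := Real.mul_self_sqrt (by norm_num)
  have h1 : (rho : ℂ) = ⟨1 / 2, √3 / 2⟩ := rfl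
  have h2 : (rho : ℂ) / (starRingEnd ℂ) (rho : ℂ) = ⟨-(1 / 2), √3 / 2⟩ := by
    have h0 : (starRingEnd ℂ) (rho : ℂ) ≠ 0 := fun h => by
      have := congrArg Complex.re h
      simp [h1] at this
    rw [div_eq_iff h0, h1]
    apply Complex.ext <;> simp <;> linarith
  have h4 : ‖(⟨-(1 / 2), √3 / 2⟩ : ℂ)‖ = 1 := by
    rw [Complex.norm_eq_sqrt_sq_add_sq, Real.sqrt_eq_one]
    simp only
    linarith
  rw [h2, InnerProductGeometry.angle, h4]
  have h5 : inner ℝ (1 : ℂ) (⟨-(1 / 2), √3 / 2⟩ : ℂ) = -(1 / 2) := by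
    simp [Complex.inner]
  rw [h5]
  simp only [norm_one, mul_one, div_one]
  rw [Real.arccos_neg, ← Real.cos_pi_div_three, Real.arccos_cos] <;> linarith [Real.pi_pos]

theorem adjacentWithAngle_rhoToInfty_rhoToZero :
    AdjacentWithAngle rhoToInfty rhoToZero (2 * Real.pi / 3) := by
  refine ⟨rho, rhoToInfty_inter_rhoToZero, by rw [extremities_rhoToInfty]; rfl,
    by rw [extremities_rhoToZero]; rfl, ?_⟩
  -- Seen from ρ, the points of `rhoToInfty` are positive reals, so those of its image under u₁ are
  -- positive multiples of ρ².
  rw [← u₁_smul_rhoToInfty]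
  rintro a ⟨ha, ha'⟩ hav _ ⟨b, ⟨hb, hb'⟩, rfl⟩ hbv
  have key : ∀ z : ℍ, z.re = 1 / 2 → √3 / 2 ≤ z.im → z ≠ rho → 0 < (z.im - rho.im) / (z.im + rho.im) :=
    fun z h1 h2 h3 => by
      have h4 : √3 / 2 < z.im := h2.lt_of_ne fun h => h3 (UpperHalfPlane.ext (Complex.ext h1 h.symm))
      have h5 : rho.im = √3 / 2 := rfl
      have := rho.im_pos
      exact div_pos (by linarith) (by linarith [z.im_pos])
  have h1 := key a ha ha' hav
  have h2 := key b hb hb' fun h => hbv (by simp only [h, u₁_smul_rho])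
  have h3 := (cayley_mk_smul uMatrix rho).2 b
  have h4 : ((uMatrix 1 0 * (starRingEnd ℂ) (rho : ℂ) + uMatrix 1 1) /
      (uMatrix 1 0 * rho + uMatrix 1 1) : ℂ) = rho / (starRingEnd ℂ) (rho : ℂ) := by
    have h1 : (rho : ℂ) = ⟨1 / 2, √3 / 2⟩ := rfl
    congr 1 <;> rw [h1] <;> apply Complex.ext <;> simp [uMatrix] <;> norm_num
  change ((u₁ • b : ℍ) - (u₁ • rho : ℍ)) / ((u₁ • b : ℍ) -
    (starRingEnd ℂ) ((u₁ • rho : ℍ) : ℂ)) = _ at h3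
  rw [u₁_smul_rho, h4, cayley_of_re_eq (a := b) (v := rho) hb, mul_comm,
    ← Complex.real_smul] at h3
  rw [hypAngle]
  simp only
  rw [h3, cayley_of_re_eq (a := a) (v := rho) ha, InnerProductGeometry.angle_smul_right_of_pos _ _ h2,
    ← mul_one (((_ : ℝ) : ℂ)), ← Complex.real_smul,
    InnerProductGeometry.angle_smul_left_of_pos _ _ h1, angle_one_rho_sq]

/-! ### The modular group is the free product of `G₀` and `G₁` -/

theorem re_s₀_smul_neg {z : ℍ} (hz : 0 < z.re) : (s₀ • z).re < 0 := by
  rw [re_s₀_smul']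
  exact div_neg_of_neg_of_pos (by linarith) (sqNorm_pos z)

theorem re_u₁_smul_pos {z : ℍ} (hz : z.re < 0) : 0 < (u₁ • z).re := by
  rw [re_u₁_smul']
  exact div_pos (by linarith) (sub_add_sqNorm_pos z)

theorem re_u₁_inv_smul_pos {z : ℍ} (hz : z.re < 0) : 0 < (u₁⁻¹ • z).re := by
  rw [re_u₁_inv_smul']
  have := div_neg_of_neg_of_pos hz (sqNorm_pos z)
  linarith

/-- The homomorphism from the cyclic group of order `n` given by an element with `m ^ n = 1`. -/
def cyclicHom {M : Type} [Group M] (n : ℕ) (m : M) (h : m ^ n = 1) :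
    Multiplicative (ZMod n) →* M :=
  AddMonoidHom.toMultiplicativeLeft (ZMod.lift n ⟨zmultiplesHom (Additive M) (Additive.ofMul m), by
    simpa using congrArg Additive.ofMul h⟩)

theorem cyclicHom_ofAdd_one {M : Type} [Group M] (n : ℕ) (m : M) (h : m ^ n = 1) :
    cyclicHom n m h (Multiplicative.ofAdd 1) = m := by
  have := ZMod.lift_coe n ⟨zmultiplesHom (Additive M) (Additive.ofMul m), by
    simpa using congrArg Additive.ofMul h⟩ 1
  simp only [Int.cast_one] at this
  simp [cyclicHom, this]

/-- The orders of `s₀` and `u₁`. -/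
def genOrder (b : Bool) : ℕ := bif b then 3 else 2

/-- The generators `s₀` and `u₁`. -/
def gen (b : Bool) : PSL2Z := bif b then u₁ else s₀

theorem gen_pow (b : Bool) : gen b ^ genOrder b = 1 := by
  cases b
  · exact (sq _).trans s₀_mul_self
  · exact (pow_three' _).trans u₁_mul_mul

/-- The natural homomorphism from the free product of cyclic groups of orders 2 and 3 to `Γ`. -/
def freeProductHom : Monoid.CoprodI (fun b => Multiplicative (ZMod (genOrder b))) →* PSL2Z :=
  Monoid.CoprodI.lift fun b => cyclicHom (genOrder b) (gen b) (gen_pow b)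

/-- Ping-pong: s₀ takes re > 0 into re < 0, and both u₁ and u₁⁻¹ take re < 0 into re > 0. -/
theorem freeProductHom_injective : Function.Injective freeProductHom := by
  -- With only two factors, ping-pong requires one of them to have at least three elements; this is
  -- the factor of order 3.
  refine Monoid.CoprodI.lift_injective_of_ping_pong (α := ℍ) _ (.inr ⟨true, ?_⟩)
    (fun b => bif b then {z | 0 < z.re} else {z | z.re < 0}) ?_ ?_ ?_
  · change (3 : Cardinal) ≤ Cardinal.mk (Multiplicative (ZMod 3))
    rw [Cardinal.mk_multiplicative]
    change (3 : Cardinal) ≤ Cardinal.mk (Fin 3)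
    simp
  · rintro (_ | _)
    · exact ⟨⟨⟨-1, 1⟩, one_pos⟩, by change (-1 : ℝ) < 0; norm_num⟩
    · exact ⟨⟨⟨1, 1⟩, one_pos⟩, by change (0 : ℝ) < 1; norm_num⟩
  · rintro (_ | _) (_ | _) h
    · exact absurd rfl h
    · exact Set.disjoint_left.mpr fun z (h1 : z.re < 0) (h2 : 0 < z.re) => lt_asymm h1 h2
    · exact Set.disjoint_left.mpr fun z (h1 : 0 < z.re) (h2 : z.re < 0) => lt_asymm h1 h2
    · exact absurd rfl h
  · rintro (_ | _) (_ | _) h x hx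
    · exact absurd rfl h
    · have h0 : ∀ y : ZMod 2, y ≠ 0 → y = 1 := by decide
      have h1 : x = Multiplicative.ofAdd (1 : ZMod (genOrder false)) := h0 x hx
      rw [h1, cyclicHom_ofAdd_one]
      rintro _ ⟨z, hz, rfl⟩
      exact re_s₀_smul_neg hz
    · have h0 : ∀ y : ZMod 3, y ≠ 0 → y = 1 ∨ y = -1 := by decide
      have h1 : x = Multiplicative.ofAdd (1 : ZMod (genOrder true)) ∨
        x = (Multiplicative.ofAdd (1 : ZMod (genOrder true)))⁻¹ := h0 x hx
      rcases h1 with h1 | h1 <;> rw [h1]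
      · rw [cyclicHom_ofAdd_one]
        rintro _ ⟨z, hz, rfl⟩
        exact re_u₁_smul_pos hz
      · rw [map_inv, cyclicHom_ofAdd_one]
        rintro _ ⟨z, hz, rfl⟩
        exact re_u₁_inv_smul_pos hz
    · exact absurd rfl h

theorem freeProductHom_of (b : Bool) :
    freeProductHom (Monoid.CoprodI.of (i := b) (Multiplicative.ofAdd 1)) = gen b := by
  rw [freeProductHom, Monoid.CoprodI.lift_of, cyclicHom_ofAdd_one]

theorem freeProductHom_surjective : Function.Surjective freeProductHom := by
  rw [← MonoidHom.range_eq_top, eq_top_iff, ← closure_s₀_u₁, Subgroup.closure_le]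
  rintro _ (rfl | rfl)
  exacts [⟨_, freeProductHom_of false⟩, ⟨_, freeProductHom_of true⟩]

/-- The universal property of `Γ`. -/
theorem exists_hom_of_relations {M : Type} [Group M] {a b : M} (ha : a * a = 1)
    (hb : b * b * b = 1) : ∃ f : PSL2Z →* M, f s₀ = a ∧ f u₁ = b := by
  let e := MulEquiv.ofBijective freeProductHom
    ⟨freeProductHom_injective, freeProductHom_surjective⟩
  let c : Bool → M := fun i => bif i then b else a
  have hc : ∀ i, c i ^ genOrder i = 1 := by
    rintro (_ | _)
    exacts [(sq _).trans ha, (pow_three' _).trans hb]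
  let f : PSL2Z →* M :=
    (Monoid.CoprodI.lift fun i => cyclicHom (genOrder i) (c i) (hc i)).comp e.symm.toMonoidHom
  have hf : ∀ i, f (gen i) = c i := fun i => by
    have : e.symm (gen i) = Monoid.CoprodI.of (i := i) (Multiplicative.ofAdd 1) := by
      rw [MulEquiv.symm_apply_eq]; exact (freeProductHom_of i).symm
    change (Monoid.CoprodI.lift fun i => cyclicHom (genOrder i) (c i) (hc i))
      (e.symm (gen i)) = _
    rw [this, Monoid.CoprodI.lift_of, cyclicHom_ofAdd_one]
  exact ⟨f, hf false, hf true⟩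

/-! ### The combinatorics of the cut tree -/

section

variable {G : Subgroup PSL2Z}

theorem RCoset.of_eq_of {a b : PSL2Z} : RCoset.of G a = RCoset.of G b ↔ b * a⁻¹ ∈ G := by
  rw [RCoset.of, RCoset.of, Quotient.eq, QuotientGroup.rightRel_apply]

theorem RCoset.of_mulRight (a b : PSL2Z) : (RCoset.of G a).mulRight b = RCoset.of G (a * b) := rfl

theorem RCoset.of_mul_left {g : PSL2Z} (hg : g ∈ G) (a : PSL2Z) :
    RCoset.of G (g * a) = RCoset.of G a := by
  rw [RCoset.of_eq_of, mul_inv_rev, mul_inv_cancel_left]; exact inv_mem hg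

theorem mem_of_of_mul_eq {g a : PSL2Z} (h : RCoset.of G (g * a) = RCoset.of G a) : g ∈ G := by
  rw [RCoset.of_eq_of, mul_inv_rev, mul_inv_cancel_left] at h
  exact inv_mem_iff.mp h

theorem RCoset.mulRight_s₀_s₀ (x : RCoset G) : (x.mulRight s₀).mulRight s₀ = x := by
  rw [← RCoset.mulRight_mul, s₀_mul_self, RCoset.mulRight_one]

theorem RCoset.mulRight_u₁_u₁_u₁ (x : RCoset G) :
    ((x.mulRight u₁).mulRight u₁).mulRight u₁ = x := by
  rw [← RCoset.mulRight_mul, ← RCoset.mulRight_mul, ← mul_assoc, u₁_mul_mul,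
    RCoset.mulRight_one]

theorem end0_eq_iff {x y : RCoset G} :
    (Xcomb G).end0 x = (Xcomb G).end0 y ↔ y = x ∨ y = x.mulRight s₀ := by
  have : (Xcomb G).end0 x = (Xcomb G).end0 y ↔ ∃ k ∈ G₀, x.mulRight k = y := Quotient.eq
  rw [this]
  constructor
  · rintro ⟨k, hk, rfl⟩
    rcases mem_G₀_iff.mp hk with rfl | rfl
    exacts [.inl x.mulRight_one, .inr rfl]
  · rintro (rfl | rfl)
    exacts [⟨1, one_mem _, y.mulRight_one⟩, ⟨s₀, Subgroup.mem_zpowers _, rfl⟩]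

theorem end1_eq_iff {x y : RCoset G} : (Xcomb G).end1 x = (Xcomb G).end1 y ↔
    y = x ∨ y = x.mulRight u₁ ∨ y = (x.mulRight u₁).mulRight u₁ := by
  have : (Xcomb G).end1 x = (Xcomb G).end1 y ↔ ∃ k ∈ G₁, x.mulRight k = y := Quotient.eq
  rw [this]
  constructor
  · rintro ⟨k, hk, rfl⟩
    rcases mem_G₁_iff.mp hk with rfl | rfl | rfl
    exacts [.inl x.mulRight_one, .inr (.inl rfl), .inr (.inr (x.mulRight_mul _ _))]
  · rintro (rfl | rfl | rfl)
    exacts [⟨1, one_mem _, y.mulRight_one⟩, ⟨u₁, Subgroup.mem_zpowers _, rfl⟩,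
      ⟨u₁ * u₁, mem_G₁_iff.mpr (.inr (.inr rfl)), x.mulRight_mul _ _⟩]

theorem valency0_eq_one_iff {x : RCoset G} :
    (Xcomb G).valency0 ((Xcomb G).end0 x) = 1 ↔ x.mulRight s₀ = x := by
  rw [BipGraph.valency0, Set.encard_eq_one]
  constructor
  · rintro ⟨a, ha⟩
    have h1 : x ∈ ({a} : Set (RCoset G)) := ha ▸ rfl
    have h2 : x.mulRight s₀ ∈ ({a} : Set (RCoset G)) := ha ▸ end0_mulRight x
    exact (h2 : _ = _).trans (h1 : _ = _).symm
  · intro h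
    refine ⟨x, Set.eq_singleton_iff_unique_mem.mpr ⟨rfl, fun y hy => ?_⟩⟩
    rcases end0_eq_iff.mp (Eq.symm hy) with h' | h'
    exacts [h', h'.trans h]

theorem valency1_eq_one_iff {x : RCoset G} :
    (Xcomb G).valency1 ((Xcomb G).end1 x) = 1 ↔ x.mulRight u₁ = x := by
  rw [BipGraph.valency1, Set.encard_eq_one]
  constructor
  · rintro ⟨a, ha⟩
    have h1 : x ∈ ({a} : Set (RCoset G)) := ha ▸ rfl
    have h2 : x.mulRight u₁ ∈ ({a} : Set (RCoset G)) :=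
      ha ▸ (end1_eq_iff.mpr (.inr (.inl rfl))).symm
    exact (h2 : _ = _).trans (h1 : _ = _).symm
  · intro h
    refine ⟨x, Set.eq_singleton_iff_unique_mem.mpr ⟨rfl, fun y hy => ?_⟩⟩
    rcases end1_eq_iff.mp (Eq.symm hy) with h' | h' | h'
    exacts [h', h'.trans h, by rw [h', h, h]]

variable {C : Set (Xcomb G).Vert0}

theorem mulRight_s₀_ne_of_mem (hC : ∀ v ∈ C, (Xcomb G).valency0 v = 2) {x : RCoset G}
    (hx : (Xcomb G).end0 x ∈ C) : x.mulRight s₀ ≠ x := fun h => by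
  have h1 := hC _ hx
  rw [valency0_eq_one_iff.mpr h] at h1
  norm_num at h1

theorem cut_end0_eq {x : RCoset G} (h : (Xcomb G).end0 x ∉ C) :
    ((Xcomb G).cut C).end0 (x.mulRight s₀) = ((Xcomb G).cut C).end0 x := by
  have h' : (Xcomb G).end0 (x.mulRight s₀) ∉ C := by rwa [end0_mulRight]
  simp only [BipGraph.cut, h, h', dif_neg, not_false_eq_true]
  congr 2
  exact end0_mulRight x

theorem eq_or_of_cut_end0_eq {x y : RCoset G}
    (h : ((Xcomb G).cut C).end0 x = ((Xcomb G).cut C).end0 y) :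
    y = x ∨ (Xcomb G).end0 x ∉ C ∧ y = x.mulRight s₀ := by
  by_cases hx : (Xcomb G).end0 x ∈ C <;> by_cases hy : (Xcomb G).end0 y ∈ C <;>
    simp only [BipGraph.cut, hx, hy, dif_pos, dif_neg, not_false_eq_true, Sum.inl.injEq,
      Sum.inr.injEq, Subtype.mk.injEq, reduceCtorEq] at h
  · exact .inl (congrArg Subtype.val h).symm
  · rcases end0_eq_iff.mp h with h | h
    exacts [.inl h, .inr ⟨hx, h⟩]

/-- Induction over the edges of the connected graph `X'`. -/
theorem cut_induction (hX' : ((Xcomb G).cut C).IsTree) {Q : RCoset G → Prop} {x₀ : RCoset G}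
    (base : Q x₀) (step0 : ∀ x, (Xcomb G).end0 x ∉ C → Q x → Q (x.mulRight s₀))
    (step1 : ∀ x, Q x → Q (x.mulRight u₁)) (x : RCoset G) : Q x := by
  -- The property is extended to the vertices of the subdivision: it holds at a vertex if it holds
  -- on all edges meeting it. Then it propagates along walks.
  let R : ((Xcomb G).cut C).Edge ⊕ (((Xcomb G).cut C).Vert0 ⊕ ((Xcomb G).cut C).Vert1) → Prop :=
    Sum.elim Q (Sum.elim (fun v => ∀ e, ((Xcomb G).cut C).end0 e = v → Q e)
      fun v => ∀ e, ((Xcomb G).cut C).end1 e = v → Q e)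
  have h0 : ∀ e : ((Xcomb G).cut C).Edge, Q e → ∀ e', ((Xcomb G).cut C).end0 e' =
      ((Xcomb G).cut C).end0 e → Q e' := fun e he e' h => by
    rcases eq_or_of_cut_end0_eq h.symm with h | ⟨h1, h2⟩
    · rwa [h]
    · rw [h2]; exact step0 e h1 he
  have h1 : ∀ e : ((Xcomb G).cut C).Edge, Q e → ∀ e', ((Xcomb G).cut C).end1 e' =
      ((Xcomb G).cut C).end1 e → Q e' := fun e he e' h => by
    rcases end1_eq_iff.mp h.symm with h | h | h <;> rw [h]
    exacts [he, step1 _ he, step1 _ (step1 _ he)]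
  have hR : ∀ a b, ((Xcomb G).cut C).subdivision.Adj a b → R a → R b := by
    intro a b hab ha
    rw [BipGraph.subdivision, SimpleGraph.fromRel_adj] at hab
    obtain ⟨-, ⟨e, rfl, rfl | rfl⟩ | ⟨e, rfl, rfl | rfl⟩⟩ := hab
    · exact h0 e ha
    · exact h1 e ha
    · exact ha e rfl
    · exact ha e rfl
  obtain ⟨w⟩ := hX'.connected.preconnected (Sum.inl x₀) (Sum.inl x)
  have : ∀ a b, ((Xcomb G).cut C).subdivision.Walk a b → R a → R b := by
    intro a b w
    induction w with
    | nil => exact id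
    | cons h _ ih => exact fun ha => ih (hR _ _ h ha)
  exact this _ _ w base

variable {j : ((Xcomb G).cut C).Hom treeT}

theorem of_edgeElt (hj : (treeProj G).comp j = (Xcomb G).cutProj C) (x : RCoset G) :
    RCoset.of G (edgeElt j x) = x :=
  congrFun (congrArg BipGraph.Hom.onEdge hj) x

theorem edgeElt_injective (hj : (treeProj G).comp j = (Xcomb G).cutProj C) :
    Function.Injective (edgeElt j) := fun x y h => by
  rw [← of_edgeElt hj x, h, of_edgeElt hj]

/-- The morphism j keeps the common vertex of x and xs₀, so it can change the edge only by an
element of G₀; this is not 1 because j is injective on edges. -/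
theorem edgeElt_mulRight_s₀ (hj : (treeProj G).comp j = (Xcomb G).cutProj C) {x : RCoset G}
    (hx : (Xcomb G).end0 x ∉ C) (hne : x.mulRight s₀ ≠ x) :
    edgeElt j (x.mulRight s₀) = edgeElt j x * s₀ := by
  have h1 : treeT.end0 (edgeElt j x) = treeT.end0 (edgeElt j (x.mulRight s₀)) := by
    exact (j.map_end0 x).trans
      ((congrArg j.onVert0 (cut_end0_eq hx)).symm.trans (j.map_end0 (x.mulRight s₀)).symm)
  have h2 : (edgeElt j x)⁻¹ * edgeElt j (x.mulRight s₀) ∈ G₀ := QuotientGroup.eq.mp h1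
  rcases mem_G₀_iff.mp h2 with h | h
  · exact absurd (edgeElt_injective hj (inv_mul_eq_one.mp h)).symm hne
  · exact inv_mul_eq_iff_eq_mul.mp h

theorem edgeElt_mulRight_u₁ (hj : (treeProj G).comp j = (Xcomb G).cutProj C) {x : RCoset G}
    (hne : x.mulRight u₁ ≠ x) : edgeElt j (x.mulRight u₁) = edgeElt j x * u₁ := by
  have h0 : ((Xcomb G).cut C).end1 x = ((Xcomb G).cut C).end1 (x.mulRight u₁) :=
    end1_eq_iff.mpr (.inr (.inl rfl))
  have h1 : treeT.end1 (edgeElt j x) = treeT.end1 (edgeElt j (x.mulRight u₁)) := by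
    exact (j.map_end1 x).trans ((congrArg j.onVert1 h0).trans (j.map_end1 (x.mulRight u₁)).symm)
  have h2 : (edgeElt j x)⁻¹ * edgeElt j (x.mulRight u₁) ∈ G₁ := QuotientGroup.eq.mp h1
  rcases mem_G₁_iff.mp h2 with h | h | h
  · exact absurd (edgeElt_injective hj (inv_mul_eq_one.mp h)).symm hne
  · exact inv_mul_eq_iff_eq_mul.mp h
  -- The factor u₁² is excluded by projecting to G\Γ: xu₁ = xu₁² would give xu₁ = x.
  · rw [inv_mul_eq_iff_eq_mul] at h
    have h3 := congrArg (RCoset.of G) h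
    rw [of_edgeElt hj, ← mul_assoc, ← RCoset.of_mulRight, ← RCoset.of_mulRight, of_edgeElt hj] at h3
    have h4 := congrArg (fun y => RCoset.mulRight (RCoset.mulRight y u₁) u₁) h3
    simp only [RCoset.mulRight_u₁_u₁_u₁] at h4
    exact absurd h4.symm hne

end

/-! ### The presentation of `G` given by the side pairings -/

section

variable {G : Subgroup PSL2Z} {C : Set (Xcomb G).Vert0} {j : ((Xcomb G).cut C).Hom treeT}

/-- In every case g_s j(x) lies in the coset Gj(x), as the projection of j(x) to G\Γ is x. -/
theorem sidePairing_mem (hj : (treeProj G).comp j = (Xcomb G).cutProj C) (s : Side G C) :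
    sidePairing j s ∈ G := by
  rcases s with ⟨x, h⟩ | ⟨x, h, b⟩ | ⟨x, h, b⟩
  · refine mem_of_of_mul_eq (a := edgeElt j x) ?_
    rw [sidePairing, inv_mul_cancel_right, ← RCoset.of_mulRight, of_edgeElt hj, of_edgeElt hj,
      RCoset.mulRight_s₀_s₀]
  · refine mem_of_of_mul_eq (a := edgeElt j x) ?_
    rw [sidePairing, inv_mul_cancel_right, ← RCoset.of_mulRight, of_edgeElt hj,
      valency0_eq_one_iff.mp h]
  · have hu := valency1_eq_one_iff.mp h
    refine mem_of_of_mul_eq (a := edgeElt j x) ?_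
    cases b
    · rw [sidePairing, inv_mul_cancel_right, ← RCoset.of_mulRight, of_edgeElt hj, u₁_inv,
        RCoset.mulRight_mul, hu, hu]
    · rw [sidePairing, inv_mul_cancel_right, ← RCoset.of_mulRight, of_edgeElt hj, hu]

theorem sidePairing_sigma (s : Side G C) :
    sidePairing j (sigma s) = (sidePairing j s)⁻¹ := by
  rcases s with ⟨x, h⟩ | ⟨x, h, b⟩ | ⟨x, h, b⟩
  · simp only [sigma, sidePairing, RCoset.mulRight_s₀_s₀, mul_inv_rev, inv_inv, s₀_inv, mul_assoc]
  · simp only [sigma, sidePairing, mul_inv_rev, inv_inv, s₀_inv, mul_assoc]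
  · cases b <;> simp [sigma, sidePairing, mul_assoc]

theorem sidePairing_even_mul_self (x : RCoset G) (h b) :
    sidePairing j (Side.even x h b : Side G C) * sidePairing j (Side.even x h b : Side G C) = 1 := by
  simp only [sidePairing]
  rw [conj_mul, s₀_mul_self]
  simp

theorem sidePairing_odd_mul_mul (x : RCoset G) (h b) :
    sidePairing j (Side.odd x h b : Side G C) * sidePairing j (Side.odd x h b : Side G C) *
      sidePairing j (Side.odd x h b : Side G C) = 1 := by
  cases b
  · simp only [sidePairing]
    rw [conj_mul, conj_mul, ← mul_inv_rev, ← mul_inv_rev, ← mul_assoc, u₁_mul_mul]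
    simp
  · simp only [sidePairing]
    rw [conj_mul, conj_mul, u₁_mul_mul]
    simp

theorem sigma_sigma (s : Side G C) : sigma (sigma s) = s := by
  rcases s with ⟨x, h⟩ | ⟨x, h, b⟩ | ⟨x, h, b⟩
  · simp only [sigma, RCoset.mulRight_s₀_s₀]
  · simp [sigma]
  · simp [sigma]

theorem sigma_ne (hC : ∀ v ∈ C, (Xcomb G).valency0 v = 2) (s : Side G C) : sigma s ≠ s := by
  rcases s with ⟨x, h⟩ | ⟨x, h, b⟩ | ⟨x, h, b⟩
  · simpa only [sigma, ne_eq, Side.free.injEq] using mulRight_s₀_ne_of_mem hC h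
  · simp [sigma]
  · simp [sigma]

/-! ### The covering of X_comb(G) with group K, and its monodromy -/

section Cover

variable {K : Type} [Group K] (k : Side G C → K)

open Classical in
/-- The factor by which `s₀` moves the sheets of the covering with group `K` given by `k`. -/
def sheetShift0 (x : RCoset G) : K :=
  -- The inverse appears because g_s, for the free side s at x, belongs to the step from xs₀ back to
  -- x.
  if h : (Xcomb G).end0 x ∈ C then (k (.free x h))⁻¹
  else if h : (Xcomb G).valency0 ((Xcomb G).end0 x) = 1 then k (.even x h true) else 1

open Classical in
/-- The factor by which `u₁` moves the sheets of the covering with group `K` given by `k`. -/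
def sheetShift1 (x : RCoset G) : K :=
  if h : (Xcomb G).valency1 ((Xcomb G).end1 x) = 1 then k (.odd x h true) else 1

/-- The action of `s₀` on the edges of the covering. -/
def coverMap0 (p : K × RCoset G) : K × RCoset G := (p.1 * sheetShift0 k p.2, p.2.mulRight s₀)

/-- The action of `u₁` on the edges of the covering. -/
def coverMap1 (p : K × RCoset G) : K × RCoset G := (p.1 * sheetShift1 k p.2, p.2.mulRight u₁)

variable {k}

theorem sheetShift0_mul (hσ : ∀ s, k (sigma s) = (k s)⁻¹)
    (heven : ∀ x h b, k (.even x h b) * k (.even x h b) = 1) (x : RCoset G) :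
    sheetShift0 k x * sheetShift0 k (x.mulRight s₀) = 1 := by
  by_cases h : (Xcomb G).end0 x ∈ C
  · have h' : (Xcomb G).end0 (x.mulRight s₀) ∈ C := by rwa [end0_mulRight]
    have := hσ (.free x h)
    simp only [sigma] at this
    rw [sheetShift0, sheetShift0, dif_pos h, dif_pos h', this, inv_inv, inv_mul_cancel]
  · by_cases h1 : (Xcomb G).valency0 ((Xcomb G).end0 x) = 1
    · rw [valency0_eq_one_iff.mp h1, sheetShift0, dif_neg h, dif_pos h1, heven]
    · have h' : (Xcomb G).end0 (x.mulRight s₀) ∉ C := by rwa [end0_mulRight]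
      have h1' : ¬ (Xcomb G).valency0 ((Xcomb G).end0 (x.mulRight s₀)) = 1 := by
        rwa [end0_mulRight]
      rw [sheetShift0, sheetShift0, dif_neg h, dif_neg h', dif_neg h1, dif_neg h1', one_mul]

theorem sheetShift1_mul (hodd : ∀ x h b, k (.odd x h b) * k (.odd x h b) * k (.odd x h b) = 1)
    (x : RCoset G) : sheetShift1 k x * sheetShift1 k (x.mulRight u₁) *
      sheetShift1 k ((x.mulRight u₁).mulRight u₁) = 1 := by
  by_cases h : (Xcomb G).valency1 ((Xcomb G).end1 x) = 1
  · have := valency1_eq_one_iff.mp h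
    rw [this, this, sheetShift1, dif_pos h, hodd]
  · have e1 : (Xcomb G).end1 (x.mulRight u₁) = (Xcomb G).end1 x :=
      (end1_eq_iff.mpr (.inr (.inl rfl))).symm
    have e2 : (Xcomb G).end1 ((x.mulRight u₁).mulRight u₁) = (Xcomb G).end1 x :=
      (end1_eq_iff.mpr (.inr (.inr rfl))).symm
    have h1 : ¬ (Xcomb G).valency1 ((Xcomb G).end1 (x.mulRight u₁)) = 1 := by rwa [e1]
    have h2 : ¬ (Xcomb G).valency1 ((Xcomb G).end1 ((x.mulRight u₁).mulRight u₁)) = 1 := by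
      rwa [e2]
    rw [sheetShift1, sheetShift1, sheetShift1, dif_neg h, dif_neg h1, dif_neg h2, one_mul, one_mul]

/-- The right action of `Γ` on the edges of the covering with group `K` given by `k`. -/
theorem exists_cover_action (hσ : ∀ s, k (sigma s) = (k s)⁻¹)
    (heven : ∀ x h b, k (.even x h b) * k (.even x h b) = 1)
    (hodd : ∀ x h b, k (.odd x h b) * k (.odd x h b) * k (.odd x h b) = 1) :
    ∃ act : PSL2Z → K × RCoset G → K × RCoset G, (∀ p, act 1 p = p) ∧
      (∀ γ δ p, act (γ * δ) p = act δ (act γ p)) ∧ act s₀ = coverMap0 k ∧ act u₁ = coverMap1 k := by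
  have h0 : ∀ p, coverMap0 k (coverMap0 k p) = p := fun p => by
    simp only [coverMap0, RCoset.mulRight_s₀_s₀, mul_assoc, sheetShift0_mul hσ heven, mul_one]
  have h1 : ∀ p, coverMap1 k (coverMap1 k (coverMap1 k p)) = p := fun p => by
    simp only [coverMap1, RCoset.mulRight_u₁_u₁_u₁]
    rw [mul_assoc, mul_assoc, ← mul_assoc (sheetShift1 k p.2), sheetShift1_mul hodd, mul_one]
  let a : Equiv.Perm (K × RCoset G) := ⟨coverMap0 k, coverMap0 k, h0, h0⟩
  let b : Equiv.Perm (K × RCoset G) := ⟨coverMap1 k, fun p => coverMap1 k (coverMap1 k p), h1, h1⟩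
  -- The action is from the right, hence the opposite of the permutation group.
  obtain ⟨f, hf0, hf1⟩ := exists_hom_of_relations (M := (Equiv.Perm (K × RCoset G))ᵐᵒᵖ)
    (a := MulOpposite.op a) (b := MulOpposite.op b)
    (by rw [← MulOpposite.op_mul, MulOpposite.op_eq_one_iff]; exact Equiv.ext h0)
    (by
      rw [← MulOpposite.op_mul, ← MulOpposite.op_mul, MulOpposite.op_eq_one_iff]
      exact Equiv.ext h1)
  refine ⟨fun γ p => (f γ).unop p, fun p => ?_, fun γ δ p => ?_, ?_, ?_⟩
  · simp
  · simp
  · funext p; simp only [hf0]; rfl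
  · funext p; simp only [hf1]; rfl

/-- ψ(g) is the sheet reached from (1, x₀) by the path that g describes in the covering. Steps
inside X' do not change the sheet; the step through the end of X' belonging to s changes it by k(s).
-/
theorem exists_hom_of_pairing (hC : ∀ v ∈ C, (Xcomb G).valency0 v = 2)
    (hX' : ((Xcomb G).cut C).IsTree) (hj : (treeProj G).comp j = (Xcomb G).cutProj C)
    (hσ : ∀ s, k (sigma s) = (k s)⁻¹)
    (heven : ∀ x h b, k (.even x h b) * k (.even x h b) = 1)
    (hodd : ∀ x h b, k (.odd x h b) * k (.odd x h b) * k (.odd x h b) = 1) :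
    ∃ ψ : G →* K, ∀ s, ψ ⟨sidePairing j s, sidePairing_mem hj s⟩ = k s := by
  obtain ⟨act, act_one, act_mul, act_s₀, act_u₁⟩ := exists_cover_action hσ heven hodd
  -- The right action of Γ commutes with left multiplication by K on the sheets, which makes the
  -- monodromy multiplicative.
  have equivariant : ∀ (γ : PSL2Z) (c : K) (x : RCoset G),
      act γ (c, x) = (c * (act γ (1, x)).1, x.mulRight γ) := by
    intro γ
    induction γ using induction_mul_right with
    | one => intro c x; simp [act_one, RCoset.mulRight_one]
    | mul_s₀ γ ih =>
      intro c x
      rw [act_mul, act_mul, ih c, ih 1, act_s₀]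
      simp [coverMap0, RCoset.mulRight_mul, mul_assoc]
    | mul_u₁ γ ih =>
      intro c x
      rw [act_mul, act_mul, ih c, ih 1, act_u₁]
      simp [coverMap1, RCoset.mulRight_mul, mul_assoc]
  set x₀ : RCoset G := RCoset.of G 1
  -- The lift of X' through (1, x₀) stays in the sheet 1, as the shifts are trivial at the steps
  -- available in X'.
  have from_base : ∀ x, act ((edgeElt j x₀)⁻¹ * edgeElt j x) (1, x₀) = (1, x) := by
    refine cut_induction hX' (x₀ := x₀) ?_ ?_ ?_
    · rw [inv_mul_cancel, act_one]
    · intro x hx ih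
      by_cases hne : x.mulRight s₀ = x
      · rwa [hne]
      · rw [edgeElt_mulRight_s₀ hj hx hne, ← mul_assoc, act_mul, ih, act_s₀, coverMap0, sheetShift0,
          dif_neg hx, dif_neg (mt valency0_eq_one_iff.mp hne), one_mul]
    · intro x ih
      by_cases hne : x.mulRight u₁ = x
      · rwa [hne]
      · rw [edgeElt_mulRight_u₁ hj hne, ← mul_assoc, act_mul, ih, act_u₁, coverMap1, sheetShift1,
          dif_neg (mt valency1_eq_one_iff.mp hne), one_mul]
  have to_base : ∀ x, act ((edgeElt j x)⁻¹ * edgeElt j x₀) (1, x) = (1, x₀) := fun x => by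
    rw [← from_base x, ← act_mul]
    simp [mul_assoc, act_one]
  have base_fixed : ∀ g ∈ G, x₀.mulRight ((edgeElt j x₀)⁻¹ * g * edgeElt j x₀) = x₀ := by
    intro g hg
    conv_lhs => rw [← of_edgeElt hj x₀, of_edgeElt hj]
    conv_lhs => rw [← of_edgeElt hj x₀]
    rw [RCoset.of_mulRight, of_edgeElt hj, ← mul_assoc, ← mul_assoc, mul_inv_cancel, one_mul,
      RCoset.of_mul_left hg, of_edgeElt hj]
  -- A step from x to y closes up to a loop at x₀ through X', at no cost in sheets; so ψ can be
  -- computed from the step alone.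
  have transport : ∀ (x y : RCoset G) (γ : PSL2Z) (c : K), act γ (1, x) = (c, y) →
      (act ((edgeElt j x₀)⁻¹ * (edgeElt j x * γ * (edgeElt j y)⁻¹) * edgeElt j x₀) (1, x₀)).1 =
        c := by
    intro x y γ c h
    have e : (edgeElt j x₀)⁻¹ * (edgeElt j x * γ * (edgeElt j y)⁻¹) * edgeElt j x₀ =
      ((edgeElt j x₀)⁻¹ * edgeElt j x) * γ * ((edgeElt j y)⁻¹ * edgeElt j x₀) := by group
    rw [e, act_mul _ (_ * _), act_mul _ γ, from_base, h, equivariant, to_base, mul_one]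
  let ψ : G →* K := MonoidHom.mk'
    (fun g => (act ((edgeElt j x₀)⁻¹ * g * edgeElt j x₀) (1, x₀)).1) fun g h => by
      have e : (edgeElt j x₀)⁻¹ * (g * h : G) * edgeElt j x₀ =
          ((edgeElt j x₀)⁻¹ * g * edgeElt j x₀) * ((edgeElt j x₀)⁻¹ * h * edgeElt j x₀) := by
        push_cast; group
      rw [e, act_mul, equivariant _ 1 x₀, base_fixed g g.2, one_mul, equivariant]
  refine ⟨ψ, fun s => ?_⟩
  change (act ((edgeElt j x₀)⁻¹ * sidePairing j s * edgeElt j x₀) (1, x₀)).1 = k s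
  rcases s with ⟨x, h⟩ | ⟨x, h, b⟩ | ⟨x, h, b⟩
  -- The step is s₀ from xs₀ to x, with shift k(σs)⁻¹ = k(s).
  · refine transport _ _ _ _ ?_
    have h' : (Xcomb G).end0 (x.mulRight s₀) ∈ C := by rwa [end0_mulRight]
    have := hσ (.free x h)
    simp only [sigma] at this
    rw [act_s₀, coverMap0, sheetShift0, dif_pos h', this, inv_inv, one_mul,
      RCoset.mulRight_s₀_s₀]
  · refine transport _ _ _ _ ?_
    have hx := valency0_eq_one_iff.mp h
    rw [act_s₀, coverMap0, sheetShift0, dif_neg fun h => mulRight_s₀_ne_of_mem hC h hx, dif_pos h, hx,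
      one_mul]
    cases b
    · have := hσ (.even x h false)
      simp only [sigma, Bool.not_false] at this
      rw [this, inv_eq_of_mul_eq_one_left (heven x h false)]
    · rfl
  · have hx := valency1_eq_one_iff.mp h
    have htrue : act u₁ (1, x) = (k (.odd x h true), x) := by
      rw [act_u₁, coverMap1, sheetShift1, dif_pos h, hx, one_mul]
    cases b
    · refine transport _ _ _ _ ?_
      have := hσ (.odd x h true)
      simp only [sigma, Bool.not_true] at this
      have h1 := hodd x h true
      rw [u₁_inv, act_mul, htrue, equivariant, htrue, hx, this, inv_eq_of_mul_eq_one_left h1]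
    · exact transport _ _ _ _ htrue

end Cover

/-! ### The side pairings are nontrivial, distinct, generating and independent -/

/-- There is a homomorphism `G → ℤ/n`, `n ≠ 1`, that takes `g_s` to `1` and vanishes at the
side pairings other than `g_s` and its inverse. -/
theorem exists_hom_separating (hC : ∀ v ∈ C, (Xcomb G).valency0 v = 2)
    (hX' : ((Xcomb G).cut C).IsTree) (hj : (treeProj G).comp j = (Xcomb G).cutProj C)
    (s : Side G C) : ∃ (n : ℕ) (ψ : G →* Multiplicative (ZMod n)), n ≠ 1 ∧
      ψ ⟨sidePairing j s, sidePairing_mem hj s⟩ = Multiplicative.ofAdd 1 ∧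
      ∀ t, t ≠ s → t ≠ sigma s → ψ ⟨sidePairing j t, sidePairing_mem hj t⟩ = 1 := by
  classical
  -- The value 0 for a free side stands for the infinite cyclic group, since `ZMod 0` is ℤ. The
  -- orders 2 and 3 for the other sides are those the relations demand.
  let n : ℕ := match s with | .free _ _ => 0 | .even _ _ _ => 2 | .odd _ _ _ => 3
  let k : Side G C → Multiplicative (ZMod n) := fun t =>
    if t = s then Multiplicative.ofAdd 1 else if t = sigma s then Multiplicative.ofAdd (-1) else 1
  have hk : ∀ t, (k t = 1) ∨ (t = s ∧ k t = Multiplicative.ofAdd 1) ∨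
      (t = sigma s ∧ k t = Multiplicative.ofAdd (-1)) := fun t => by
    simp only [k]
    split_ifs with h1 h2
    exacts [.inr (.inl ⟨h1, rfl⟩), .inr (.inr ⟨h2, rfl⟩), .inl rfl]
  have hne := sigma_ne hC s
  have hσ : ∀ t, k (sigma t) = (k t)⁻¹ := by
    intro t
    by_cases h1 : t = s
    · subst h1; simp [k, hne]
    · by_cases h2 : t = sigma s
      · subst h2; simp [k, hne, sigma_sigma]
      · have h3 : sigma t ≠ s := fun h => h2 (by rw [← h, sigma_sigma])
        have h4 : sigma t ≠ sigma s := fun h => h1 (by rw [← sigma_sigma t, h, sigma_sigma])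
        simp [k, h1, h2, h3, h4]
  have heven : ∀ x h b, k (.even x h b) * k (.even x h b) = 1 := by
    intro x h b
    rcases s with ⟨x', h'⟩ | ⟨x', h', b'⟩ | ⟨x', h', b'⟩
    · rcases hk (.even x h b) with e | ⟨e, -⟩ | ⟨e, -⟩
      · rw [e, one_mul]
      all_goals simp [sigma] at e
    · have : ∀ m : ZMod 2, m + m = 0 := by decide
      exact this _
    · rcases hk (.even x h b) with e | ⟨e, -⟩ | ⟨e, -⟩
      · rw [e, one_mul]
      all_goals simp [sigma] at e
  have hodd : ∀ x h b, k (.odd x h b) * k (.odd x h b) * k (.odd x h b) = 1 := by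
    intro x h b
    rcases s with ⟨x', h'⟩ | ⟨x', h', b'⟩ | ⟨x', h', b'⟩
    · rcases hk (.odd x h b) with e | ⟨e, -⟩ | ⟨e, -⟩
      · rw [e, one_mul, one_mul]
      all_goals simp [sigma] at e
    · rcases hk (.odd x h b) with e | ⟨e, -⟩ | ⟨e, -⟩
      · rw [e, one_mul, one_mul]
      all_goals simp [sigma] at e
    · have : ∀ m : ZMod 3, m + m + m = 0 := by decide
      exact this _
  obtain ⟨ψ, hψ⟩ := exists_hom_of_pairing hC hX' hj hσ heven hodd
  refine ⟨n, ψ, ?_, ?_, fun t h1 h2 => ?_⟩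
  · rcases s with ⟨x, h⟩ | ⟨x, h, b⟩ | ⟨x, h, b⟩ <;> simp [n]
  · rw [hψ]; simp [k]
  · rw [hψ]; simp [k, h1, h2]

theorem ofAdd_one_ne_one {n : ℕ} (hn : n ≠ 1) :
    Multiplicative.ofAdd (1 : ZMod n) ≠ 1 := fun h => by
  have h0 : (1 : ZMod n) = 0 := h
  have := (ZMod.natCast_eq_zero_iff 1 n).mp (by simpa using h0)
  exact hn (Nat.dvd_one.mp this)

theorem sidePairing_ne_one (hC : ∀ v ∈ C, (Xcomb G).valency0 v = 2)
    (hX' : ((Xcomb G).cut C).IsTree) (hj : (treeProj G).comp j = (Xcomb G).cutProj C)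
    (s : Side G C) : sidePairing j s ≠ 1 := fun h => by
  obtain ⟨n, ψ, hn, h1, -⟩ := exists_hom_separating hC hX' hj s
  refine ofAdd_one_ne_one hn ?_
  rw [← h1, ← map_one ψ]
  exact congrArg ψ (Subtype.ext h)

theorem sidePairing_ne (hC : ∀ v ∈ C, (Xcomb G).valency0 v = 2)
    (hX' : ((Xcomb G).cut C).IsTree) (hj : (treeProj G).comp j = (Xcomb G).cutProj C)
    {s t : Side G C} (h1 : t ≠ s) (h2 : t ≠ sigma s) : sidePairing j s ≠ sidePairing j t := fun h => by
  obtain ⟨n, ψ, hn, h3, h4⟩ := exists_hom_separating hC hX' hj s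
  refine ofAdd_one_ne_one hn ?_
  rw [← h3, ← h4 t h1 h2]
  exact congrArg ψ (Subtype.ext h)

/-- The side pairings generate `G`. -/
theorem eq_top_of_sidePairing_mem (hj : (treeProj G).comp j = (Xcomb G).cutProj C)
    (R : Subgroup PSL2Z) (hR : R ≤ G) (h : ∀ s : Side G C, sidePairing j s ∈ R) : R = G := by
  refine le_antisymm hR fun g hg => ?_
  set x₀ : RCoset G := RCoset.of G 1
  -- A walk in T from j(x₀) is followed modulo R within the image of X': whenever a step would leave
  -- this image, a side pairing is moved into r.
  have key : ∀ γ, ∃ r ∈ R, ∃ x, edgeElt j x₀ * γ = r * edgeElt j x := by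
    intro γ
    induction γ using induction_mul_right with
    | one => exact ⟨1, one_mem _, x₀, by simp⟩
    | mul_s₀ γ ih =>
      obtain ⟨r, hr, x, hx⟩ := ih
      rw [← mul_assoc, hx]
      by_cases hxC : (Xcomb G).end0 x ∈ C
      · have h' : (Xcomb G).end0 (x.mulRight s₀) ∈ C := by rwa [end0_mulRight]
        refine ⟨_, mul_mem hr (h (.free _ h')), x.mulRight s₀, ?_⟩
        simp [sidePairing, RCoset.mulRight_s₀_s₀, mul_assoc]
      · by_cases hne : x.mulRight s₀ = x
        · refine ⟨_, mul_mem hr (h (.even x (valency0_eq_one_iff.mpr hne) true)), x, ?_⟩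
          simp [sidePairing, mul_assoc]
        · exact ⟨r, hr, x.mulRight s₀, by rw [edgeElt_mulRight_s₀ hj hxC hne, mul_assoc]⟩
    | mul_u₁ γ ih =>
      obtain ⟨r, hr, x, hx⟩ := ih
      rw [← mul_assoc, hx]
      by_cases hne : x.mulRight u₁ = x
      · refine ⟨_, mul_mem hr (h (.odd x (valency1_eq_one_iff.mpr hne) true)), x, ?_⟩
        simp [sidePairing, mul_assoc]
      · exact ⟨r, hr, x.mulRight u₁, by rw [edgeElt_mulRight_u₁ hj hne, mul_assoc]⟩
  obtain ⟨r, hr, x, hx⟩ := key ((edgeElt j x₀)⁻¹ * g * edgeElt j x₀)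
  have hx' : g * edgeElt j x₀ = r * edgeElt j x := by rw [← hx]; group
  have h0 : x₀ = x := by
    rw [← of_edgeElt hj x₀, ← RCoset.of_mul_left hg, hx', RCoset.of_mul_left (hR hr),
      of_edgeElt hj]
  rw [← h0] at hx'
  rwa [mul_right_cancel hx']

/-- The covering construction with K the abstract free product, S labelled by its tautological
generators, gives a homomorphism ψ from G back to K. It is a left inverse of the natural map. -/
theorem isIndependentGeneratingSet (hC : ∀ v ∈ C, (Xcomb G).valency0 v = 2)
    (hX' : ((Xcomb G).cut C).IsTree) (hj : (treeProj G).comp j = (Xcomb G).cutProj C)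
    (S : Set (Side G C)) (hS : ∀ s, ∃! t, t ∈ S ∧ (t = s ∨ t = sigma s)) :
    IsIndependentGeneratingSet
      ((fun s => (⟨sidePairing j s, sidePairing_mem hj s⟩ : G)) '' S) := by
  classical
  set A : Set G := (fun s => (⟨sidePairing j s, sidePairing_mem hj s⟩ : G)) '' S with hA
  have hmem : ∀ s, sigma s ∈ S ↔ s ∉ S := by
    intro s
    obtain ⟨t, ⟨h1, h2⟩, h3⟩ := hS s
    constructor
    · intro h4 h5
      have h6 := h3 s ⟨h5, .inl rfl⟩
      have h7 := h3 (sigma s) ⟨h4, .inr rfl⟩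
      exact sigma_ne hC s (h7.trans h6.symm)
    · intro h4
      rcases h2 with rfl | rfl
      exacts [absurd h1 h4, h1]
  let c : ∀ s ∈ S, Monoid.CoprodI fun a : A => Subgroup.zpowers (a : G) := fun s hs =>
    Monoid.CoprodI.of (i := ⟨⟨sidePairing j s, sidePairing_mem hj s⟩, s, hs, rfl⟩)
      ⟨⟨sidePairing j s, sidePairing_mem hj s⟩, Subgroup.mem_zpowers _⟩
  let k : Side G C → Monoid.CoprodI fun a : A => Subgroup.zpowers (a : G) := fun s =>
    if h : s ∈ S then c s h else (c (sigma s) ((hmem s).mpr h))⁻¹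
  have hkσ : ∀ s, k (sigma s) = (k s)⁻¹ := by
    intro s
    by_cases h : s ∈ S
    · have h' : sigma s ∉ S := fun h' => (hmem s).mp h' h
      simp only [k, dif_pos h, dif_neg h', sigma_sigma]
    · have h' : sigma s ∈ S := (hmem s).mpr h
      simp only [k, dif_neg h, dif_pos h', inv_inv]
  -- A relation satisfied by g_s already holds in the cyclic factor generated by g_s, hence for its
  -- label.
  have hk2 : ∀ s, sidePairing j s * sidePairing j s = 1 → k s * k s = 1 := by
    have : ∀ s (hs : s ∈ S), sidePairing j s * sidePairing j s = 1 → c s hs * c s hs = 1 := by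
      intro s hs h
      rw [← map_mul]
      exact (congrArg _ (Subtype.ext (Subtype.ext h))).trans (map_one _)
    intro s h
    by_cases hs : s ∈ S
    · simp only [k, dif_pos hs]; exact this s hs h
    · simp only [k, dif_neg hs]
      rw [← mul_inv_rev, this _ ((hmem s).mpr hs), inv_one]
      rw [sidePairing_sigma, ← mul_inv_rev, h, inv_one]
  have hk3 : ∀ s, sidePairing j s * sidePairing j s * sidePairing j s = 1 →
      k s * k s * k s = 1 := by
    have : ∀ s (hs : s ∈ S), sidePairing j s * sidePairing j s * sidePairing j s = 1 →
        c s hs * c s hs * c s hs = 1 := by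
      intro s hs h
      rw [← map_mul, ← map_mul]
      exact (congrArg _ (Subtype.ext (Subtype.ext h))).trans (map_one _)
    intro s h
    by_cases hs : s ∈ S
    · simp only [k, dif_pos hs]; exact this s hs h
    · simp only [k, dif_neg hs]
      rw [← mul_inv_rev, ← mul_inv_rev, ← mul_assoc, this _ ((hmem s).mpr hs), inv_one]
      rw [sidePairing_sigma, ← mul_inv_rev, ← mul_inv_rev, ← mul_assoc, h, inv_one]
  obtain ⟨ψ, hψ⟩ := exists_hom_of_pairing hC hX' hj hkσ
    (fun x h b => hk2 _ (sidePairing_even_mul_self x h b))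
    (fun x h b => hk3 _ (sidePairing_odd_mul_mul x h b))
  set φ : (Monoid.CoprodI fun a : A => Subgroup.zpowers (a : G)) →* G :=
    Monoid.CoprodI.lift fun a : A => (Subgroup.zpowers (a : G)).subtype with hφ
  constructor
  · have hcomp : ψ.comp φ = MonoidHom.id _ := by
      refine Monoid.CoprodI.ext_hom _ _ fun a => MonoidHom.ext fun y => ?_
      obtain ⟨_, s, hs, rfl⟩ := a
      obtain ⟨_, m, rfl⟩ := y
      have e1 : φ (c s hs) = ⟨sidePairing j s, sidePairing_mem hj s⟩ := by
        rw [hφ, Monoid.CoprodI.lift_of]; rfl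
      have e2 : ψ (φ (c s hs ^ m)) = c s hs ^ m := by
        rw [map_zpow, map_zpow, e1, hψ]
        simp only [k, dif_pos hs]
      simp only [c, ← map_zpow] at e2
      exact e2
    exact Function.LeftInverse.injective (g := ψ) fun y => DFunLike.congr_fun hcomp y
  · rw [← MonoidHom.range_eq_top]
    have h1 : (φ.range.map G.subtype) = G := by
      refine eq_top_of_sidePairing_mem hj _ (Subgroup.map_subtype_le _) ?_
      have h2 : ∀ s ∈ S, sidePairing j s ∈ φ.range.map G.subtype := by
        intro s hs
        refine ⟨⟨sidePairing j s, sidePairing_mem hj s⟩, ⟨c s hs, ?_⟩, rfl⟩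
        rw [hφ, Monoid.CoprodI.lift_of]
        rfl
      intro s
      by_cases hs : s ∈ S
      · exact h2 s hs
      · rw [← inv_mem_iff, ← sidePairing_sigma]
        exact h2 _ ((hmem s).mpr hs)
    rw [eq_top_iff]
    rintro g -
    have h3 : (g : PSL2Z) ∈ φ.range.map G.subtype := by rw [h1]; exact g.2
    obtain ⟨g', h4, h5⟩ := h3
    rwa [← Subtype.ext h5]

end

/-! ### Copies of the three geodesics -/

theorem iToInfty_ne_iToZero : iToInfty ≠ iToZero := fun h => by
  have h1 := iToInfty_inter_iToZero
  rw [← h, inter_self] at h1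
  exact isGeodesicArc_iToInfty.nontrivial.ne_singleton h1

theorem rhoToInfty_ne_rhoToZero : rhoToInfty ≠ rhoToZero := fun h => by
  have h1 := rhoToInfty_inter_rhoToZero
  rw [← h, inter_self] at h1
  exact isGeodesicArc_rhoToInfty.nontrivial.ne_singleton h1

/-- The three types of geodesics are told apart by their extremities in ℍ: none, a translate of i,
or a translate of ρ. -/
theorem not_isCopy_imagAxis_iToInfty {A : Set ℍ} (h1 : IsCopy A imagAxis) :
    ¬ IsCopy A iToInfty := by
  rintro ⟨δ, h2⟩
  obtain ⟨γ, rfl⟩ := h1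
  have h3 := congrArg extremities h2
  rw [extremities_smul, extremities_smul, extremities_imagAxis, extremities_iToInfty,
    smul_set_empty, smul_set_singleton] at h3
  exact (singleton_nonempty _).ne_empty h3.symm

theorem not_isCopy_imagAxis_rhoToInfty {A : Set ℍ} (h1 : IsCopy A imagAxis) :
    ¬ IsCopy A rhoToInfty := by
  rintro ⟨δ, h2⟩
  obtain ⟨γ, rfl⟩ := h1
  have h3 := congrArg extremities h2
  rw [extremities_smul, extremities_smul, extremities_imagAxis, extremities_rhoToInfty,
    smul_set_empty, smul_set_singleton] at h3
  exact (singleton_nonempty _).ne_empty h3.symm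

/-- The triangles through ρ belong to the powers of u₁, all of which fix ρ; so γi = ρ would force i
= ρ. -/
theorem smul_I_ne_rho (γ : PSL2Z) : γ • UpperHalfPlane.I ≠ rho := fun h => by
  have hI : UpperHalfPlane.I ∈ triangle := imagAxis_subset_triangle rfl
  have hr : rho ∈ rhoToInfty := ⟨rfl, le_rfl⟩
  have h1 : rho ∈ γ • triangle := h ▸ smul_mem_smul_set hI
  have h2 : UpperHalfPlane.I = rho := by
    rw [smul_eq_iff_eq_inv_smul] at h
    rcases eq_one_or_u₁_of_mem (rhoToInfty_subset_triangle hr) h1 (re_pos_of_mem_rhoToInfty hr)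
      with rfl | rfl | rfl
    · rw [h, inv_one, one_smul]
    · rw [h, inv_smul_eq_iff, u₁_smul_rho]
    · rw [h, inv_inv, u₁_smul_rho]
  have h3 : (0 : ℝ) = 1 / 2 := congrArg UpperHalfPlane.re h2
  norm_num at h3

theorem not_isCopy_iToInfty_rhoToInfty {A : Set ℍ} (h1 : IsCopy A iToInfty) :
    ¬ IsCopy A rhoToInfty := by
  rintro ⟨δ, h2⟩
  obtain ⟨γ, rfl⟩ := h1
  have h3 := congrArg extremities h2
  rw [extremities_smul, extremities_smul, extremities_iToInfty, extremities_rhoToInfty,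
    smul_set_singleton, smul_set_singleton, singleton_eq_singleton_iff, ← inv_smul_eq_iff,
    smul_smul] at h3
  exact smul_I_ne_rho _ h3

/-! ### The sides of the polygon -/

section

variable {G : Subgroup PSL2Z} {C : Set (Xcomb G).Vert0} {j : ((Xcomb G).cut C).Hom treeT}

/-- The edge of `X'` that labels a side. -/
def sideEdge : Side G C → RCoset G
  | .free x _ => x
  | .even x _ _ => x
  | .odd x _ _ => x

/-- The side of the standard triangle of which a side of `P` is a translate. -/
def sideBase : Side G C → Set ℍ
  | .free _ _ => imagAxis
  | .even _ _ true => iToInfty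
  | .even _ _ false => iToZero
  | .odd _ _ true => rhoToInfty
  | .odd _ _ false => rhoToZero

theorem sideSet_eq (s : Side G C) : sideSet j s = edgeElt j (sideEdge s) • sideBase s := by
  rcases s with ⟨x, h⟩ | ⟨x, h, _ | _⟩ | ⟨x, h, _ | _⟩ <;> rfl

theorem sideBase_subset_triangle (s : Side G C) : sideBase s ⊆ triangle := by
  rcases s with ⟨x, h⟩ | ⟨x, h, _ | _⟩ | ⟨x, h, _ | _⟩
  exacts [imagAxis_subset_triangle, iToZero_subset_imagAxis.trans imagAxis_subset_triangle,
    iToInfty_subset_imagAxis.trans imagAxis_subset_triangle, rhoToZero_subset_triangle,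
    rhoToInfty_subset_triangle]

theorem isGeodesicArc_sideBase (s : Side G C) : IsGeodesicArc (sideBase s) := by
  rcases s with ⟨x, h⟩ | ⟨x, h, _ | _⟩ | ⟨x, h, _ | _⟩
  exacts [isGeodesicArc_imagAxis, isGeodesicArc_iToZero, isGeodesicArc_iToInfty,
    isGeodesicArc_rhoToZero, isGeodesicArc_rhoToInfty]

theorem isGeodesicArc_sideSet (s : Side G C) : IsGeodesicArc (sideSet j s) := by
  rw [sideSet_eq]
  exact isGeodesicArc_smul (isGeodesicArc_sideBase s) _

theorem extremities_sideSet_subsingleton (s : Side G C) :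
    (extremities (sideSet j s)).Subsingleton := by
  rw [sideSet_eq, extremities_smul]
  refine Subsingleton.image ?_ _
  rcases s with ⟨x, h⟩ | ⟨x, h, _ | _⟩ | ⟨x, h, _ | _⟩
  · exact extremities_imagAxis ▸ subsingleton_empty
  · exact extremities_iToZero ▸ subsingleton_singleton
  · exact extremities_iToInfty ▸ subsingleton_singleton
  · exact extremities_rhoToZero ▸ subsingleton_singleton
  · exact extremities_rhoToInfty ▸ subsingleton_singleton

theorem sideSet_subset_smul_triangle (s : Side G C) :
    sideSet j s ⊆ edgeElt j (sideEdge s) • triangle := by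
  rw [sideSet_eq]
  exact smul_set_mono (sideBase_subset_triangle s)

theorem smul_triangle_subset_polygon (x : RCoset G) : edgeElt j x • triangle ⊆ polygon j :=
  subset_iUnion (fun x => edgeElt j x • triangle) x

theorem sideSet_subset_polygon (s : Side G C) : sideSet j s ⊆ polygon j :=
  (sideSet_subset_smul_triangle s).trans (smul_triangle_subset_polygon _)

theorem mem_range_of_mem_smul_triangle {p : ℍ} {γ : PSL2Z} (hP : polygon j ∈ 𝓝 p)
    (hp : p ∈ γ • triangle) : ∃ x, edgeElt j x = γ :=
  mem_of_mem_smul_triangle (L := range (edgeElt j)) hP (by rw [biUnion_range]; rfl) hp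

theorem isClosed_polygon (hj : (treeProj G).comp j = (Xcomb G).cutProj C) :
    IsClosed (polygon j) :=
  (locallyFinite_smul_triangle.comp_injective (edgeElt_injective hj)).isClosed_iUnion
    fun x => isClosed_triangle.smul (edgeElt j x)

/-- The label of a side as an element of a product. -/
def sideCode : Side G C → RCoset G × Fin 3 × Bool
  | .free x _ => (x, 0, true)
  | .even x _ b => (x, 1, b)
  | .odd x _ b => (x, 2, b)

theorem sideCode_fst (s : Side G C) : (sideCode s).1 = sideEdge s := by
  rcases s with ⟨x, h⟩ | ⟨x, h, b⟩ | ⟨x, h, b⟩ <;> rfl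

theorem sideCode_injective : Function.Injective (sideCode : Side G C → _) := by
  intro s t h
  rcases s with ⟨x, h1⟩ | ⟨x, h1, b⟩ | ⟨x, h1, b⟩ <;>
    rcases t with ⟨y, h2⟩ | ⟨y, h2, c⟩ | ⟨y, h2, c⟩ <;> simp [sideCode] at h ⊢ <;> exact h

theorem finite_side (hG : G.FiniteIndex) : Finite (Side G C) := by
  have h1 : Finite (RCoset G) := Finite.of_equiv _ (QuotientGroup.quotientRightRelEquivQuotientLeftRel G).symm
  exact Finite.of_injective sideCode sideCode_injective

theorem locallyFinite_sideSet (hj : (treeProj G).comp j = (Xcomb G).cutProj C) :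
    LocallyFinite (sideSet j) := by
  intro p
  obtain ⟨U, hU, hfin⟩ :=
    (locallyFinite_smul_triangle.comp_injective (edgeElt_injective hj)) p
  refine ⟨U, hU, ((hfin.prod (finite_univ (α := Fin 3 × Bool))).preimage
    sideCode_injective.injOn).subset ?_⟩
  rintro s ⟨z, hz, hzU⟩
  refine ⟨?_, trivial⟩
  rw [sideCode_fst]
  exact ⟨z, sideSet_subset_smul_triangle s hz, hzU⟩

/-! ### The edges of `T` that are not in the image of `X'` -/

/-- If j(y) = j(x)s₀, then y = xs₀ by projection to G\Γ, and the pairing element of the side at x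
would be trivial. This is where the algebra enters the geometry. -/
theorem edgeElt_ne_mul_s₀ (hC : ∀ v ∈ C, (Xcomb G).valency0 v = 2)
    (hX' : ((Xcomb G).cut C).IsTree) (hj : (treeProj G).comp j = (Xcomb G).cutProj C)
    {x : RCoset G}
    (hx : (Xcomb G).end0 x ∈ C ∨ (Xcomb G).valency0 ((Xcomb G).end0 x) = 1) (y : RCoset G) :
    edgeElt j y ≠ edgeElt j x * s₀ := fun h => by
  have h1 := congrArg (RCoset.of G) h
  rw [← RCoset.of_mulRight, of_edgeElt hj, of_edgeElt hj] at h1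
  subst h1
  rcases hx with hx | hx
  · refine sidePairing_ne_one hC hX' hj (.free x hx) ?_
    rw [sidePairing, h, mul_assoc (edgeElt j x), s₀_mul_self, mul_one, mul_inv_cancel]
  · refine sidePairing_ne_one hC hX' hj (.even x hx true) ?_
    rw [valency0_eq_one_iff.mp hx] at h
    rw [sidePairing, ← h, mul_inv_cancel]

theorem edgeElt_ne_mul_u₁ (hC : ∀ v ∈ C, (Xcomb G).valency0 v = 2)
    (hX' : ((Xcomb G).cut C).IsTree) (hj : (treeProj G).comp j = (Xcomb G).cutProj C)
    {x : RCoset G} (hx : (Xcomb G).valency1 ((Xcomb G).end1 x) = 1) (y : RCoset G) :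
    edgeElt j y ≠ edgeElt j x * u₁ := fun h => by
  have h1 := congrArg (RCoset.of G) h
  rw [← RCoset.of_mulRight, of_edgeElt hj, of_edgeElt hj, valency1_eq_one_iff.mp hx] at h1
  subst h1
  refine sidePairing_ne_one hC hX' hj (.odd y hx true) ?_
  rw [sidePairing, ← h, mul_inv_cancel]

theorem edgeElt_ne_mul_u₁_inv (hC : ∀ v ∈ C, (Xcomb G).valency0 v = 2)
    (hX' : ((Xcomb G).cut C).IsTree) (hj : (treeProj G).comp j = (Xcomb G).cutProj C)
    {x : RCoset G} (hx : (Xcomb G).valency1 ((Xcomb G).end1 x) = 1) (y : RCoset G) :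
    edgeElt j y ≠ edgeElt j x * u₁⁻¹ := fun h => by
  have hu := valency1_eq_one_iff.mp hx
  have h1 := congrArg (RCoset.of G) h
  rw [← RCoset.of_mulRight, of_edgeElt hj, of_edgeElt hj, u₁_inv, RCoset.mulRight_mul, hu, hu] at h1
  subst h1
  refine sidePairing_ne_one hC hX' hj (.odd y hx false) ?_
  rw [sidePairing, ← h, mul_inv_cancel]

/-- The only triangle of `P` that meets a given side is the one that contains it. -/
theorem eq_sideEdge_of_mem (hC : ∀ v ∈ C, (Xcomb G).valency0 v = 2)
    (hX' : ((Xcomb G).cut C).IsTree) (hj : (treeProj G).comp j = (Xcomb G).cutProj C)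
    {s : Side G C} {y : RCoset G} {p : ℍ} (hp : p ∈ sideSet j s)
    (hy : p ∈ edgeElt j y • triangle) : y = sideEdge s := by
  rw [sideSet_eq, mem_smul_set_iff_inv_smul_mem] at hp
  have hy' : (edgeElt j (sideEdge s))⁻¹ • p ∈
      ((edgeElt j (sideEdge s))⁻¹ * edgeElt j y) • triangle := by
    rw [mul_smul]; exact smul_mem_smul_set hy
  have hone : (edgeElt j (sideEdge s))⁻¹ * edgeElt j y = 1 → y = sideEdge s := fun h =>
    (edgeElt_injective hj (inv_mul_eq_one.mp h)).symm
  have even_case : ((edgeElt j (sideEdge s))⁻¹ • p).re = 0 →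
      ((Xcomb G).end0 (sideEdge s) ∈ C ∨
        (Xcomb G).valency0 ((Xcomb G).end0 (sideEdge s)) = 1) → y = sideEdge s := fun h1 h2 => by
    rcases eq_one_or_s₀_of_mem hy' h1 with h | h
    · exact hone h
    · exact absurd (inv_mul_eq_iff_eq_mul.mp h) (edgeElt_ne_mul_s₀ hC hX' hj h2 y)
  have odd_case : 0 < ((edgeElt j (sideEdge s))⁻¹ • p).re →
      (Xcomb G).valency1 ((Xcomb G).end1 (sideEdge s)) = 1 → y = sideEdge s := fun h1 h2 => by
    rcases eq_one_or_u₁_of_mem (sideBase_subset_triangle s hp) hy' h1 with h | h | h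
    · exact hone h
    · exact absurd (inv_mul_eq_iff_eq_mul.mp h) (edgeElt_ne_mul_u₁ hC hX' hj h2 y)
    · exact absurd (inv_mul_eq_iff_eq_mul.mp h) (edgeElt_ne_mul_u₁_inv hC hX' hj h2 y)
  rcases s with ⟨x, h⟩ | ⟨x, h, _ | _⟩ | ⟨x, h, _ | _⟩
  · exact even_case hp (.inl h)
  · exact even_case hp.1 (.inr h)
  · exact even_case hp.1 (.inr h)
  · exact odd_case (re_pos_of_mem_rhoToZero hp) h
  · exact odd_case (re_pos_of_mem_rhoToInfty hp) h

/-- Two sides that meet belong to the same triangle of P. A triangle cannot carry both a free and an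
even side, and its sides on the imaginary axis are disjoint from those at ρ; so the two sides are
paired and meet at i or at ρ, up to translation. -/
theorem mem_extremities_of_mem_inter (hC : ∀ v ∈ C, (Xcomb G).valency0 v = 2)
    (hX' : ((Xcomb G).cut C).IsTree) (hj : (treeProj G).comp j = (Xcomb G).cutProj C)
    {s t : Side G C} (hst : s ≠ t) {p : ℍ} (hs : p ∈ sideSet j s) (ht : p ∈ sideSet j t) :
    p ∈ extremities (sideSet j s) := by
  have hst' := eq_sideEdge_of_mem hC hX' hj hs (sideSet_subset_smul_triangle t ht)
  rw [sideSet_eq] at hs ht ⊢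
  rw [hst'] at ht
  rw [extremities_smul]
  rw [mem_smul_set_iff_inv_smul_mem] at hs ht ⊢
  generalize (edgeElt j (sideEdge s))⁻¹ • p = q at hs ht
  have hfe : ∀ {x : RCoset G}, (Xcomb G).end0 x ∈ C →
      (Xcomb G).valency0 ((Xcomb G).end0 x) = 1 → False := fun h1 h2 =>
    mulRight_s₀_ne_of_mem hC h1 (valency0_eq_one_iff.mp h2)
  have him : ∀ {q : ℍ}, q.re = 0 → 0 < q.re → False := fun h1 h2 => h2.ne' h1
  rcases s with ⟨x, h⟩ | ⟨x, h, _ | _⟩ | ⟨x, h, _ | _⟩ <;>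
    rcases t with ⟨y, h'⟩ | ⟨y, h', _ | _⟩ | ⟨y, h', _ | _⟩ <;>
    obtain rfl : y = x := hst'
  · exact absurd rfl hst
  · exact (hfe h h').elim
  · exact (hfe h h').elim
  · exact (him hs (re_pos_of_mem_rhoToZero ht)).elim
  · exact (him hs (re_pos_of_mem_rhoToInfty ht)).elim
  · exact (hfe h' h).elim
  · exact absurd rfl hst
  · exact extremities_iToZero ▸ iToInfty_inter_iToZero ▸ ⟨ht, hs⟩
  · exact (him hs.1 (re_pos_of_mem_rhoToZero ht)).elim
  · exact (him hs.1 (re_pos_of_mem_rhoToInfty ht)).elim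
  · exact (hfe h' h).elim
  · exact extremities_iToInfty ▸ iToInfty_inter_iToZero ▸ ⟨hs, ht⟩
  · exact absurd rfl hst
  · exact (him hs.1 (re_pos_of_mem_rhoToZero ht)).elim
  · exact (him hs.1 (re_pos_of_mem_rhoToInfty ht)).elim
  · exact (him ht (re_pos_of_mem_rhoToZero hs)).elim
  · exact (him ht.1 (re_pos_of_mem_rhoToZero hs)).elim
  · exact (him ht.1 (re_pos_of_mem_rhoToZero hs)).elim
  · exact absurd rfl hst
  · exact extremities_rhoToZero ▸ rhoToInfty_inter_rhoToZero ▸ ⟨ht, hs⟩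
  · exact (him ht (re_pos_of_mem_rhoToInfty hs)).elim
  · exact (him ht.1 (re_pos_of_mem_rhoToInfty hs)).elim
  · exact (him ht.1 (re_pos_of_mem_rhoToInfty hs)).elim
  · exact extremities_rhoToInfty ▸ rhoToInfty_inter_rhoToZero ▸ ⟨hs, ht⟩
  · exact absurd rfl hst

/-- If two different labels gave the same arc, then all its points would be extremities; but there
is at most one extremity, and an arc has more points. -/
theorem sideSet_injective (hC : ∀ v ∈ C, (Xcomb G).valency0 v = 2)
    (hX' : ((Xcomb G).cut C).IsTree) (hj : (treeProj G).comp j = (Xcomb G).cutProj C) :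
    Function.Injective (sideSet j) := by
  intro s t h
  by_contra hst
  refine not_subsingleton_iff.mpr (isGeodesicArc_sideSet (j := j) s).nontrivial
    ((extremities_sideSet_subsingleton (j := j) s).anti fun p hp => ?_)
  exact mem_extremities_of_mem_inter hC hX' hj hst hp (h ▸ hp)

/-! ### The boundary of the polygon -/

/-- At a point of a side, the triangle across this side would have to belong to P if P were a
neighbourhood. -/
theorem not_mem_interior_of_mem_sideSet (hC : ∀ v ∈ C, (Xcomb G).valency0 v = 2)
    (hX' : ((Xcomb G).cut C).IsTree) (hj : (treeProj G).comp j = (Xcomb G).cutProj C)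
    {s : Side G C} {p : ℍ} (hp : p ∈ sideSet j s) : polygon j ∉ 𝓝 p := by
  intro hP
  rw [sideSet_eq] at hp
  have h_s₀ : p ∈ edgeElt j (sideEdge s) • imagAxis →
      ((Xcomb G).end0 (sideEdge s) ∈ C ∨
        (Xcomb G).valency0 ((Xcomb G).end0 (sideEdge s)) = 1) → False := fun h1 h2 => by
    obtain ⟨y, hy⟩ := mem_range_of_mem_smul_triangle hP
      (smul_imagAxis_subset_mul_s₀_smul_triangle _ h1)
    exact edgeElt_ne_mul_s₀ hC hX' hj h2 y hy
  rcases s with ⟨x, h⟩ | ⟨x, h, _ | _⟩ | ⟨x, h, _ | _⟩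
  · exact h_s₀ hp (.inl h)
  · exact h_s₀ (smul_set_mono iToZero_subset_imagAxis hp) (.inr h)
  · exact h_s₀ (smul_set_mono iToInfty_subset_imagAxis hp) (.inr h)
  · have h1 : rhoToZero ⊆ u₁ • triangle := by
      rw [← u₁_smul_rhoToInfty]; exact smul_set_mono rhoToInfty_subset_triangle
    have h2 : p ∈ (edgeElt j x * u₁) • triangle := by
      rw [mul_smul]; exact smul_set_mono h1 hp
    obtain ⟨y, hy⟩ := mem_range_of_mem_smul_triangle hP h2
    exact edgeElt_ne_mul_u₁ hC hX' hj h y hy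
  · have h1 : rhoToInfty ⊆ u₁⁻¹ • triangle := by
      rw [subset_smul_set_iff, inv_inv, u₁_smul_rhoToInfty]; exact rhoToZero_subset_triangle
    have h2 : p ∈ (edgeElt j x * u₁⁻¹) • triangle := by
      rw [mul_smul]; exact smul_set_mono h1 hp
    obtain ⟨y, hy⟩ := mem_range_of_mem_smul_triangle hP h2
    exact edgeElt_ne_mul_u₁_inv hC hX' hj h y hy

theorem smul_union_s₀_subset_polygon (hj : (treeProj G).comp j = (Xcomb G).cutProj C)
    {x : RCoset G} (h1 : (Xcomb G).end0 x ∉ C)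
    (h2 : (Xcomb G).valency0 ((Xcomb G).end0 x) ≠ 1) :
    edgeElt j x • (triangle ∪ s₀ • triangle) ⊆ polygon j := by
  rw [smul_set_union, smul_smul,
    ← edgeElt_mulRight_s₀ hj h1 (mt valency0_eq_one_iff.mpr h2)]
  exact union_subset (smul_triangle_subset_polygon _) (smul_triangle_subset_polygon _)

/-- A G₁-orbit has one or three elements, and in the second case all three triangles around ρ belong
to P. -/
theorem smul_idealTriangle_subset_polygon (hj : (treeProj G).comp j = (Xcomb G).cutProj C)
    {x : RCoset G} (h : (Xcomb G).valency1 ((Xcomb G).end1 x) ≠ 1) :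
    edgeElt j x • idealTriangle ⊆ polygon j := by
  have h1 : x.mulRight u₁ ≠ x := mt valency1_eq_one_iff.mpr h
  have h2 : (x.mulRight u₁).mulRight u₁ ≠ x.mulRight u₁ := fun h2 => by
    have h3 := x.mulRight_u₁_u₁_u₁
    rw [h2, h2] at h3
    exact h1 h3
  rw [idealTriangle_eq, smul_set_union, smul_set_union, smul_smul, smul_smul, u₁_inv, ← mul_assoc,
    ← edgeElt_mulRight_u₁ hj h1, ← edgeElt_mulRight_u₁ hj h2]
  exact union_subset (smul_triangle_subset_polygon _)
    (union_subset (smul_triangle_subset_polygon _) (smul_triangle_subset_polygon _))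

theorem triangle_mem_nhds {p : ℍ} (hp : p ∈ triangle) (h0 : 0 < p.re) (h1 : p ∉ rhoToInfty)
    (h2 : p ∉ rhoToZero) : triangle ∈ 𝓝 p := by
  rw [mem_triangle_iff] at hp
  rw [mem_rhoToInfty_iff] at h1
  rw [mem_rhoToZero_iff] at h2
  have h3 : p.re < 1 / 2 := hp.2.1.lt_of_ne fun h => h1 ⟨h, by linarith [hp.2.2]⟩
  have h4 : 2 * p.re < sqNorm p := hp.2.2.lt_of_ne fun h => h2 ⟨hp.2.1, h.symm⟩
  have hc := UpperHalfPlane.continuous_re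
  filter_upwards [continuousAt_const.eventually_lt hc.continuousAt h0,
    hc.continuousAt.eventually_lt continuousAt_const h3,
    (continuous_const.mul hc).continuousAt.eventually_lt continuous_sqNorm.continuousAt h4]
    with z h1 h2 h3
  exact mem_triangle_iff.mpr ⟨h1.le, h2.le, h3.le⟩

theorem smul_mem_nhds_of_inv_smul {A : Set ℍ} {γ : PSL2Z} {p : ℍ} (h : A ∈ 𝓝 (γ⁻¹ • p)) :
    γ • A ∈ 𝓝 p := by
  have := smul_mem_nhds_smul γ h
  rwa [smul_inv_smul] at this

/-- Away from the sides, P contains a neighbourhood: both triangles along the imaginary axis, the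
whole ideal triangle around ρ, or the interior of △. -/
theorem exists_sideSet_of_mem_polygon (hj : (treeProj G).comp j = (Xcomb G).cutProj C)
    {p : ℍ} (hp : p ∈ polygon j) (hP : polygon j ∉ 𝓝 p) : ∃ s, p ∈ sideSet j s := by
  obtain ⟨x, hx⟩ := mem_iUnion.mp hp
  rw [mem_smul_set_iff_inv_smul_mem] at hx
  have himp : ∀ A, edgeElt j x • A ⊆ polygon j → A ∉ 𝓝 ((edgeElt j x)⁻¹ • p) := fun A h1 h2 =>
    hP (mem_of_superset (smul_mem_nhds_of_inv_smul h2) h1)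
  have hmem : ∀ s : Side G C, sideEdge s = x → (edgeElt j x)⁻¹ • p ∈ sideBase s →
      p ∈ sideSet j s := fun s h1 h2 => by
    rw [sideSet_eq, h1]; exact mem_smul_set_iff_inv_smul_mem.mpr h2
  rcases (mem_triangle_iff.mp hx).1.eq_or_lt with h0 | h0
  · by_cases h1 : (Xcomb G).end0 x ∈ C
    · exact ⟨.free x h1, hmem _ rfl h0.symm⟩
    · by_cases h2 : (Xcomb G).valency0 ((Xcomb G).end0 x) = 1
      · have h3 : (edgeElt j x)⁻¹ • p ∈ iToInfty ∪ iToZero := by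
          rw [iToInfty_union_iToZero]; exact h0.symm
        rcases h3 with h3 | h3
        exacts [⟨.even x h2 true, hmem _ rfl h3⟩, ⟨.even x h2 false, hmem _ rfl h3⟩]
      · exact absurd (union_s₀_smul_triangle_mem_nhds h0.symm)
          (himp _ (smul_union_s₀_subset_polygon hj h1 h2))
  · by_cases h : (Xcomb G).valency1 ((Xcomb G).end1 x) = 1
    · by_contra hne
      push Not at hne
      exact himp triangle (smul_triangle_subset_polygon x) (triangle_mem_nhds hx h0
        (fun h' => hne (.odd x h true) (hmem _ rfl h'))
        (fun h' => hne (.odd x h false) (hmem _ rfl h')))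
    · exact absurd (idealTriangle_mem_nhds hx h0) (himp _ (smul_idealTriangle_subset_polygon hj h))

theorem frontier_polygon (hC : ∀ v ∈ C, (Xcomb G).valency0 v = 2)
    (hX' : ((Xcomb G).cut C).IsTree) (hj : (treeProj G).comp j = (Xcomb G).cutProj C) :
    frontier (polygon j) = ⋃ s, sideSet j s := by
  rw [(isClosed_polygon hj).frontier_eq]
  ext p
  rw [Set.mem_sdiff, mem_interior_iff_mem_nhds, mem_iUnion]
  constructor
  · rintro ⟨h1, h2⟩
    exact exists_sideSet_of_mem_polygon hj h1 h2
  · rintro ⟨s, hs⟩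
    exact ⟨sideSet_subset_polygon s hs, not_mem_interior_of_mem_sideSet hC hX' hj hs⟩

theorem nonempty_interior_polygon : (interior (polygon j)).Nonempty := by
  obtain ⟨z, hz⟩ := triangleCore_nonempty
  refine ⟨edgeElt j (RCoset.of G 1) • z, interior_mono (smul_triangle_subset_polygon (RCoset.of G 1)) ?_⟩
  rw [interior_smul]
  exact smul_mem_smul_set (triangleCore_subset_interior hz)

/-! ### Convexity -/

/-- The half-plane that is bounded by the geodesic containing a side and contains the
polygon. -/
def sideHalf (j : ((Xcomb G).cut C).Hom treeT) : Side G C → Set ℍ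
  | .free x _ => edgeElt j x • rightHalf 0
  | .even x _ _ => edgeElt j x • rightHalf 0
  | .odd x _ true => edgeElt j x • leftHalf (1 / 2)
  | .odd x _ false => (edgeElt j x * u₁) • rightHalf (1 / 2)

theorem hypConvex_sideHalf (s : Side G C) : HypConvex (sideHalf j s) := by
  rcases s with ⟨x, h⟩ | ⟨x, h, b⟩ | ⟨x, h, _ | _⟩
  exacts [hypConvex_smul (hypConvex_rightHalf 0) _, hypConvex_smul (hypConvex_rightHalf 0) _,
    hypConvex_smul (hypConvex_rightHalf _) _, hypConvex_smul (hypConvex_leftHalf _) _]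

theorem kleinConvex_sideHalf (s : Side G C) : KleinConvex (sideHalf j s) := by
  rcases s with ⟨x, h⟩ | ⟨x, h, b⟩ | ⟨x, h, _ | _⟩
  exacts [kleinConvex_smul_rightHalf _ _, kleinConvex_smul_rightHalf _ _,
    kleinConvex_smul_rightHalf _ _, kleinConvex_smul_leftHalf _ _]

/-- Walk through X' from x, in coordinates in which j(x) is the identity. Only an s₀-step between 1
and s₀ crosses the imaginary axis, and the edge s₀ is not in the image of X'. -/
theorem smul_triangle_subset_rightHalf (hC : ∀ v ∈ C, (Xcomb G).valency0 v = 2)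
    (hX' : ((Xcomb G).cut C).IsTree) (hj : (treeProj G).comp j = (Xcomb G).cutProj C)
    {x : RCoset G}
    (hx : (Xcomb G).end0 x ∈ C ∨ (Xcomb G).valency0 ((Xcomb G).end0 x) = 1) (y : RCoset G) :
    ((edgeElt j x)⁻¹ * edgeElt j y) • triangle ⊆ rightHalf 0 := by
  refine cut_induction hX' (Q := fun y => ((edgeElt j x)⁻¹ * edgeElt j y) • triangle ⊆ rightHalf 0)
    (x₀ := x) ?_ ?_ ?_ y
  · rw [inv_mul_cancel, one_smul]
    exact fun z hz => hz.1
  · intro y hy ih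
    by_cases hne : y.mulRight s₀ = y
    · rwa [hne]
    · rw [edgeElt_mulRight_s₀ hj hy hne, ← mul_assoc]
      refine mul_s₀_smul_triangle_subset_rightHalf ih (fun h => ?_) fun h => ?_
      · obtain rfl := edgeElt_injective hj (inv_mul_eq_one.mp h)
        exact edgeElt_ne_mul_s₀ hC hX' hj hx _ (edgeElt_mulRight_s₀ hj hy hne)
      · exact edgeElt_ne_mul_s₀ hC hX' hj hx _ (inv_mul_eq_iff_eq_mul.mp h)
  · intro y ih
    by_cases hne : y.mulRight u₁ = y
    · rwa [hne]
    · rw [edgeElt_mulRight_u₁ hj hne, ← mul_assoc]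
      exact mul_u₁_smul_triangle_subset_rightHalf ih

/-- At an odd end of X' the only way out of △ is across the imaginary axis, so all other triangles
of P lie beyond it. The left half-plane is contained in both half-planes bounded by the sides at ρ.
-/
theorem smul_triangle_subset_leftHalf
    (hX' : ((Xcomb G).cut C).IsTree) (hj : (treeProj G).comp j = (Xcomb G).cutProj C)
    {x : RCoset G} (hx : (Xcomb G).valency1 ((Xcomb G).end1 x) = 1) (y : RCoset G) :
    y = x ∨ ((edgeElt j x)⁻¹ * edgeElt j y) • triangle ⊆ leftHalf 0 := by
  refine cut_induction hX' (Q := fun y => y = x ∨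
    ((edgeElt j x)⁻¹ * edgeElt j y) • triangle ⊆ leftHalf 0) (x₀ := x) (.inl rfl) ?_ ?_ y
  · intro y hy ih
    by_cases hne : y.mulRight s₀ = y
    · rwa [hne]
    · have e : (edgeElt j x)⁻¹ * edgeElt j (y.mulRight s₀) =
          (edgeElt j x)⁻¹ * edgeElt j y * s₀ := by
        rw [edgeElt_mulRight_s₀ hj hy hne, mul_assoc]
      rcases ih with rfl | ih
      · right
        rw [e, inv_mul_cancel, one_mul]
        exact fun z hz => (mem_s₀_smul_triangle_iff.mp hz).1
      · by_cases h1 : (edgeElt j x)⁻¹ * edgeElt j y = 1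
        · right
          rw [e, h1, one_mul]
          exact fun z hz => (mem_s₀_smul_triangle_iff.mp hz).1
        · by_cases h2 : (edgeElt j x)⁻¹ * edgeElt j y = s₀
          · left
            rw [h2, s₀_mul_self, inv_mul_eq_one] at e
            exact (edgeElt_injective hj e).symm
          · right
            rw [e]
            exact mul_s₀_smul_triangle_subset_leftHalf ih h1 h2
  · intro y ih
    by_cases hne : y.mulRight u₁ = y
    · rwa [hne]
    · rcases ih with rfl | ih
      · exact absurd (valency1_eq_one_iff.mp hx) hne
      · right
        rw [edgeElt_mulRight_u₁ hj hne, ← mul_assoc]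
        exact mul_u₁_smul_triangle_subset_leftHalf ih

end

section

variable {G : Subgroup PSL2Z} {C : Set (Xcomb G).Vert0} {j : ((Xcomb G).cut C).Hom treeT}

theorem polygon_subset_sideHalf (hC : ∀ v ∈ C, (Xcomb G).valency0 v = 2)
    (hX' : ((Xcomb G).cut C).IsTree) (hj : (treeProj G).comp j = (Xcomb G).cutProj C)
    (s : Side G C) : polygon j ⊆ sideHalf j s := by
  refine iUnion_subset fun y => ?_
  have h_right : ∀ x, (Xcomb G).end0 x ∈ C ∨ (Xcomb G).valency0 ((Xcomb G).end0 x) = 1 →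
      edgeElt j y • triangle ⊆ edgeElt j x • rightHalf 0 := fun x hx => by
    rw [subset_smul_set_iff, smul_smul]
    exact smul_triangle_subset_rightHalf hC hX' hj hx y
  have h_left : ∀ x (A : Set ℍ), (Xcomb G).valency1 ((Xcomb G).end1 x) = 1 → triangle ⊆ A →
      leftHalf 0 ⊆ A → edgeElt j y • triangle ⊆ edgeElt j x • A := fun x A hx h1 h2 => by
    rw [subset_smul_set_iff, smul_smul]
    rcases smul_triangle_subset_leftHalf hX' hj hx y with rfl | h
    · rwa [inv_mul_cancel, one_smul]
    · exact h.trans h2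
  rcases s with ⟨x, h⟩ | ⟨x, h, b⟩ | ⟨x, h, _ | _⟩
  · exact h_right x (.inl h)
  · exact h_right x (.inr h)
  · rw [sideHalf, mul_smul]
    refine h_left x _ h (fun z hz => ?_) fun z (hz : z.re ≤ 0) => ?_
    · exact mem_u₁_smul_rightHalf_iff.mpr (mem_triangle_iff.mp hz).2.2
    · exact mem_u₁_smul_rightHalf_iff.mpr (by linarith [sqNorm_pos z])
  · exact h_left x _ h (fun z hz => hz.2.1) fun z (hz : z.re ≤ 0) => hz.trans (by norm_num)

/-- Either P contains a full standard neighbourhood of p, or the half-planes of the sides at this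
triangle cut the standard neighbourhood down to △. -/
theorem exists_nhds_inter_subset_polygon (hj : (treeProj G).comp j = (Xcomb G).cutProj C)
    {p : ℍ} (hp : p ∈ polygon j) :
    ∃ N ∈ 𝓝 p, N ∩ ⋂ s, sideHalf j s ⊆ polygon j := by
  obtain ⟨x, hx⟩ := mem_iUnion.mp hp
  rw [mem_smul_set_iff_inv_smul_mem] at hx
  have h_right : triangle ∪ s₀ • triangle ∈ 𝓝 ((edgeElt j x)⁻¹ • p) →
      ∀ s : Side G C, sideHalf j s = edgeElt j x • rightHalf 0 →
      ∃ N ∈ 𝓝 p, N ∩ ⋂ s, sideHalf j s ⊆ polygon j := fun h0 s hs => by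
    refine ⟨_, smul_mem_nhds_of_inv_smul h0, ?_⟩
    rintro _ ⟨⟨z, hz, rfl⟩, h2⟩
    refine smul_triangle_subset_polygon x (smul_mem_smul_set ?_)
    have h3 := mem_iInter.mp h2 s
    rw [hs] at h3
    have h4 : 0 ≤ z.re := (smul_mem_smul_set_iff.mp h3 :)
    rcases hz with hz | hz
    · exact hz
    · exact imagAxis_subset_triangle (le_antisymm (mem_s₀_smul_triangle_iff.mp hz).1 h4)
  rcases (mem_triangle_iff.mp hx).1.eq_or_lt with h0 | h0
  · have h0' := union_s₀_smul_triangle_mem_nhds h0.symm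
    by_cases h1 : (Xcomb G).end0 x ∈ C
    · exact h_right h0' (.free x h1) rfl
    · by_cases h2 : (Xcomb G).valency0 ((Xcomb G).end0 x) = 1
      · exact h_right h0' (.even x h2 true) rfl
      · exact ⟨_, smul_mem_nhds_of_inv_smul h0',
          inter_subset_left.trans (smul_union_s₀_subset_polygon hj h1 h2)⟩
  · have h0' := idealTriangle_mem_nhds hx h0
    refine ⟨_, smul_mem_nhds_of_inv_smul h0', ?_⟩
    by_cases h : (Xcomb G).valency1 ((Xcomb G).end1 x) = 1
    · rintro _ ⟨⟨z, hz, rfl⟩, h2⟩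
      have h3 : edgeElt j x • z ∈ edgeElt j x • leftHalf (1 / 2) :=
        mem_iInter.mp h2 (.odd x h true)
      have h4 : edgeElt j x • z ∈ (edgeElt j x * u₁) • rightHalf (1 / 2) :=
        mem_iInter.mp h2 (.odd x h false)
      rw [mul_smul] at h4
      have h5 : z.re ≤ 1 / 2 := (smul_mem_smul_set_iff.mp h3 :)
      have h6 := mem_u₁_smul_rightHalf_iff.mp (smul_mem_smul_set_iff.mp h4)
      exact smul_triangle_subset_polygon x
        (smul_mem_smul_set (mem_triangle_iff.mpr ⟨hz.1, h5, h6⟩))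
    · exact inter_subset_left.trans (smul_idealTriangle_subset_polygon hj h)

/-- The polygon is the intersection of the half-planes bounded by its sides. -/
theorem polygon_eq_iInter_sideHalf (hC : ∀ v ∈ C, (Xcomb G).valency0 v = 2)
    (hX' : ((Xcomb G).cut C).IsTree) (hj : (treeProj G).comp j = (Xcomb G).cutProj C) :
    polygon j = ⋂ s, sideHalf j s := by
  refine (subset_iInter (polygon_subset_sideHalf hC hX' hj)).antisymm fun q hq => ?_
  by_contra hqP
  obtain ⟨p, hp⟩ := (nonempty_interior_polygon (j := j)).mono interior_subset
  have hconn : IsPreconnected (⋂ s, sideHalf j s) :=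
    (kleinConvex_iInter kleinConvex_sideHalf).isPreconnected
  -- U is an open set meeting the intersection of the half-planes exactly in P, so a point q outside
  -- P would disconnect this intersection.
  let U : Set ℍ := ⋃₀ {V | IsOpen V ∧ V ∩ ⋂ s, sideHalf j s ⊆ polygon j}
  have hpU : polygon j ⊆ U := fun r hr => by
    obtain ⟨N, hN, h⟩ := exists_nhds_inter_subset_polygon hj hr
    obtain ⟨V, hVN, hV, hrV⟩ := mem_nhds_iff.mp hN
    exact ⟨V, ⟨hV, (inter_subset_inter_left _ hVN).trans h⟩, hrV⟩
  obtain ⟨r, hrD, ⟨V, ⟨-, hV⟩, hrV⟩, hrP⟩ := hconn U (polygon j)ᶜ (isOpen_sUnion fun V hV => hV.1)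
    (isClosed_polygon hj).isOpen_compl
    (fun r _ => (em (r ∈ polygon j)).imp (fun h => hpU h) id)
    ⟨p, mem_iInter.mpr fun s => polygon_subset_sideHalf hC hX' hj s hp, hpU hp⟩ ⟨q, hq, hqP⟩
  exact hrP (hV ⟨hrV, hrD⟩)

theorem isConvexPolygon_polygon (hC : ∀ v ∈ C, (Xcomb G).valency0 v = 2)
    (hX' : ((Xcomb G).cut C).IsTree) (hj : (treeProj G).comp j = (Xcomb G).cutProj C) :
    IsConvexPolygon (polygon j) (sideSet j) where
  isClosed := isClosed_polygon hj
  convex := by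
    rw [polygon_eq_iInter_sideHalf hC hX' hj]
    exact hypConvex_iInter hypConvex_sideHalf
  nonempty_interior := nonempty_interior_polygon
  frontier_eq := frontier_polygon hC hX' hj
  geodesic := isGeodesicArc_sideSet
  locallyFinite := locallyFinite_sideSet hj
  injective := sideSet_injective hC hX' hj
  inter_subset _ _ hst _ hp := ⟨mem_extremities_of_mem_inter hC hX' hj hst hp.1 hp.2,
    mem_extremities_of_mem_inter hC hX' hj hst.symm hp.2 hp.1⟩

/-! ### The special polygon -/

theorem isCopy_imagAxis (x : RCoset G) (h : (Xcomb G).end0 x ∈ C) :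
    IsCopy (sideSet j (.free x h)) imagAxis := ⟨_, rfl⟩

theorem isCopy_iToInfty (x : RCoset G) (h) (b : Bool) :
    IsCopy (sideSet j (.even x h b : Side G C)) iToInfty := by
  cases b
  · exact ⟨edgeElt j x * s₀, by rw [mul_smul, s₀_smul_iToInfty]; rfl⟩
  · exact ⟨_, rfl⟩

theorem isCopy_rhoToInfty (x : RCoset G) (h) (b : Bool) :
    IsCopy (sideSet j (.odd x h b : Side G C)) rhoToInfty := by
  cases b
  · exact ⟨edgeElt j x * u₁, by rw [mul_smul, u₁_smul_rhoToInfty]; rfl⟩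
  · exact ⟨_, rfl⟩

theorem isSpecialPolygon_polygon (hC : ∀ v ∈ C, (Xcomb G).valency0 v = 2)
    (hX' : ((Xcomb G).cut C).IsTree) (hj : (treeProj G).comp j = (Xcomb G).cutProj C) :
    IsSpecialPolygon (polygon j) (sideSet j) sigma where
  polygon := isConvexPolygon_polygon hC hX' hj
  involutive := sigma_sigma
  types s := by
    rcases s with ⟨x, h⟩ | ⟨x, h, b⟩ | ⟨x, h, b⟩
    exacts [.inl (isCopy_imagAxis x h), .inr (.inl (isCopy_iToInfty x h b)),
      .inr (.inr (isCopy_rhoToInfty x h b))]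
  free s hs := by
    rcases s with ⟨x, h⟩ | ⟨x, h, b⟩ | ⟨x, h, b⟩
    · exact ⟨sigma_ne hC _, isCopy_imagAxis _ _⟩
    · exact absurd (isCopy_iToInfty x h b) (not_isCopy_imagAxis_iToInfty hs)
    · exact absurd (isCopy_rhoToInfty x h b) (not_isCopy_imagAxis_rhoToInfty hs)
  even s hs := by
    rcases s with ⟨x, h⟩ | ⟨x, h, b⟩ | ⟨x, h, b⟩
    · exact absurd hs (not_isCopy_imagAxis_iToInfty (isCopy_imagAxis x h))
    · refine ⟨sigma_ne hC _, isCopy_iToInfty x h _, ?_⟩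
      cases b
      · exact adjacentWithAngle_iToInfty_iToZero.symm.smul _
      · exact adjacentWithAngle_iToInfty_iToZero.smul _
    · exact absurd (isCopy_rhoToInfty x h b) (not_isCopy_iToInfty_rhoToInfty hs)
  odd s hs := by
    rcases s with ⟨x, h⟩ | ⟨x, h, b⟩ | ⟨x, h, b⟩
    · exact absurd hs (not_isCopy_imagAxis_rhoToInfty (isCopy_imagAxis x h))
    · exact absurd hs (not_isCopy_iToInfty_rhoToInfty (isCopy_iToInfty x h b))
    · refine ⟨sigma_ne hC _, isCopy_rhoToInfty x h _, ?_⟩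
      cases b
      · exact adjacentWithAngle_rhoToInfty_rhoToZero.symm.smul _
      · exact adjacentWithAngle_rhoToInfty_rhoToZero.smul _

/-! ### The side pairings -/

/-- A common interior point lies in a triangle j(x)△ that must also be a triangle gj(y)△ of gP. Then
x = y as cosets, and g = 1. -/
theorem disjoint_interior_smul_polygon (hj : (treeProj G).comp j = (Xcomb G).cutProj C)
    {g : PSL2Z} (hg : g ∈ G) (hne : g ≠ 1) :
    Disjoint (interior (g • polygon j)) (interior (polygon j)) := by
  rw [Set.disjoint_left]
  intro p h1 h2
  obtain ⟨x, hx⟩ := mem_iUnion.mp (interior_subset h2)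
  obtain ⟨y, hy⟩ := mem_of_mem_smul_triangle (L := range fun y => g * edgeElt j y)
    (mem_interior_iff_mem_nhds.mp h1)
    (by
      rw [biUnion_range, polygon, smul_set_iUnion]
      simp only [mul_smul]
      exact subset_rfl) hx
  have hxy : y = x := by
    rw [← of_edgeElt hj x, ← hy, RCoset.of_mul_left hg, of_edgeElt hj]
  rw [hxy] at hy
  exact hne (mul_eq_right.mp hy)

theorem sidePairing_smul_sideSet (s : Side G C) :
    sidePairing j s • sideSet j s = sideSet j (sigma s) := by
  rcases s with ⟨x, h⟩ | ⟨x, h, _ | _⟩ | ⟨x, h, _ | _⟩ <;>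
    simp only [sidePairing, sideSet, sigma, smul_smul, inv_mul_cancel_right, Bool.not_true,
      Bool.not_false] <;> rw [mul_smul]
  · rw [s₀_smul_imagAxis]
  · rw [← s₀_smul_iToInfty, smul_smul s₀, s₀_mul_self, one_smul]
  · rw [s₀_smul_iToInfty]
  · rw [← u₁_smul_rhoToInfty, inv_smul_smul]
  · rw [u₁_smul_rhoToInfty]

theorem eq_s₀_of_smul_eq {γ : PSL2Z} {A B : Set ℍ} (hA : A.Nonempty) (hA' : A ⊆ imagAxis)
    (hB' : B ⊆ imagAxis) (hne : A ≠ B) (h : γ • A = B) : γ = s₀ := by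
  obtain ⟨z, hz⟩ := hA
  rcases eq_one_or_s₀_of_mem (smul_mem_smul_set (imagAxis_subset_triangle (hA' hz)))
    (hB' (h ▸ smul_mem_smul_set hz)) with rfl | h'
  · exact absurd ((one_smul _ A).symm.trans h) hne
  · exact h'

theorem eq_u₁_of_smul_rhoToInfty_eq {γ : PSL2Z} (h : γ • rhoToInfty = rhoToZero) : γ = u₁ := by
  have hz : rho ∈ rhoToInfty := ⟨rfl, le_rfl⟩
  have hz' : γ • rho ∈ rhoToZero := h ▸ smul_mem_smul_set hz
  rcases eq_one_or_u₁_of_mem (rhoToZero_subset_triangle hz')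
    (smul_mem_smul_set (rhoToInfty_subset_triangle hz)) (re_pos_of_mem_rhoToZero hz') with
    rfl | h' | rfl
  · exact absurd ((one_smul _ rhoToInfty).symm.trans h) rhoToInfty_ne_rhoToZero
  · exact h'
  · refine absurd ?_ rhoToInfty_ne_rhoToZero
    rw [u₁_inv, mul_smul, u₁_smul_rhoToInfty, ← u₁_smul_rhoToInfty] at h
    have h2 := smul_left_cancel u₁ h
    rw [← h2, u₁_smul_rhoToInfty]

theorem pairsSides_iff (hC : ∀ v ∈ C, (Xcomb G).valency0 v = 2)
    (hX' : ((Xcomb G).cut C).IsTree) (hj : (treeProj G).comp j = (Xcomb G).cutProj C)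
    (s : Side G C) (γ : PSL2Z) :
    PairsSides (polygon j) (sideSet j s) (sideSet j (sigma s)) γ ↔ γ = sidePairing j s := by
  constructor
  swap
  · rintro rfl
    exact ⟨sidePairing_smul_sideSet s, disjoint_interior_smul_polygon hj (sidePairing_mem hj s)
      (sidePairing_ne_one hC hX' hj s)⟩
  rintro ⟨h1, h2⟩
  -- Both sides are moved back to the standard triangle, where few elements of Γ take one standard
  -- side to the other.
  have hsmul : ((edgeElt j (sideEdge (sigma s)))⁻¹ * γ * edgeElt j (sideEdge s)) • sideBase s =
      sideBase (sigma s) := by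
    rw [sideSet_eq, sideSet_eq] at h1
    rw [mul_smul, mul_smul, h1, inv_smul_smul]
  have hγ : ∀ δ, (edgeElt j (sideEdge (sigma s)))⁻¹ * γ * edgeElt j (sideEdge s) = δ →
      γ = edgeElt j (sideEdge (sigma s)) * δ * (edgeElt j (sideEdge s))⁻¹ := by
    rintro _ rfl; group
  rcases s with ⟨x, h⟩ | ⟨x, h, _ | _⟩ | ⟨x, h, _ | _⟩
  · rcases eq_one_or_s₀_of_smul_imagAxis_subset hsmul.subset with h3 | h3
    -- For a free side, γ might also preserve the induced orientations; then γP and P share the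
    -- triangle j(xs₀)△, against the disjointness of the interiors.
    · have h4 : γ * edgeElt j x = edgeElt j (x.mulRight s₀) := by
        rw [hγ _ h3, mul_one]; exact inv_mul_cancel_right _ _
      obtain ⟨z, hz⟩ := triangleCore_nonempty
      have h5 : ∀ y, edgeElt j y • z ∈ interior (edgeElt j y • triangle) := fun y => by
        rw [interior_smul]; exact smul_mem_smul_set (triangleCore_subset_interior hz)
      have h6 : edgeElt j (x.mulRight s₀) • triangle ⊆ γ • polygon j := by
        rw [← h4, mul_smul]; exact smul_set_mono (smul_triangle_subset_polygon x)
      exact absurd (interior_mono (smul_triangle_subset_polygon _) (h5 (x.mulRight s₀)))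
        (Set.disjoint_left.mp h2 (interior_mono h6 (h5 _)))
    · exact hγ _ h3
  · exact hγ _ (eq_s₀_of_smul_eq (isGeodesicArc_iToZero.nontrivial.nonempty)
      iToZero_subset_imagAxis iToInfty_subset_imagAxis iToInfty_ne_iToZero.symm hsmul)
  · exact hγ _ (eq_s₀_of_smul_eq (isGeodesicArc_iToInfty.nontrivial.nonempty)
      iToInfty_subset_imagAxis iToZero_subset_imagAxis iToInfty_ne_iToZero hsmul)
  · refine hγ _ (inv_eq_iff_eq_inv.mp (eq_u₁_of_smul_rhoToInfty_eq ?_))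
    rw [inv_smul_eq_iff]
    exact hsmul.symm
  · exact hγ _ (eq_u₁_of_smul_rhoToInfty_eq hsmul)

end

end ModularPolygon

end
-- The theorem
theorem mainTheorem2 (G : Subgroup ModularPolygon.PSL2Z)
    (C : Set (ModularPolygon.Xcomb G).Vert0)
    (hC : ∀ v ∈ C, (ModularPolygon.Xcomb G).valency0 v = 2)
    (hX' : ((ModularPolygon.Xcomb G).cut C).IsTree)
    (j : ((ModularPolygon.Xcomb G).cut C).Hom ModularPolygon.treeT)
    (hj : (ModularPolygon.treeProj G).comp j = (ModularPolygon.Xcomb G).cutProj C) :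
    (ModularPolygon.IsSpecialPolygon (ModularPolygon.polygon j) (ModularPolygon.sideSet j)
        ModularPolygon.sigma ∧
      (G.FiniteIndex → Finite (ModularPolygon.Side G C))) ∧
    (∀ (s : ModularPolygon.Side G C) (γ : ModularPolygon.PSL2Z),
      ModularPolygon.PairsSides (ModularPolygon.polygon j) (ModularPolygon.sideSet j s)
        (ModularPolygon.sideSet j (ModularPolygon.sigma s)) γ ↔
      γ = ModularPolygon.sidePairing j s) ∧
    ∃ hG : ∀ s : ModularPolygon.Side G C, ModularPolygon.sidePairing j s ∈ G,
      ∀ S : Set (ModularPolygon.Side G C),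
        (∀ s, ∃! t, t ∈ S ∧ (t = s ∨ t = ModularPolygon.sigma s)) →
        Set.InjOn (ModularPolygon.sidePairing j) S ∧
        ModularPolygon.IsIndependentGeneratingSet
          ((fun s => (⟨ModularPolygon.sidePairing j s, hG s⟩ : G)) '' S) := by
  refine ⟨⟨ModularPolygon.isSpecialPolygon_polygon hC hX' hj, ModularPolygon.finite_side⟩,
    ModularPolygon.pairsSides_iff hC hX' hj, ModularPolygon.sidePairing_mem hj, fun S hS => ⟨?_,
    ModularPolygon.isIndependentGeneratingSet hC hX' hj S hS⟩⟩
  intro s hs t ht h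
  by_contra hst
  refine ModularPolygon.sidePairing_ne hC hX' hj (s := s) (t := t) (Ne.symm hst) (fun h' => ?_) h
  obtain ⟨r, -, hr⟩ := hS s
  exact hst ((hr s ⟨hs, .inl rfl⟩).trans (hr t ⟨ht, .inr h'⟩).symm)
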